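/- Consider a normal-form game with finitely many players, namely $k$ followers and one leader, with nonempty finite action sets and rational payoffs, where the numbers of players and of actions are part of the input. Let $A_F$ be the set of pure action profiles of the followers and let $\Delta$ be the simplex of mixed strategies of the leader. For $x\in\Delta$, let $f(x)$ be the minimum, over all pure Nash equilibria $a\in A_F$ of the followers' game induced by $x$, of the leader's expected payoff at $(a,x)$, with $f(x)=-\infty$ if the followers' game induced by $x$ has no pure Nash equilibrium. The size of an instance is the total number of binary digits of all the (rational) entries of the payoff tables. There is an algorithm which, for every such game, halts after at most $2^{q(s)}$ steps, where $s$ is the size of the game and $q$ is a fixed polynomial, and returns the exact value of $\sup_{x\in\Delta} f(x)$ (a rational number or $-\infty$); whenever the supremum is attained, it also returns a (rational) strategy $x^*\in\Delta$ with $f(x^*)=\max_{x\in\Delta} f(x)$, and every strategy that it returns is such a maximiser. -/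

import Mathlib

namespace LeaderFollower

/-! ### A machine model with a step count

Programs compute on binary trees (nested pairs). Every elementary operation (taking the left or
right component of a pair, building a pair, composing, testing for the empty tree) costs one step.
This is the usual WHILE language over binary trees; it is deterministic, and its running time
agrees with that of Turing machines up to a polynomial, because in every step only a bounded number
of pointers is followed or created. -/

/-- Binary trees, the data on which programs compute. -/
inductive Data : Type
  | nil : Data
  | cons : Data → Data → Data
  deriving DecidableEq

/-- Left component (the left component of the empty tree is empty). -/
def Data.left : Data → Data
  | .nil => .nil
  | .cons a _ => a

/-- Right component (the right component of the empty tree is empty). -/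
def Data.right : Data → Data
  | .nil => .nil
  | .cons _ b => b

/-- Programs; each one maps an input tree to an output tree (if it terminates). -/
inductive Prog : Type
  | id : Prog
  | nil : Prog
  | left : Prog
  | right : Prog
  | cons : Prog → Prog → Prog
  | comp : Prog → Prog → Prog
  | ite : Prog → Prog → Prog → Prog
  | loop : Prog → Prog → Prog

/-- `Runs c v w t`: the program `c`, started on the input `v`, halts with the output `w` after
exactly `t` steps. -/
inductive Runs : Prog → Data → Data → ℕ → Prop
  | id (v : Data) : Runs .id v v 1
  | nil (v : Data) : Runs .nil v .nil 1
  | left (v : Data) : Runs .left v v.left 1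
  | right (v : Data) : Runs .right v v.right 1
  | cons {f g : Prog} {v a b : Data} {s t : ℕ} :
      Runs f v a s → Runs g v b t → Runs (.cons f g) v (.cons a b) (s + t + 1)
  | comp {g f : Prog} {v a b : Data} {s t : ℕ} :
      Runs f v a s → Runs g a b t → Runs (.comp g f) v b (s + t + 1)
  | ite_true {c f g : Prog} {v a b w : Data} {s t : ℕ} :
      Runs c v (.cons a b) s → Runs f v w t → Runs (.ite c f g) v w (s + t + 1)
  | ite_false {c f g : Prog} {v w : Data} {s t : ℕ} :
      Runs c v .nil s → Runs g v w t → Runs (.ite c f g) v w (s + t + 1)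
  | loop_true {c f : Prog} {v a b u w : Data} {s t r : ℕ} :
      Runs c v (.cons a b) s → Runs f v u t → Runs (.loop c f) u w r →
        Runs (.loop c f) v w (s + t + r + 1)
  | loop_false {c f : Prog} {v : Data} {s : ℕ} :
      Runs c v .nil s → Runs (.loop c f) v v (s + 1)

/-- The machine model is deterministic: output and number of steps are determined by the input. -/
theorem Runs.deterministic {c : Prog} {v w w' : Data} {t t' : ℕ}
    (h : Runs c v w t) (h' : Runs c v w' t') : w = w' ∧ t = t' := by
  induction h generalizing w' t' with
  | id v => cases h'; exact ⟨rfl, rfl⟩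
  | nil v => cases h'; exact ⟨rfl, rfl⟩
  | left v => cases h'; exact ⟨rfl, rfl⟩
  | right v => cases h'; exact ⟨rfl, rfl⟩
  | cons _ _ ih₁ ih₂ =>
    cases h' with
    | cons k₁ k₂ =>
      obtain ⟨rfl, rfl⟩ := ih₁ k₁
      obtain ⟨rfl, rfl⟩ := ih₂ k₂
      exact ⟨rfl, rfl⟩
  | comp _ _ ih₁ ih₂ =>
    cases h' with
    | comp k₁ k₂ =>
      obtain ⟨rfl, rfl⟩ := ih₁ k₁
      obtain ⟨rfl, rfl⟩ := ih₂ k₂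
      exact ⟨rfl, rfl⟩
  | ite_true _ _ ih₁ ih₂ =>
    cases h' with
    | ite_true k₁ k₂ =>
      obtain ⟨-, rfl⟩ := ih₁ k₁
      obtain ⟨rfl, rfl⟩ := ih₂ k₂
      exact ⟨rfl, rfl⟩
    | ite_false k₁ k₂ => exact absurd (ih₁ k₁).1 (by simp)
  | ite_false _ _ ih₁ ih₂ =>
    cases h' with
    | ite_true k₁ k₂ => exact absurd (ih₁ k₁).1 (by simp)
    | ite_false k₁ k₂ =>
      obtain ⟨-, rfl⟩ := ih₁ k₁
      obtain ⟨rfl, rfl⟩ := ih₂ k₂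
      exact ⟨rfl, rfl⟩
  | loop_true _ _ _ ih₁ ih₂ ih₃ =>
    cases h' with
    | loop_true k₁ k₂ k₃ =>
      obtain ⟨-, rfl⟩ := ih₁ k₁
      obtain ⟨rfl, rfl⟩ := ih₂ k₂
      obtain ⟨rfl, rfl⟩ := ih₃ k₃
      exact ⟨rfl, rfl⟩
    | loop_false k₁ => exact absurd (ih₁ k₁).1 (by simp)
  | loop_false _ ih₁ =>
    cases h' with
    | loop_true k₁ k₂ k₃ => exact absurd (ih₁ k₁).1 (by simp)
    | loop_false k₁ =>
      obtain ⟨-, rfl⟩ := ih₁ k₁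
      exact ⟨rfl, rfl⟩

/-! ### Binary encodings -/

/-- A list of trees as a right-nested tree. -/
def encList : List Data → Data
  | [] => .nil
  | a :: l => .cons a (encList l)

/-- A truth value (a bit) as a tree. -/
def encBool : Bool → Data
  | false => .nil
  | true => .cons .nil .nil

/-- A natural number as the list of its binary digits, least significant digit first. -/
def encNat (n : ℕ) : Data := encList (n.bits.map encBool)

/-- An integer as its sign (`true` for negative) and its absolute value. -/
def encInt (z : ℤ) : Data := .cons (encBool (decide (z < 0))) (encNat z.natAbs)

/-- A rational number as its numerator and its denominator, in lowest terms. -/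
def encRat (q : ℚ) : Data := .cons (encInt q.num) (encNat q.den)

/-- A vector of rational numbers as a list. -/
def encVec {l : ℕ} (x : Fin l → ℚ) : Data := encList (List.ofFn fun j => encRat (x j))

/-- An optional tree. -/
def encOption : Option Data → Data
  | none => .nil
  | some a => .cons a .nil

/-- A table indexed by the profiles `a = (a₁, …, aₖ)`, as a list (indexed by `a₁`) of lists
(indexed by `a₂`) … -/
def encTable : {k : ℕ} → (m : Fin k → ℕ) → (((p : Fin k) → Fin (m p)) → Data) → Data
  | 0, _, T => T (fun p => p.elim0)
  | _ + 1, m, T => encList (List.ofFn fun i : Fin (m 0) =>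
      encTable (fun p => m p.succ) (fun a => T (Fin.cons (α := fun p => Fin (m p)) i a)))

/-- The number of binary digits used for a rational number (at least `1`). -/
def bitSize (q : ℚ) : ℕ := q.num.natAbs.size + q.den.size

/-! ### Leader-follower games in normal form -/

/-- A normal-form game with rational payoffs, `k` followers and one leader (the last player).
Follower `p` has the actions `Fin (m p)`, the leader has the actions `Fin l`. -/
structure Game where
  /-- number of followers -/
  k : ℕ
  /-- number of actions of each follower -/
  m : Fin k → ℕ
  /-- number of actions of the leader -/
  l : ℕ
  m_pos : ∀ p, 0 < m p
  l_pos : 0 < l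
  /-- `U p a j` is the payoff of follower `p` when the followers play `a` and the leader plays `j` -/
  U : Fin k → ((p : Fin k) → Fin (m p)) → Fin l → ℚ
  /-- `V a j` is the payoff of the leader when the followers play `a` and the leader plays `j` -/
  V : ((p : Fin k) → Fin (m p)) → Fin l → ℚ

namespace Game

variable (G : Game)

/-- The followers' (pure) action profiles. -/
abbrev Profile : Type := (p : Fin G.k) → Fin (G.m p)

/-- The leader's (mixed) strategies. -/
def strategies : Set (Fin G.l → ℝ) := stdSimplex ℝ (Fin G.l)

/-- Expected payoff of follower `p` when the followers play `a` and the leader plays `x`. -/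
def followerUtility (p : Fin G.k) (a : G.Profile) (x : Fin G.l → ℝ) : ℝ :=
  ∑ j, (G.U p a j : ℝ) * x j

/-- Expected payoff of the leader when the followers play `a` and the leader plays `x`. -/
def leaderUtility (a : G.Profile) (x : Fin G.l → ℝ) : ℝ :=
  ∑ j, (G.V a j : ℝ) * x j

/-- `a` is a pure Nash equilibrium of the followers' game induced by the leader's strategy `x`. -/
def IsNE (x : Fin G.l → ℝ) (a : G.Profile) : Prop :=
  ∀ (p : Fin G.k) (b : Fin (G.m p)),
    G.followerUtility p (Function.update a p b) x ≤ G.followerUtility p a x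

open Classical in
/-- The leader's pessimistic utility: the least payoff of the leader over the (finitely many) pure
Nash equilibria of the followers' game induced by `x`, and `-∞` if there is none. -/
noncomputable def pessimistic (x : Fin G.l → ℝ) : EReal :=
  if ∃ a, G.IsNE x a then ⨅ a ∈ {a | G.IsNE x a}, (G.leaderUtility a x : EReal) else ⊥

/-- The supremum of the leader's pessimistic utility over her strategies. -/
noncomputable def supValue : EReal := ⨆ x ∈ G.strategies, G.pessimistic x

/-- A maximising strategy of the leader. -/
def IsMaximiser (x : Fin G.l → ℝ) : Prop :=
  x ∈ G.strategies ∧ G.pessimistic x = G.supValue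

/-- The size of the instance: the total number of binary digits of all payoffs. As every payoff
contributes at least `1`, it bounds the number of payoffs, of players and of actions. -/
def size : ℕ :=
  ∑ a : G.Profile, ∑ j, (bitSize (G.V a j) + ∑ p, bitSize (G.U p a j))

/-- The game as an input for programs: the numbers of actions of the followers, the number of
actions of the leader, the payoff table of the leader, and the payoff tables of the followers. -/
def encode : Data :=
  .cons (encList (List.ofFn fun p => encNat (G.m p)))
    (.cons (encNat G.l)
      (.cons (encTable G.m fun a => encVec (G.V a))
        (encList (List.ofFn fun p => encTable G.m fun a => encVec (G.U p a)))))

/-- What an algorithm returns: a value (`none` stands for `-∞`), and possibly a strategy. -/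
structure Output where
  value : Option ℚ
  strategy : Option (Fin G.l → ℚ)

end Game

/-- The output of an algorithm as a tree. -/
def Game.Output.encode {G : Game} (r : G.Output) : Data :=
  .cons (encOption (r.value.map encRat)) (encOption (r.strategy.map encVec))

/-- The returned value as an extended real number. -/
noncomputable def Game.Output.valueEReal {G : Game} (r : G.Output) : EReal :=
  match r.value with
  | none => ⊥
  | some q => ((q : ℝ) : EReal)

end LeaderFollower

/-!
# Optimal commitment to a pessimistic leader strategy in exponential time

**The mathematics.** For a strategy `x` of the leader, the set of equilibria of the followers is
determined by the signs of finitely many linear forms in `x`, the losses of the followers under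
deviations. So the simplex is cut into finitely many pieces, on each of which the set `S` of
equilibria is constant and the pessimistic utility is the minimum of the leader's payoffs over `S`.
A piece is given by weak and strict linear inequalities, so its supremum over a piece with `S ≠ ∅`
is the maximum of that minimum over the closure of the piece. This maximum need not be attained in the piece itself, but a point `x` of the
closure is the limit of `x + ε • (z - x)` for `ε → 0`, where `z` is any point of the piece, and
the equilibria at these perturbed strategies can be read off from `x` and `z`: they are the profiles
at which no deviation is profitable in the lexicographic order (`Game.LexNE`). Hence the supremum is
the maximum, over all pairs `(x, z)`, of the least payoff that the leader gets at `x` in such an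
equilibrium (`Game.IsWorst.le_supValue` and `Game.exists_small_isWorst`), and it is attained exactly
if it is reached by a pair of the form `(x, x)`. If no strategy induces an equilibrium, then there is
no such pair, the supremum is `-∞`, and every strategy is a maximiser.

It is enough to consider small rational `x` and `z`: a linear program that attains its optimum
attains it at a vertex of its polyhedron (`exists_vertex`), and by Cramer's rule a vertex has
coordinates of polynomial bit length (`exists_small_vertex`). So an optimal pair, and an optimal
strategy if there is one, is found by exhaustive search among exponentially many candidates.

**The machine.** `ExpComp f` says that `f` is computed by a program in time `2 ^ p` with output
length at most `p`, for a polynomial `p` in the length of the input. Because of the bound on the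
output, this class is closed under composition, and it is closed under primitive recursion on binary
numbers as long as the intermediate values remain polynomially long (`ExpComp.natRec`), for instance
under bounded quantification and bounded search over exponentially many numbers. Arithmetic may be
implemented in the most naive way, and the algorithm is written down as a first-order definition
with bounded quantifiers (`Game.CodeIsBest`, `Game.solve`). Profiles and strategies are coded by the
digits of numbers.
-/

open Polynomial

namespace LeaderFollower

/-! ### Encodings and growth of functions -/

/-- The number of nodes of a tree. -/
def Data.size : Data → ℕ
  | .nil => 1
  | .cons a b => a.size + b.size + 1

/-- Types whose elements are represented by trees. -/
class Enc (α : Type) where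
  /-- the tree that represents an element -/
  enc : α → Data

open Enc

/-- The length of the encoding. -/
def len {α : Type} [Enc α] (a : α) : ℕ := (enc a).size

variable {α β γ σ : Type} [Enc α] [Enc β] [Enc γ] [Enc σ]

/-- `f` is bounded by a polynomial in the length of its argument. -/
def PolyBdd (f : α → ℕ) : Prop := ∃ p : ℕ[X], ∀ a, f a ≤ p.eval (len a)

/-- `f` is bounded by `2 ^ p`, where `p` is a polynomial in the length of its argument. -/
def ExpBdd (f : α → ℕ) : Prop := ∃ g : α → ℕ, PolyBdd g ∧ ∀ a, f a ≤ 2 ^ g a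

theorem eval_mono (p : ℕ[X]) : Monotone fun n => p.eval n := by
  intro a b hab
  simp only [eval_eq_sum_range]
  gcongr

theorem PolyBdd.of_le {f g : α → ℕ} (hg : PolyBdd g) (h : ∀ a, f a ≤ g a) : PolyBdd f := by
  obtain ⟨p, hp⟩ := hg
  exact ⟨p, fun a => (h a).trans (hp a)⟩

theorem PolyBdd.const (n : ℕ) : PolyBdd fun _ : α => n := ⟨C n, fun a => by simp⟩

theorem PolyBdd.self : PolyBdd fun a : α => len a := ⟨X, fun a => by simp⟩

theorem PolyBdd.add {f g : α → ℕ} (hf : PolyBdd f) (hg : PolyBdd g) :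
    PolyBdd fun a => f a + g a := by
  obtain ⟨p, hp⟩ := hf
  obtain ⟨q, hq⟩ := hg
  exact ⟨p + q, fun a => by simpa using add_le_add (hp a) (hq a)⟩

theorem PolyBdd.mul {f g : α → ℕ} (hf : PolyBdd f) (hg : PolyBdd g) :
    PolyBdd fun a => f a * g a := by
  obtain ⟨p, hp⟩ := hf
  obtain ⟨q, hq⟩ := hg
  exact ⟨p * q, fun a => by simpa using Nat.mul_le_mul (hp a) (hq a)⟩

theorem PolyBdd.eval {f : α → ℕ} (hf : PolyBdd f) (p : ℕ[X]) : PolyBdd fun a => p.eval (f a) := by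
  obtain ⟨q, hq⟩ := hf
  exact ⟨p.comp q, fun a => by simpa using eval_mono p (hq a)⟩

theorem PolyBdd.comp {g : β → ℕ} {f : α → β} (hg : PolyBdd g) (hf : PolyBdd fun a => len (f a)) :
    PolyBdd fun a => g (f a) := by
  obtain ⟨p, hp⟩ := hg
  exact (hf.eval p).of_le fun a => hp (f a)

theorem PolyBdd.expBdd {f : α → ℕ} (hf : PolyBdd f) : ExpBdd f :=
  ⟨f, hf, fun _ => Nat.lt_two_pow_self.le⟩

theorem ExpBdd.const (n : ℕ) : ExpBdd fun _ : α => n := (PolyBdd.const n).expBdd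

theorem ExpBdd.add {f g : α → ℕ} (hf : ExpBdd f) (hg : ExpBdd g) : ExpBdd fun a => f a + g a := by
  obtain ⟨p, hp, hf⟩ := hf
  obtain ⟨q, hq, hg⟩ := hg
  refine ⟨_, (hp.add hq).add (.const 1), fun a => ?_⟩
  calc f a + g a ≤ 2 ^ (p a + q a) + 2 ^ (p a + q a) :=
        add_le_add ((hf a).trans (Nat.pow_le_pow_right two_pos (by omega)))
          ((hg a).trans (Nat.pow_le_pow_right two_pos (by omega)))
    _ = 2 ^ (p a + q a + 1) := by ring

theorem ExpBdd.mul {f g : α → ℕ} (hf : ExpBdd f) (hg : ExpBdd g) : ExpBdd fun a => f a * g a := by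
  obtain ⟨p, hp, hf⟩ := hf
  obtain ⟨q, hq, hg⟩ := hg
  exact ⟨_, hp.add hq, fun a => by simpa [pow_add] using Nat.mul_le_mul (hf a) (hg a)⟩

theorem ExpBdd.pow {f g : α → ℕ} (hf : ExpBdd f) (hg : PolyBdd g) :
    ExpBdd fun a => f a ^ g a := by
  obtain ⟨p, hp, hf⟩ := hf
  exact ⟨_, hp.mul hg, fun a => by simpa [pow_mul] using Nat.pow_le_pow_left (hf a) (g a)⟩

theorem ExpBdd.comp {g : β → ℕ} {f : α → β} (hg : ExpBdd g) (hf : PolyBdd fun a => len (f a)) :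
    ExpBdd fun a => g (f a) := by
  obtain ⟨p, hp, hg⟩ := hg
  exact ⟨_, hp.comp hf, fun a => hg (f a)⟩

/-! ### Functions computable in exponential time with polynomially long values -/

/-- `f` is computed by a program whose running time is bounded by `2 ^ p` and whose output length
is bounded by `p`, for a polynomial `p` in the length of the input. Bounding the lengths of the
values polynomially makes this class closed under composition. -/
@[fun_prop]
def ExpComp (f : α → β) : Prop :=
  (∃ c : Prog, ∃ T : α → ℕ, ExpBdd T ∧ ∀ a, ∃ t ≤ T a, Runs c (enc a) (enc (f a)) t) ∧
    PolyBdd fun a => len (f a)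

theorem ExpComp.polyBdd {f : α → β} (hf : ExpComp f) : PolyBdd fun a => len (f a) := hf.2

instance : Enc Data := ⟨fun d => d⟩
instance : Enc (α × β) := ⟨fun z => .cons (enc z.1) (enc z.2)⟩
instance : Enc Bool := ⟨encBool⟩
instance : Enc ℕ := ⟨encNat⟩
instance : Enc ℚ := ⟨encRat⟩
instance : Enc (List α) := ⟨fun l => encList (l.map enc)⟩
instance : Enc (Option α) := ⟨fun o => encOption (o.map enc)⟩

open Classical in
/-- Propositions are encoded by their truth values, so that decidable predicates are treated as
functions. -/
noncomputable instance : Enc Prop := ⟨fun P => encBool (decide P)⟩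

theorem ExpComp.of_enc_eq {f : α → β} (hf : ExpComp f) {g : α → γ}
    (h : ∀ a, enc (g a) = enc (f a)) : ExpComp g := by
  obtain ⟨⟨c, T, hT, hc⟩, hp⟩ := hf
  refine ⟨⟨c, T, hT, fun a => ?_⟩, hp.of_le fun a => ?_⟩
  · rw [h]
    exact hc a
  · simp [len, h]

theorem ExpComp.of_runs_const {f : α → β} (c : Prog) (t : ℕ)
    (h : ∀ a, ∃ s ≤ t, Runs c (enc a) (enc (f a)) s) (hp : PolyBdd fun a => len (f a)) :
    ExpComp f :=
  ⟨⟨c, _, ExpBdd.const t, h⟩, hp⟩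

@[fun_prop]
theorem ExpComp.id : ExpComp fun a : α => a :=
  .of_runs_const .id 1 (fun _ => ⟨1, le_rfl, .id _⟩) .self

theorem Runs.const (d : Data) : ∃ c, ∃ t, ∀ v, Runs c v d t := by
  induction d with
  | nil => exact ⟨.nil, 1, fun v => .nil v⟩
  | cons a b iha ihb =>
    obtain ⟨c, t, h⟩ := iha
    obtain ⟨c', t', h'⟩ := ihb
    exact ⟨.cons c c', _, fun v => .cons (h v) (h' v)⟩

@[fun_prop]
theorem ExpComp.const (b : β) : ExpComp fun _ : α => b := by
  obtain ⟨c, t, h⟩ := Runs.const (enc b)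
  exact .of_runs_const c t (fun _ => ⟨t, le_rfl, h _⟩) (.const _)

@[fun_prop]
theorem ExpComp.comp {g : β → γ} {f : α → β} (hg : ExpComp g) (hf : ExpComp f) :
    ExpComp fun a => g (f a) := by
  obtain ⟨⟨c, T, hT, hc⟩, hp⟩ := hf
  obtain ⟨⟨d, U, hU, hd⟩, hq⟩ := hg
  refine ⟨⟨.comp d c, _, (hT.add (hU.comp hp)).add (.const 1), fun a => ?_⟩, hq.comp hp⟩
  obtain ⟨s, hs, h⟩ := hc a
  obtain ⟨t, ht, h'⟩ := hd (f a)
  exact ⟨s + t + 1, by omega, .comp h h'⟩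

@[fun_prop]
theorem ExpComp.prodMk {f : α → β} {g : α → γ} (hf : ExpComp f) (hg : ExpComp g) :
    ExpComp fun a => (f a, g a) := by
  obtain ⟨⟨c, T, hT, hc⟩, hp⟩ := hf
  obtain ⟨⟨d, U, hU, hd⟩, hq⟩ := hg
  refine ⟨⟨.cons c d, _, (hT.add hU).add (.const 1), fun a => ?_⟩, (hp.add hq).add (.const 1)⟩
  obtain ⟨s, hs, h⟩ := hc a
  obtain ⟨t, ht, h'⟩ := hd a
  exact ⟨s + t + 1, by omega, .cons h h'⟩

theorem Data.size_pos (d : Data) : 0 < d.size := by cases d <;> simp [Data.size]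

theorem Data.size_left_le (d : Data) : d.left.size ≤ d.size := by
  cases d <;> simp [Data.size, Data.left]; omega

theorem Data.size_right_le (d : Data) : d.right.size ≤ d.size := by
  cases d <;> simp [Data.size, Data.right]; omega

@[fun_prop]
theorem ExpComp.left {f : α → Data} (hf : ExpComp f) : ExpComp fun a => (f a).left :=
  ExpComp.comp (g := Data.left)
    (.of_runs_const .left 1 (fun _ => ⟨1, le_rfl, .left _⟩) (.of_le .self Data.size_left_le)) hf

@[fun_prop]
theorem ExpComp.right {f : α → Data} (hf : ExpComp f) : ExpComp fun a => (f a).right :=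
  ExpComp.comp (g := Data.right)
    (.of_runs_const .right 1 (fun _ => ⟨1, le_rfl, .right _⟩) (.of_le .self Data.size_right_le)) hf

theorem ExpComp.toData {f : α → β} (hf : ExpComp f) : ExpComp fun a => enc (f a) :=
  hf.of_enc_eq fun _ => rfl

@[fun_prop]
theorem ExpComp.fst {f : α → β × γ} (hf : ExpComp f) : ExpComp fun a => (f a).1 :=
  hf.toData.left.of_enc_eq fun _ => rfl

@[fun_prop]
theorem ExpComp.snd {f : α → β × γ} (hf : ExpComp f) : ExpComp fun a => (f a).2 :=
  hf.toData.right.of_enc_eq fun _ => rfl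

theorem enc_true : enc True = .cons .nil .nil := by simp [enc, encBool]

instance {p : α → Prop} : Enc {a // p a} := ⟨fun a => enc a.1⟩

/-- Branching on whether a tree is empty; the first branch only has to be computable on the inputs
for which it is taken. -/
theorem ExpComp.cases {d : α → Data} {f : {a // d a ≠ .nil} → β} {g h : α → β} (hd : ExpComp d)
    (hf : ExpComp f) (hg : ExpComp g) (h₁ : ∀ a, d a = .nil → h a = g a)
    (h₂ : ∀ a (ha : d a ≠ .nil), h a = f ⟨a, ha⟩) : ExpComp h := by
  obtain ⟨⟨c₀, T₀, hT₀, h₀⟩, -⟩ := hd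
  obtain ⟨⟨c, T, ⟨T', ⟨p', hp'⟩, hT⟩, hc⟩, p, hp⟩ := hf
  obtain ⟨⟨c', U, hU, hc'⟩, q, hq⟩ := hg
  refine ⟨⟨.ite c₀ c c', _, ((hT₀.add ⟨_, ⟨p', fun _ => le_rfl⟩, fun _ => le_rfl⟩).add hU).add
    (.const 1), fun a => ?_⟩, p + q, fun a => ?_⟩
  · obtain ⟨s, hs, hr⟩ := h₀ a
    rcases hda : d a with _ | ⟨x, y⟩
    · obtain ⟨t, ht, hr'⟩ := hc' a
      rw [h₁ a hda]
      exact ⟨s + t + 1, Nat.succ_le_succ (add_le_add (hs.trans (Nat.le_add_right _ _)) ht),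
        .ite_false (hda ▸ hr) hr'⟩
    · have ha : d a ≠ .nil := by simp [hda]
      obtain ⟨t, ht, hr'⟩ := hc ⟨a, ha⟩
      rw [h₂ a ha]
      refine ⟨s + t + 1, Nat.succ_le_succ ?_, .ite_true (hda ▸ hr) hr'⟩
      exact (add_le_add hs (ht.trans ((hT _).trans
        (Nat.pow_le_pow_right two_pos (hp' ⟨a, ha⟩))))).trans (Nat.le_add_right _ _)
  · dsimp only
    rw [eval_add]
    by_cases hda : d a = .nil
    · rw [h₁ a hda]
      exact (hq a).trans (Nat.le_add_left _ _)
    · rw [h₂ a hda]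
      exact (hp ⟨a, hda⟩).trans (Nat.le_add_right _ _)

theorem ExpComp.val {p : α → Prop} : ExpComp fun a : {a // p a} => a.1 :=
  .of_enc_eq (f := fun a : {a // p a} => a) .id fun _ => rfl

/-- Branching on whether a list is empty. -/
theorem ExpComp.listCases {L : α → List β} {z h : α → γ} {g : α → β → List β → γ} (hL : ExpComp L)
    (hz : ExpComp z) (hg : ExpComp fun w : α × β × List β => g w.1 w.2.1 w.2.2)
    (h₁ : ∀ a, L a = [] → h a = z a) (h₂ : ∀ a x xs, L a = x :: xs → h a = g a x xs) :
    ExpComp h := by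
  have hne : ∀ a, enc (L a) ≠ .nil → L a ≠ [] := by
    intro a ha h
    simp [h, enc, encList] at ha
  let e : {a // enc (L a) ≠ .nil} → α × β × List β :=
    fun s => (s.1, (L s.1).head (hne _ s.2), (L s.1).tail)
  have he : ExpComp e := by
    refine .of_enc_eq (f := fun s : {a // enc (L a) ≠ .nil} => (s.1, L s.1))
      (ExpComp.val.prodMk (hL.comp .val)) fun s => ?_
    obtain ⟨x, xs, hx⟩ := List.exists_cons_of_ne_nil (hne _ s.2)
    simp [e, enc, hx, encList]
  refine .cases hL.toData (hg.comp he) hz (fun a ha => h₁ a ?_) fun a ha => ?_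
  · cases h : L a <;> simp_all [enc, encList]
  · exact h₂ _ _ _ (List.cons_head_tail _).symm

theorem enc_prop_eq_nil {P : Prop} : enc P = .nil ↔ ¬P := by
  by_cases hP : P <;> simp [enc, encBool, hP]

@[fun_prop]
theorem ExpComp.ite {P : α → Prop} [∀ a, Decidable (P a)] {f g : α → β} (hP : ExpComp P)
    (hf : ExpComp f) (hg : ExpComp g) : ExpComp fun a => if P a then f a else g a :=
  .cases hP.toData (hf.comp .val) hg (fun _ h => if_neg (enc_prop_eq_nil.1 h))
    fun _ h => if_pos (not_not.1 fun h' => h (enc_prop_eq_nil.2 h'))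

theorem ExpComp.of_iff {P Q : α → Prop} (hP : ExpComp P) (h : ∀ a, Q a ↔ P a) : ExpComp Q :=
  hP.of_enc_eq fun a => by rw [propext (h a)]

@[fun_prop]
theorem ExpComp.not {P : α → Prop} (hP : ExpComp P) : ExpComp fun a => ¬P a := by
  classical
  exact (hP.ite (.const False) (.const True)).of_iff fun a => by by_cases h : P a <;> simp [h]

@[fun_prop]
theorem ExpComp.and {P Q : α → Prop} (hP : ExpComp P) (hQ : ExpComp Q) :
    ExpComp fun a => P a ∧ Q a := by
  classical
  exact (hP.ite hQ (.const False)).of_iff fun a => by by_cases h : P a <;> simp [h]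

@[fun_prop]
theorem ExpComp.or {P Q : α → Prop} (hP : ExpComp P) (hQ : ExpComp Q) :
    ExpComp fun a => P a ∨ Q a := by
  classical
  exact (hP.ite (.const True) hQ).of_iff fun a => by by_cases h : P a <;> simp [h]

theorem ExpComp.imp {P Q : α → Prop} (hP : ExpComp P) (hQ : ExpComp Q) :
    ExpComp fun a => P a → Q a := by
  classical
  exact (hP.ite hQ (.const True)).of_iff fun a => by by_cases h : P a <;> simp [h]

@[fun_prop]
theorem ExpComp.coe_bool {f : α → Bool} (hf : ExpComp f) : ExpComp fun a => f a = true :=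
  hf.of_enc_eq fun a => by simp [enc]

@[fun_prop]
theorem ExpComp.some {f : α → β} (hf : ExpComp f) : ExpComp fun a => Option.some (f a) :=
  (hf.prodMk (.const Data.nil)).of_enc_eq fun a => by simp [enc, encOption]

@[fun_prop]
theorem ExpComp.listCons {f : α → β} {g : α → List β} (hf : ExpComp f) (hg : ExpComp g) :
    ExpComp fun a => f a :: g a :=
  (hf.prodMk hg).of_enc_eq fun a => by simp [enc, encList]

theorem ExpComp.ne_nil {f : α → List β} (hf : ExpComp f) : ExpComp fun a => f a ≠ [] :=
  .cases (f := fun _ => True) hf.toData (.const True) (.const False)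
    (fun a h => by cases h' : f a <;> simp_all [enc, encList])
    (fun a h => by cases h' : f a <;> simp_all [enc, encList])

theorem ExpComp.eq_nil {f : α → List β} (hf : ExpComp f) : ExpComp fun a => f a = [] :=
  hf.ne_nil.not.of_iff fun a => by simp

/-- A loop that carries out `n a` iterations on states of polynomially bounded length. -/
theorem ExpComp.iterate_while {i : α → σ} {c : σ → Prop} {g : σ → σ} {n b : α → ℕ}
    (hi : ExpComp i) (hc : ExpComp c) (hg : ExpComp g) (hn : ExpBdd n)
    (hcont : ∀ a j, j < n a → c (g^[j] (i a))) (hdone : ∀ a, ¬c (g^[n a] (i a)))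
    (hb : PolyBdd b) (hlen : ∀ a, ∀ j ≤ n a, len (g^[j] (i a)) ≤ b a) :
    ExpComp fun a => g^[n a] (i a) := by
  suffices h : ∃ d : Prog, ∃ T : α → ℕ, ExpBdd T ∧
      ∀ a, ∃ t ≤ T a, Runs d (enc (i a)) (enc (g^[n a] (i a))) t by
    obtain ⟨d, T, hT, h⟩ := h
    obtain ⟨⟨c', U, hU, hc'⟩, -⟩ := hi
    refine ⟨⟨.comp d c', _, (hU.add hT).add (.const 1), fun a => ?_⟩, hb.of_le fun a => hlen a _ le_rfl⟩
    obtain ⟨s, hs, hr⟩ := hc' a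
    obtain ⟨t, ht, hr'⟩ := h a
    exact ⟨s + t + 1, by omega, .comp hr hr'⟩
  obtain ⟨⟨d, T, ⟨p, ⟨p', hp⟩, hT⟩, hd⟩, -⟩ := hc
  obtain ⟨⟨e, U, ⟨q, ⟨q', hq⟩, hU⟩, he⟩, -⟩ := hg
  have hTK : ∀ a, ∀ j ≤ n a, T (g^[j] (i a)) ≤ 2 ^ p'.eval (b a) := fun a j hj =>
    (hT _).trans (Nat.pow_le_pow_right two_pos ((hp _).trans (eval_mono p' (hlen a j hj))))
  have hUK : ∀ a, ∀ j ≤ n a, U (g^[j] (i a)) ≤ 2 ^ q'.eval (b a) := fun a j hj =>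
    (hU _).trans (Nat.pow_le_pow_right two_pos ((hq _).trans (eval_mono q' (hlen a j hj))))
  have key : ∀ a j, j ≤ n a → ∃ t ≤ (j + 1) * (2 ^ p'.eval (b a) + 2 ^ q'.eval (b a) + 1),
      Runs (.loop d e) (enc (g^[n a - j] (i a))) (enc (g^[n a] (i a))) t := by
    intro a j
    induction j with
    | zero =>
      intro _
      obtain ⟨s, hs, hr⟩ := hd (g^[n a] (i a))
      rw [enc_prop_eq_nil.2 (hdone a)] at hr
      have := hTK a _ le_rfl
      refine ⟨s + 1, ?_, .loop_false hr⟩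
      rw [zero_add, one_mul]
      exact Nat.succ_le_succ ((hs.trans this).trans (Nat.le_add_right _ _))
    | succ j ih =>
      intro hj
      obtain ⟨r, hr, hrun⟩ := ih (by omega)
      obtain ⟨s, hs, hs'⟩ := hd (g^[n a - (j + 1)] (i a))
      obtain ⟨t, ht, ht'⟩ := he (g^[n a - (j + 1)] (i a))
      have h1 := hTK a (n a - (j + 1)) (by omega)
      have h2 := hUK a (n a - (j + 1)) (by omega)
      rw [eq_true (hcont a (n a - (j + 1)) (by omega)), enc_true] at hs'
      rw [← Function.iterate_succ_apply' g, show (n a - (j + 1)).succ = n a - j by omega] at ht'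
      refine ⟨s + t + r + 1, ?_, .loop_true hs' ht' hrun⟩
      rw [add_mul (j + 1) 1]
      omega
  refine ⟨.loop d e, fun a => (n a + 1) * (2 ^ p'.eval (b a) + 2 ^ q'.eval (b a) + 1), ?_, fun a => ?_⟩
  · exact (hn.add (.const 1)).mul
      ((ExpBdd.add ⟨_, hb.eval p', fun _ => le_rfl⟩ ⟨_, hb.eval q', fun _ => le_rfl⟩).add (.const 1))
  · simpa using key a (n a) le_rfl

/-! ### Recursion on lists -/

theorem len_pair (a : α) (b : β) : len (a, b) = len a + len b + 1 := rfl

theorem len_listNil : len ([] : List α) = 1 := rfl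

theorem len_listCons (x : α) (xs : List α) : len (x :: xs) = len x + len xs + 1 := rfl

theorem len_pos (a : α) : 0 < len a := Data.size_pos _

theorem len_append (l m : List α) : len (l ++ m) + 1 = len l + len m := by
  induction l with
  | nil => simp [len_listNil, add_comm]
  | cons x l ih => simp only [List.cons_append, len_listCons]; omega

theorem len_reverse (l : List α) : len l.reverse = len l := by
  induction l with
  | nil => rfl
  | cons x l ih =>
    have := len_append l.reverse [x]
    simp only [List.reverse_cons, len_listCons, len_listNil] at *
    omega

theorem len_le_of_suffix {l m : List α} (h : l <:+ m) : len l ≤ len m := by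
  obtain ⟨k, rfl⟩ := h
  have := len_append k l
  have := len_pos k
  omega

theorem len_le_of_prefix {l m : List α} (h : l <+: m) : len l ≤ len m := by
  obtain ⟨k, rfl⟩ := h
  have := len_append l k
  have := len_pos k
  omega

theorem length_lt_len (l : List α) : l.length < len l := by
  induction l with
  | nil => exact Nat.zero_lt_one
  | cons x l ih => simp only [List.length_cons, len_listCons]; omega

theorem ExpComp.foldl {L : α → List β} {z : α → γ} {g : α → γ → β → γ} {b : α → ℕ}
    (hL : ExpComp L) (hz : ExpComp z) (hg : ExpComp fun w : α × γ × β => g w.1 w.2.1 w.2.2)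
    (hb : PolyBdd b) (hlen : ∀ a l, l <+: L a → len (l.foldl (g a) (z a)) ≤ b a) :
    ExpComp fun a => (L a).foldl (g a) (z a) := by
  let st : α × List β × γ → α × List β × γ := fun s =>
    match s.2.1 with
    | [] => s
    | x :: xs => (s.1, xs, g s.1 s.2.2 x)
  have hst : ExpComp st := by
    refine .listCases (L := fun s : α × List β × γ => s.2.1) (z := fun s => s)
      (g := fun s x xs => (s.1, xs, g s.1 s.2.2 x)) (by fun_prop) (by fun_prop) ?_ ?_ ?_
    · exact .prodMk (by fun_prop) (.prodMk (by fun_prop)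
        (hg.comp (f := fun w : (α × List β × γ) × β × List β => (w.1.1, w.1.2.2, w.2.1))
          (by fun_prop)))
    · intro a h; simp [st, h]
    · intro a x xs h; simp [st, h]
  have hit : ∀ a j, j ≤ (L a).length →
      st^[j] (a, L a, z a) = (a, (L a).drop j, ((L a).take j).foldl (g a) (z a)) := by
    intro a j
    induction j with
    | zero => simp
    | succ j ih =>
      intro hj
      rw [Function.iterate_succ_apply', ih (by omega)]
      have hj' : j < (L a).length := by omega
      rw [List.take_add_one, List.getElem?_eq_getElem hj', List.foldl_append,
        List.drop_eq_getElem_cons hj']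
      rfl
  have hw := ExpComp.iterate_while (i := fun a => (a, L a, z a)) (c := fun s => s.2.1 ≠ [])
    (g := st) (n := fun a => (L a).length) (b := fun a => len a + (len (L a) + b a + 1) + 1)
    (by fun_prop) (ExpComp.ne_nil (by fun_prop)) hst
    (hL.polyBdd.of_le fun a => (length_lt_len _).le).expBdd
    (fun a j hj => by rw [hit a j hj.le]; simpa using hj)
    (fun a => by rw [hit a _ le_rfl]; simp)
    ((PolyBdd.self.add ((hL.polyBdd.add hb).add (.const 1))).add (.const 1))
    (fun a j hj => by
      rw [hit a j hj, len_pair, len_pair]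
      have h1 := len_le_of_suffix (List.drop_suffix j (L a))
      have h2 := hlen a _ (List.take_prefix j (L a))
      omega)
  refine hw.snd.snd.of_enc_eq fun a => ?_
  rw [hit a _ le_rfl]
  simp

@[fun_prop]
theorem ExpComp.reverse {L : α → List β} (hL : ExpComp L) : ExpComp fun a => (L a).reverse := by
  have h : ∀ l m : List β, l.foldl (fun acc x => x :: acc) m = l.reverse ++ m := by
    intro l
    induction l with
    | nil => simp
    | cons x l ih => simp [ih]
  have := ExpComp.foldl (z := fun _ => []) (g := fun _ acc x => x :: acc) hL (.const _)
    (by fun_prop) hL.polyBdd fun a l hl => by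
      rw [h, List.append_nil, len_reverse]
      exact len_le_of_prefix hl
  simpa only [h, List.append_nil] using this

/-- Primitive recursion on lists. -/
theorem ExpComp.listRec {L : α → List β} {h : α → List β → γ} {z : α → γ}
    {g : α → β → List β → γ → γ} {b : α → ℕ} (hL : ExpComp L) (hz : ExpComp z)
    (hg : ExpComp fun w : α × β × List β × γ => g w.1 w.2.1 w.2.2.1 w.2.2.2)
    (h₁ : ∀ a, h a [] = z a) (h₂ : ∀ a x xs, h a (x :: xs) = g a x xs (h a xs))
    (hb : PolyBdd b) (hlen : ∀ a l, l <:+ L a → len (h a l) ≤ b a) :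
    ExpComp fun a => h a (L a) := by
  let st : α → List β × γ → β → List β × γ := fun a s x => (x :: s.1, g a x s.1 s.2)
  have hst : ∀ a l, l.reverse.foldl (st a) ([], z a) = (l, h a l) := by
    intro a l
    induction l with
    | nil => simp [h₁]
    | cons x l ih => simp [ih, h₂, st]
  have hw := ExpComp.foldl (L := fun a => (L a).reverse) (z := fun a => (([] : List β), z a)) (g := st)
    (b := fun a => len (L a) + b a + 1) (by fun_prop) (by fun_prop)
    (.prodMk (by fun_prop) (hg.comp
      (f := fun w : α × (List β × γ) × β => (w.1, w.2.2, w.2.1.1, w.2.1.2)) (by fun_prop)))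
    ((hL.polyBdd.add hb).add (.const 1)) fun a l hl => by
      have h1 : l.reverse <:+ L a := by simpa using List.reverse_suffix.2 hl
      rw [← List.reverse_reverse l, hst, len_pair]
      have := len_le_of_suffix h1
      have := hlen a _ h1
      omega
  refine hw.snd.of_enc_eq fun a => ?_
  rw [hst]

/-! ### Binary numbers -/

theorem ExpComp.bits {f : α → ℕ} (hf : ExpComp f) : ExpComp fun a => (f a).bits :=
  hf.of_enc_eq fun _ => rfl

theorem ExpComp.of_bits {f : α → ℕ} (hf : ExpComp fun a => (f a).bits) : ExpComp f :=
  hf.of_enc_eq fun _ => rfl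

theorem len_bool (b : Bool) : len b ≤ 3 := by cases b <;> decide

theorem len_prop (P : Prop) : len P ≤ 3 := by
  classical
  exact len_bool (decide P)

theorem len_le_of_bool (l : List Bool) : len l ≤ 4 * l.length + 1 := by
  induction l with
  | nil => exact le_rfl
  | cons x l ih =>
    have := len_bool x
    simp only [List.length_cons, len_listCons]; omega

theorem len_nat_le (n : ℕ) : len n ≤ 4 * n.size + 1 :=
  (len_le_of_bool n.bits).trans (by rw [Nat.size_eq_bits_len])

theorem size_lt_len (n : ℕ) : n.size < len n := by
  rw [← Nat.size_eq_bits_len]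
  exact length_lt_len n.bits

theorem lt_two_pow_len (n : ℕ) : n < 2 ^ len n := by
  rw [← Nat.size_le]
  exact (size_lt_len n).le

theorem len_nat_le_of_lt {n k : ℕ} (h : n < 2 ^ k) : len n ≤ 4 * k + 1 := by
  have := len_nat_le n
  have := Nat.size_le.2 h
  omega

theorem len_nat_mono {m n : ℕ} (h : m ≤ n) : len m ≤ 4 * len n + 1 :=
  len_nat_le_of_lt (h.trans_lt (lt_two_pow_len n))

theorem PolyBdd.len_of_expBdd {f : α → ℕ} (hf : ExpBdd f) : PolyBdd fun a => len (f a) := by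
  obtain ⟨g, hg, h⟩ := hf
  exact (((PolyBdd.const 4).mul (hg.add (.const 1))).add (.const 1)).of_le fun a =>
    len_nat_le_of_lt ((h a).trans_lt (Nat.pow_lt_pow_right one_lt_two (Nat.lt_succ_self _)))

theorem ExpComp.expBdd {f : α → ℕ} (hf : ExpComp f) : ExpBdd f :=
  ⟨_, hf.polyBdd, fun a => (lt_two_pow_len (f a)).le⟩

/-- The digits of `n + 1`, if those of `n` are given. -/
def incr : List Bool → List Bool
  | [] => [true]
  | false :: l => true :: l
  | true :: l => false :: incr l

/-- The digits of `n - 1`, if those of `n` are given; a leading zero is dropped. -/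
def decr : List Bool → List Bool
  | [] => []
  | false :: l => true :: decr l
  | true :: l => if l = [] then [] else false :: l

theorem bits_bit {b : Bool} {n : ℕ} (h : n = 0 → b = true) : (Nat.bit b n).bits = b :: n.bits :=
  Nat.bits_append_bit n b h

theorem incr_bits (n : ℕ) : incr n.bits = (n + 1).bits := by
  induction n using Nat.binaryRec' with
  | zero => simp [incr]
  | bit b n h ih =>
    rw [bits_bit h]
    cases b with
    | false =>
      rw [show Nat.bit false n + 1 = Nat.bit true n by simp [Nat.bit], bits_bit (by simp)]; rfl
    | true =>
      rw [show Nat.bit true n + 1 = Nat.bit false (n + 1) by simp [Nat.bit]; ring,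
        bits_bit (by simp), ← ih]; rfl

theorem decr_bits (n : ℕ) : decr (n + 1).bits = n.bits := by
  induction n using Nat.binaryRec' with
  | zero => simp [decr]
  | bit b n h ih =>
    rw [bits_bit h]
    cases b with
    | false =>
      rw [show Nat.bit false n + 1 = Nat.bit true n by simp [Nat.bit], bits_bit (by simp), decr,
        if_neg]
      intro h'
      have : n = 0 := by
        rw [← Nat.size_eq_zero, ← Nat.size_eq_bits_len, h', List.length_nil]
      simpa using h this
    | true =>
      rw [show Nat.bit true n + 1 = Nat.bit false (n + 1) by simp [Nat.bit]; ring,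
        bits_bit (by simp), ← ih]; rfl

theorem length_incr_le (l : List Bool) : (incr l).length ≤ l.length + 1 := by
  induction l with
  | nil => simp [incr]
  | cons x l ih => cases x <;> simp [incr, ih]

theorem length_decr_le (l : List Bool) : (decr l).length ≤ l.length := by
  induction l with
  | nil => simp [decr]
  | cons x l ih => cases x <;> simp [decr, ih]; split_ifs <;> simp

@[fun_prop]
theorem ExpComp.succ {f : α → ℕ} (hf : ExpComp f) : ExpComp fun a => f a + 1 := by
  refine .of_bits ?_
  simp only [← incr_bits]
  refine .listRec (h := fun _ => incr) (z := fun _ => [true])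
    (g := fun _ x xs ih => if x = true then false :: ih else true :: xs)
    (b := fun a => 4 * (len (f a) + 1) + 1) hf.bits (by fun_prop) (by fun_prop) (fun _ => rfl)
    (fun _ x xs => by cases x <;> rfl)
    (((PolyBdd.const 4).mul (hf.polyBdd.add (.const 1))).add (.const 1)) fun a l hl => ?_
  have h1 := len_le_of_bool (incr l)
  have h2 := length_incr_le l
  have h3 := hl.length_le
  have h4 := length_lt_len (f a).bits
  have h5 : len (f a).bits = len (f a) := rfl
  omega

@[fun_prop]
theorem ExpComp.pred {f : α → ℕ} (hf : ExpComp f) : ExpComp fun a => f a - 1 := by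
  refine .of_bits ?_
  have : ∀ a, (f a - 1).bits = decr (f a).bits := by
    intro a
    cases f a with
    | zero => simp [decr]
    | succ n => simp [decr_bits]
  simp only [this]
  refine .listRec (h := fun _ => decr) (z := fun _ => [])
    (g := fun _ x xs ih => if x = true then (if xs = [] then [] else false :: xs) else true :: ih)
    (b := fun a => 4 * (len (f a) + 1) + 1) hf.bits (by fun_prop)
    (.ite (by fun_prop) (.ite (.eq_nil (by fun_prop)) (by fun_prop) (by fun_prop)) (by fun_prop))
    (fun _ => rfl) (fun _ x xs => by cases x <;> rfl)
    (((PolyBdd.const 4).mul (hf.polyBdd.add (.const 1))).add (.const 1)) fun a l hl => ?_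
  have h1 := len_le_of_bool (decr l)
  have h2 := length_decr_le l
  have h3 := hl.length_le
  have h4 := length_lt_len (f a).bits
  have h5 : len (f a).bits = len (f a) := rfl
  omega

theorem ExpComp.eq_zero {f : α → ℕ} (hf : ExpComp f) : ExpComp fun a => f a = 0 :=
  (ExpComp.eq_nil hf.bits).of_iff fun a => by
    rw [← Nat.size_eq_zero, ← Nat.size_eq_bits_len, List.length_eq_zero_iff]

/-- Primitive recursion on binary numbers. -/
theorem ExpComp.natRec {n : α → ℕ} {h : α → ℕ → γ} {z : α → γ} {g : α → ℕ → γ → γ} {b : α → ℕ}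
    (hn : ExpComp n) (hz : ExpComp z)
    (hg : ExpComp fun w : α × ℕ × γ => g w.1 w.2.1 w.2.2)
    (h₁ : ∀ a, h a 0 = z a) (h₂ : ∀ a i, h a (i + 1) = g a i (h a i))
    (hb : PolyBdd b) (hlen : ∀ a, ∀ i ≤ n a, len (h a i) ≤ b a) :
    ExpComp fun a => h a (n a) := by
  -- the state consists of the number of remaining rounds, the input, the index and the value
  let st : ℕ × α × ℕ × γ → ℕ × α × ℕ × γ :=
    fun s => (s.1 - 1, s.2.1, s.2.2.1 + 1, g s.2.1 s.2.2.1 s.2.2.2)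
  have hst : ExpComp st := by
    have := hg.comp (f := fun s : ℕ × α × ℕ × γ => s.2) (by fun_prop)
    exact .prodMk (by fun_prop) (.prodMk (by fun_prop) (.prodMk (by fun_prop) this))
  have hit : ∀ a j, st^[j] (n a, a, 0, z a) = (n a - j, a, j, h a j) := by
    intro a j
    induction j with
    | zero => simp [h₁]
    | succ j ih => simp [Function.iterate_succ_apply', ih, st, h₂, Nat.sub_sub]
  have hw := ExpComp.iterate_while (i := fun a => (n a, a, 0, z a)) (c := fun s => ¬s.1 = 0)
    (g := st) (n := n)
    (b := fun a => 4 * len (n a) + 1 + (len a + (4 * len (n a) + 1 + b a + 1) + 1) + 1)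
    (by fun_prop) (ExpComp.not (.eq_zero (by fun_prop))) hst hn.expBdd
    (fun a j hj => by rw [hit]; dsimp only; omega)
    (fun a => by rw [hit]; simp)
    (have h4 := ((PolyBdd.const 4).mul hn.polyBdd).add (.const 1);
      (h4.add ((PolyBdd.self.add ((h4.add hb).add (.const 1))).add (.const 1))).add (.const 1))
    (fun a j hj => by
      rw [hit]
      simp only [len_pair]
      have h1 := len_nat_mono (Nat.sub_le (n a) j)
      have h2 := len_nat_mono hj
      have h3 := hlen a j hj
      omega)
  refine hw.snd.snd.snd.of_enc_eq fun a => ?_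
  rw [hit]

/-! ### Arithmetic and bounded search -/

/-- Primitive recursion on binary numbers with exponentially bounded numbers as values. -/
theorem ExpComp.natRec_nat {n : α → ℕ} {h : α → ℕ → ℕ} {z : α → ℕ} {g : α → ℕ → ℕ → ℕ} {b : α → ℕ}
    (hn : ExpComp n) (hz : ExpComp z)
    (hg : ExpComp fun w : α × ℕ × ℕ => g w.1 w.2.1 w.2.2)
    (h₁ : ∀ a, h a 0 = z a) (h₂ : ∀ a i, h a (i + 1) = g a i (h a i))
    (hb : ExpBdd b) (hlen : ∀ a, ∀ i ≤ n a, h a i ≤ b a) :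
    ExpComp fun a => h a (n a) :=
  .natRec hn hz hg h₁ h₂ (((PolyBdd.const 4).mul (PolyBdd.len_of_expBdd hb)).add (.const 1))
    fun a i hi => len_nat_mono (hlen a i hi)

@[fun_prop]
theorem ExpComp.sub {f g : α → ℕ} (hf : ExpComp f) (hg : ExpComp g) :
    ExpComp fun a => f a - g a :=
  .natRec_nat (h := fun a i => f a - i) (g := fun _ _ r => r - 1) hg hf (by fun_prop)
    (fun _ => rfl) (fun _ _ => rfl) hf.expBdd fun _ _ _ => Nat.sub_le _ _

@[fun_prop]
theorem ExpComp.add {f g : α → ℕ} (hf : ExpComp f) (hg : ExpComp g) :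
    ExpComp fun a => f a + g a :=
  .natRec_nat (h := fun a i => f a + i) (g := fun _ _ r => r + 1) hg hf (by fun_prop)
    (fun _ => rfl) (fun _ _ => rfl) (hf.expBdd.add hg.expBdd) fun _ _ h => by omega

@[fun_prop]
theorem ExpComp.mul {f g : α → ℕ} (hf : ExpComp f) (hg : ExpComp g) :
    ExpComp fun a => f a * g a :=
  .natRec_nat (h := fun a i => f a * i) (g := fun a _ r => r + f a) (z := fun _ => 0) hg
    (by fun_prop) (by fun_prop)
    (fun _ => rfl) (fun _ _ => rfl) (hf.expBdd.mul hg.expBdd) fun _ _ h => Nat.mul_le_mul_left _ h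

theorem ExpComp.pow {f g : α → ℕ} (hf : ExpComp f) (hg : ExpComp g) (hg' : PolyBdd g) :
    ExpComp fun a => f a ^ g a :=
  .natRec_nat (h := fun a i => f a ^ i) (g := fun a _ r => r * f a) (z := fun _ => 1) hg
    (by fun_prop) (by fun_prop)
    (fun _ => rfl) (fun _ _ => rfl) ((hf.expBdd.add (.const 1)).pow hg') fun _ _ h =>
      (Nat.pow_le_pow_left (Nat.le_succ _) _).trans (Nat.pow_le_pow_right (Nat.succ_pos _) h)

@[fun_prop]
theorem ExpComp.le {f g : α → ℕ} (hf : ExpComp f) (hg : ExpComp g) : ExpComp fun a => f a ≤ g a :=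
  (ExpComp.eq_zero (hf.sub hg)).of_iff fun _ => Nat.sub_eq_zero_iff_le.symm

@[fun_prop]
theorem ExpComp.lt {f g : α → ℕ} (hf : ExpComp f) (hg : ExpComp g) : ExpComp fun a => f a < g a :=
  (hg.le hf).not.of_iff fun _ => not_le.symm

@[fun_prop]
theorem ExpComp.eq {f g : α → ℕ} (hf : ExpComp f) (hg : ExpComp g) : ExpComp fun a => f a = g a :=
  ((hf.le hg).and (hg.le hf)).of_iff fun _ => le_antisymm_iff

@[fun_prop]
theorem ExpComp.exists_lt {n : α → ℕ} {P : α → ℕ → Prop} (hn : ExpComp n)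
    (hP : ExpComp fun w : α × ℕ => P w.1 w.2) : ExpComp fun a => ∃ i < n a, P a i :=
  .natRec (h := fun a i => ∃ j < i, P a j) (g := fun a i r => r ∨ P a i) (z := fun _ => False) hn
    (by fun_prop) (.or (by fun_prop) (hP.comp (f := fun w : α × ℕ × Prop => (w.1, w.2.1))
      (by fun_prop))) (fun _ => by simp)
    (fun _ _ => by
      simp only [Nat.lt_succ_iff_lt_or_eq, or_and_right, exists_or, exists_eq_left])
    (.const 3) fun _ _ _ => len_prop _

@[fun_prop]
theorem ExpComp.forall_lt {n : α → ℕ} {P : α → ℕ → Prop} (hn : ExpComp n)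
    (hP : ExpComp fun w : α × ℕ => P w.1 w.2) : ExpComp fun a => ∀ i < n a, P a i :=
  (ExpComp.exists_lt (P := fun a i => ¬P a i) hn hP.not).not.of_iff fun _ => by push Not; rfl

open Classical in
/-- The least `i < n` with `P i`, and `n` if there is none. -/
noncomputable def leastBelow (n : ℕ) (P : ℕ → Prop) : ℕ :=
  n.rec 0 fun _ r => if P r then r else r + 1

theorem leastBelow_le (n : ℕ) (P : ℕ → Prop) : leastBelow n P ≤ n := by
  induction n with
  | zero => exact le_rfl
  | succ n ih =>
    simp only [leastBelow] at *
    split_ifs <;> omega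

theorem not_of_lt_leastBelow {n : ℕ} {P : ℕ → Prop} {i : ℕ} (h : i < leastBelow n P) : ¬P i := by
  induction n with
  | zero => exact absurd h (Nat.not_lt_zero _)
  | succ n ih =>
    simp only [leastBelow] at *
    split_ifs at h with h'
    · exact ih h
    · rcases Nat.lt_succ_iff_lt_or_eq.1 h with h | rfl
      · exact ih h
      · exact h'

theorem leastBelow_spec {n : ℕ} {P : ℕ → Prop} (h : leastBelow n P < n) : P (leastBelow n P) := by
  induction n with
  | zero => exact absurd h (Nat.not_lt_zero _)
  | succ n ih =>
    simp only [leastBelow] at *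
    split_ifs at h ⊢ with h'
    · exact h'
    · exact absurd (ih (by omega)) h'

theorem leastBelow_lt {n : ℕ} {P : ℕ → Prop} (h : ∃ i < n, P i) : leastBelow n P < n := by
  obtain ⟨i, hi, hP⟩ := h
  exact (not_lt.1 fun h => not_of_lt_leastBelow h hP).trans_lt hi

theorem leastBelow_eq {n : ℕ} {P : ℕ → Prop} {i : ℕ} (hi : i < n) (hP : P i)
    (h : ∀ j < i, ¬P j) : leastBelow n P = i := by
  refine le_antisymm (not_lt.1 fun h => not_of_lt_leastBelow h hP) (not_lt.1 fun h' => ?_)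
  exact h _ h' (leastBelow_spec (h'.trans hi))

@[fun_prop]
theorem ExpComp.leastBelow {n : α → ℕ} {P : α → ℕ → Prop} (hn : ExpComp n)
    (hP : ExpComp fun w : α × ℕ => P w.1 w.2) :
    ExpComp fun a => LeaderFollower.leastBelow (n a) (P a) := by
  classical
  refine .natRec_nat (h := fun a i => LeaderFollower.leastBelow i (P a))
    (g := fun a _ r => if P a r then r else r + 1) (z := fun _ => 0) hn
    (by fun_prop) (.ite (hP.comp (f := fun w : α × ℕ × ℕ => (w.1, w.2.2)) (by fun_prop))
      (by fun_prop) (by fun_prop))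
    (fun _ => rfl) (fun a i => ?_) hn.expBdd fun _ _ h => (leastBelow_le _ _).trans h
  simp only [LeaderFollower.leastBelow]
  congr

@[fun_prop]
theorem ExpComp.div {f g : α → ℕ} (hf : ExpComp f) (hg : ExpComp g) :
    ExpComp fun a => f a / g a := by
  have h : ∀ a, f a / g a = if g a = 0 then 0 else
      LeaderFollower.leastBelow (f a + 1) (fun q => f a < (q + 1) * g a) := by
    intro a
    split_ifs with h0
    · simp [h0]
    · have h0 := Nat.pos_of_ne_zero h0
      refine (leastBelow_eq (Nat.lt_succ_of_le (Nat.div_le_self _ _)) ?_ fun j hj => ?_).symm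
      · exact (Nat.div_lt_iff_lt_mul h0).1 (Nat.lt_succ_self _)
      · exact not_lt.2 ((Nat.le_div_iff_mul_le h0).1 hj)
  simp only [h]
  fun_prop

@[fun_prop]
theorem ExpComp.mod {f g : α → ℕ} (hf : ExpComp f) (hg : ExpComp g) :
    ExpComp fun a => f a % g a := by
  have h : ∀ a, f a % g a = f a - g a * (f a / g a) := fun a => Nat.mod_eq_sub _ _
  simp only [h]
  fun_prop

theorem ExpComp.gcd {f g : α → ℕ} (hf : ExpComp f) (hg : ExpComp g) :
    ExpComp fun a => Nat.gcd (f a) (g a) := by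
  have h : ∀ a, Nat.gcd (f a) (g a) = if f a = 0 then g a else
      f a - LeaderFollower.leastBelow (f a) (fun i => f a % (f a - i) = 0 ∧ g a % (f a - i) = 0) := by
    intro a
    split_ifs with h0
    · simp [h0]
    · have h0 := Nat.pos_of_ne_zero h0
      have h1 := Nat.gcd_le_left (g a) h0
      have h2 : 0 < Nat.gcd (f a) (g a) := Nat.gcd_pos_of_pos_left _ h0
      rw [leastBelow_eq (i := f a - Nat.gcd (f a) (g a)) (by omega) _ _]
      · omega
      · rw [Nat.sub_sub_self h1]
        exact ⟨Nat.mod_eq_zero_of_dvd (Nat.gcd_dvd_left _ _),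
          Nat.mod_eq_zero_of_dvd (Nat.gcd_dvd_right _ _)⟩
      · intro j hj h
        have := Nat.le_of_dvd h2
          (Nat.dvd_gcd (Nat.dvd_of_mod_eq_zero h.1) (Nat.dvd_of_mod_eq_zero h.2))
        omega
  simp only [h]
  fun_prop

/-! ### Rational arithmetic -/

/-- The numerator and the denominator of `q` are at most `2 ^ b` in absolute value. -/
def HeightLe (q : ℚ) (b : ℕ) : Prop := q.num.natAbs ≤ 2 ^ b ∧ q.den ≤ 2 ^ b

theorem HeightLe.mono {q : ℚ} {b c : ℕ} (h : HeightLe q b) (hbc : b ≤ c) : HeightLe q c :=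
  ⟨h.1.trans (Nat.pow_le_pow_right two_pos hbc), h.2.trans (Nat.pow_le_pow_right two_pos hbc)⟩

theorem HeightLe.of_eq_div {q : ℚ} {n : ℤ} {d b : ℕ} (hd : d ≠ 0) (hq : q = n / d)
    (hn : n.natAbs ≤ 2 ^ b) (hdb : d ≤ 2 ^ b) : HeightLe q b := by
  subst hq
  constructor
  · by_cases h0 : n = 0
    · simp [h0]
    · have h := Rat.num_dvd n (b := d) (by exact_mod_cast hd)
      rw [Rat.divInt_eq_div, Int.cast_natCast] at h
      exact (Nat.le_of_dvd (Int.natAbs_pos.2 h0) (Int.natAbs_dvd_natAbs.2 h)).trans hn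
  · have h := Rat.den_dvd n d
    rw [Rat.divInt_eq_div, Int.cast_natCast] at h
    exact (Nat.le_of_dvd (Nat.pos_of_ne_zero hd) (Int.natCast_dvd_natCast.1 h)).trans hdb

theorem HeightLe.zero (b : ℕ) : HeightLe 0 b := ⟨by simp, by simpa using Nat.one_le_two_pow⟩

theorem HeightLe.one (b : ℕ) : HeightLe 1 b :=
  ⟨by simpa using Nat.one_le_two_pow, by simpa using Nat.one_le_two_pow⟩

theorem HeightLe.neg {q : ℚ} {b : ℕ} (h : HeightLe q b) : HeightLe (-q) b := by
  simpa [HeightLe] using h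

theorem HeightLe.add {q r : ℚ} {b c : ℕ} (hq : HeightLe q b) (hr : HeightLe r c) :
    HeightLe (q + r) (b + c + 1) := by
  refine .of_eq_div (n := q.num * r.den + r.num * q.den) (d := q.den * r.den)
    (Nat.mul_ne_zero q.den_ne_zero r.den_ne_zero) ?_ ?_ ?_
  · have h1 : (q.den : ℚ) ≠ 0 := by exact_mod_cast q.den_ne_zero
    have h2 : (r.den : ℚ) ≠ 0 := by exact_mod_cast r.den_ne_zero
    conv_lhs => rw [← Rat.num_div_den q, ← Rat.num_div_den r]
    push_cast
    field_simp
  · calc _ ≤ (q.num * r.den).natAbs + (r.num * q.den).natAbs := Int.natAbs_add_le _ _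
      _ = q.num.natAbs * r.den + r.num.natAbs * q.den := by simp [Int.natAbs_mul]
      _ ≤ 2 ^ b * 2 ^ c + 2 ^ c * 2 ^ b :=
        add_le_add (Nat.mul_le_mul hq.1 hr.2) (Nat.mul_le_mul hr.1 hq.2)
      _ = 2 ^ (b + c + 1) := by ring
  · calc _ ≤ 2 ^ b * 2 ^ c := Nat.mul_le_mul hq.2 hr.2
      _ ≤ 2 ^ (b + c + 1) := by
        rw [← pow_add]; exact Nat.pow_le_pow_right two_pos (Nat.le_succ _)

theorem HeightLe.sub {q r : ℚ} {b c : ℕ} (hq : HeightLe q b) (hr : HeightLe r c) :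
    HeightLe (q - r) (b + c + 1) := by
  rw [sub_eq_add_neg]
  exact hq.add hr.neg

theorem HeightLe.sum {f : ℕ → ℚ} {n b : ℕ} (h : ∀ i < n, HeightLe (f i) b) :
    HeightLe (∑ i ∈ Finset.range n, f i) (n * (b + 1)) := by
  induction n with
  | zero => simpa using HeightLe.zero _
  | succ n ih =>
    rw [Finset.sum_range_succ]
    exact ((ih fun i hi => h i (hi.trans (Nat.lt_succ_self n))).add (h n (Nat.lt_succ_self n))).mono
      (by rw [add_mul]; omega)

theorem HeightLe.mul {q r : ℚ} {b c : ℕ} (hq : HeightLe q b) (hr : HeightLe r c) :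
    HeightLe (q * r) (b + c) := by
  refine .of_eq_div (n := q.num * r.num) (d := q.den * r.den)
    (Nat.mul_ne_zero q.den_ne_zero r.den_ne_zero) ?_ ?_ ?_
  · conv_lhs => rw [← Rat.num_div_den q, ← Rat.num_div_den r]
    push_cast
    rw [div_mul_div_comm]
  · rw [Int.natAbs_mul, pow_add]
    exact Nat.mul_le_mul hq.1 hr.1
  · rw [pow_add]
    exact Nat.mul_le_mul hq.2 hr.2

theorem HeightLe.natCast {n b : ℕ} (h : n ≤ 2 ^ b) : HeightLe n b :=
  ⟨by simpa using h, by simpa using Nat.one_le_two_pow⟩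

theorem HeightLe.inv_natCast {n b : ℕ} (h : n ≤ 2 ^ b) : HeightLe (n : ℚ)⁻¹ b := by
  rcases Nat.eq_zero_or_pos n with rfl | hn
  · simpa using HeightLe.zero b
  · exact .of_eq_div (n := 1) hn.ne' (by simp) (by simpa using Nat.one_le_two_pow) h

theorem len_rat (q : ℚ) :
    len q = (encBool (decide (q.num < 0))).size + len q.num.natAbs + 1 + len q.den + 1 := rfl

theorem heightLe_len (q : ℚ) : HeightLe q (len q) := by
  have h := len_rat q
  constructor
  · exact (lt_two_pow_len _).le.trans (Nat.pow_le_pow_right two_pos (by omega))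
  · exact (lt_two_pow_len _).le.trans (Nat.pow_le_pow_right two_pos (by omega))

theorem HeightLe.len_le {q : ℚ} {b : ℕ} (h : HeightLe q b) : len q ≤ 8 * b + 15 := by
  have h0 := len_rat q
  have h1 := len_nat_le_of_lt (h.1.trans_lt (Nat.pow_lt_pow_right one_lt_two (Nat.lt_succ_self b)))
  have h2 := len_nat_le_of_lt (h.2.trans_lt (Nat.pow_lt_pow_right one_lt_two (Nat.lt_succ_self b)))
  have h3 := len_bool (decide (q.num < 0))
  change (encBool _).size ≤ 3 at h3
  omega

@[fun_prop]
theorem ExpComp.den {f : α → ℚ} (hf : ExpComp f) : ExpComp fun a => (f a).den :=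
  hf.toData.right.of_enc_eq fun _ => rfl

theorem ExpComp.num_natAbs {f : α → ℚ} (hf : ExpComp f) : ExpComp fun a => (f a).num.natAbs :=
  hf.toData.left.right.of_enc_eq fun _ => rfl

theorem ExpComp.num_neg {f : α → ℚ} (hf : ExpComp f) : ExpComp fun a => (f a).num < 0 :=
  hf.toData.left.left.of_enc_eq fun a => by
    simp only [enc, encRat, encInt, Data.left]
    congr

@[fun_prop]
theorem ExpComp.num_toNat {f : α → ℚ} (hf : ExpComp f) : ExpComp fun a => (f a).num.toNat := by
  have h : ∀ a, (f a).num.toNat = if (f a).num < 0 then 0 else (f a).num.natAbs := by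
    intro a; split_ifs <;> omega
  simp only [h]
  exact .ite hf.num_neg (.const 0) hf.num_natAbs

@[fun_prop]
theorem ExpComp.neg_num_toNat {f : α → ℚ} (hf : ExpComp f) :
    ExpComp fun a => (-(f a).num).toNat := by
  have h : ∀ a, (-(f a).num).toNat = if (f a).num < 0 then (f a).num.natAbs else 0 := by
    intro a; split_ifs <;> omega
  simp only [h]
  exact .ite hf.num_neg hf.num_natAbs (.const 0)

theorem enc_mkRat (z : ℤ) {d : ℕ} (hd : d ≠ 0) :
    enc (mkRat z d) = .cons (.cons (enc (z < 0)) (enc (z.natAbs / d.gcd z.natAbs)))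
      (enc (d / d.gcd z.natAbs)) := by
  have hg : 0 < d.gcd z.natAbs := Nat.gcd_pos_of_pos_left _ (Nat.pos_of_ne_zero hd)
  have hdvd : ((d.gcd z.natAbs : ℕ) : ℤ) ∣ z :=
    Int.natCast_dvd.2 (Nat.gcd_dvd_right _ _)
  have hs : (z / (d.gcd z.natAbs : ℕ) < 0) = (z < 0) := by
    obtain ⟨w, hw⟩ := hdvd
    generalize d.gcd z.natAbs = g at *
    have hg' : (0 : ℤ) < g := by exact_mod_cast hg
    rw [hw, Int.mul_ediv_cancel_left _ hg'.ne', mul_neg_iff]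
    simp [hg, hg'.not_gt]
  have hn : (z / (d.gcd z.natAbs : ℕ)).natAbs = z.natAbs / d.gcd z.natAbs := by
    rw [Int.natAbs_ediv_of_dvd hdvd, Int.natAbs_natCast]
  simp only [enc, encRat, encInt, Rat.num_mkRat, Rat.den_mkRat, if_neg hd, hn]
  congr

theorem ExpComp.ratMk {p n d : α → ℕ} (hp : ExpComp p) (hn : ExpComp n) (hd : ExpComp d) :
    ExpComp fun a => ((p a : ℚ) - n a) / d a := by
  have h : ∀ a, ((p a : ℚ) - n a) / d a = if d a = 0 then 0 else mkRat ((p a : ℤ) - n a) (d a) := by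
    intro a
    split_ifs with h0
    · simp [h0]
    · rw [Rat.mkRat_eq_div]; push_cast; rfl
  simp only [h]
  have h1 : ExpComp fun a => p a - n a + (n a - p a) := by fun_prop
  have h2 : ExpComp fun a => if d a = 0 then enc (0 : ℚ) else enc (mkRat ((p a : ℤ) - n a) (d a)) := by
    have h3 := ((((hp.lt hn).prodMk (h1.div (hd.gcd h1))).prodMk (hd.div (hd.gcd h1)))).toData
    refine ((hd.eq_zero).ite (.const (enc (0 : ℚ))) h3).of_enc_eq fun a => ?_
    split_ifs with h0
    · rfl
    · have h4 : ((p a : ℤ) - n a).natAbs = p a - n a + (n a - p a) := by omega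
      have h5 : ((p a : ℤ) - n a < 0) = (p a < n a) := by
        rw [sub_neg, Nat.cast_lt]
      rw [enc_mkRat _ h0, h4, h5]
      rfl
  exact h2.of_enc_eq fun a => by split_ifs <;> rfl

theorem num_eq_sub (q : ℚ) : (q.num : ℚ) = (q.num.toNat : ℚ) - ((-q.num).toNat : ℚ) := by
  have : q.num = (q.num.toNat : ℤ) - ((-q.num).toNat : ℤ) := by omega
  exact_mod_cast congrArg (Int.cast : ℤ → ℚ) this

theorem eq_sub_div (q : ℚ) : q = ((q.num.toNat : ℚ) - ((-q.num).toNat : ℚ)) / q.den := by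
  rw [← num_eq_sub, Rat.num_div_den]

@[fun_prop]
theorem ExpComp.natCast {f : α → ℕ} (hf : ExpComp f) : ExpComp fun a => (f a : ℚ) :=
  (hf.ratMk (.const 0) (.const 1)).of_enc_eq fun a => by simp

@[fun_prop]
theorem ExpComp.rat_add {f g : α → ℚ} (hf : ExpComp f) (hg : ExpComp g) :
    ExpComp fun a => f a + g a := by
  refine (ExpComp.ratMk
    (p := fun a => (f a).num.toNat * (g a).den + (g a).num.toNat * (f a).den)
    (n := fun a => (-(f a).num).toNat * (g a).den + (-(g a).num).toNat * (f a).den)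
    (d := fun a => (f a).den * (g a).den)
    (by fun_prop) (by fun_prop) (by fun_prop)).of_enc_eq fun a => congrArg enc ?_
  have h1 : ((f a).den : ℚ) ≠ 0 := by exact_mod_cast (f a).den_ne_zero
  have h2 : ((g a).den : ℚ) ≠ 0 := by exact_mod_cast (g a).den_ne_zero
  conv_lhs => rw [eq_sub_div (f a), eq_sub_div (g a)]
  push_cast
  field_simp
  ring

@[fun_prop]
theorem ExpComp.rat_neg {f : α → ℚ} (hf : ExpComp f) : ExpComp fun a => -f a := by
  refine (ExpComp.ratMk (p := fun a => (-(f a).num).toNat) (n := fun a => (f a).num.toNat)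
    (d := fun a => (f a).den) (by fun_prop) (by fun_prop) (by fun_prop)).of_enc_eq
    fun a => congrArg enc ?_
  conv_lhs => rw [eq_sub_div (f a)]
  ring

@[fun_prop]
theorem ExpComp.rat_sub {f g : α → ℚ} (hf : ExpComp f) (hg : ExpComp g) :
    ExpComp fun a => f a - g a := by
  simp only [sub_eq_add_neg]
  fun_prop

@[fun_prop]
theorem ExpComp.rat_mul {f g : α → ℚ} (hf : ExpComp f) (hg : ExpComp g) :
    ExpComp fun a => f a * g a := by
  refine (ExpComp.ratMk
    (p := fun a => (f a).num.toNat * (g a).num.toNat + (-(f a).num).toNat * (-(g a).num).toNat)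
    (n := fun a => (f a).num.toNat * (-(g a).num).toNat + (-(f a).num).toNat * (g a).num.toNat)
    (d := fun a => (f a).den * (g a).den)
    (by fun_prop) (by fun_prop) (by fun_prop)).of_enc_eq fun a => congrArg enc ?_
  conv_lhs => rw [eq_sub_div (f a), eq_sub_div (g a)]
  push_cast
  rw [div_mul_div_comm]
  ring

@[fun_prop]
theorem ExpComp.rat_div_natCast {f : α → ℚ} {g : α → ℕ} (hf : ExpComp f) (hg : ExpComp g) :
    ExpComp fun a => f a / g a := by
  refine (ExpComp.ratMk (p := fun a => (f a).num.toNat) (n := fun a => (-(f a).num).toNat)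
    (d := fun a => (f a).den * g a) (by fun_prop) (by fun_prop) (by fun_prop)).of_enc_eq
    fun a => congrArg enc ?_
  conv_lhs => rw [eq_sub_div (f a)]
  push_cast
  rw [div_div]

@[fun_prop]
theorem ExpComp.rat_nonneg {f : α → ℚ} (hf : ExpComp f) : ExpComp fun a => 0 ≤ f a :=
  hf.num_neg.not.of_iff fun a => by rw [not_lt, Rat.num_nonneg]

@[fun_prop]
theorem ExpComp.rat_le {f g : α → ℚ} (hf : ExpComp f) (hg : ExpComp g) :
    ExpComp fun a => f a ≤ g a :=
  (hg.rat_sub hf).rat_nonneg.of_iff fun _ => sub_nonneg.symm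

@[fun_prop]
theorem ExpComp.rat_lt {f g : α → ℚ} (hf : ExpComp f) (hg : ExpComp g) :
    ExpComp fun a => f a < g a :=
  (hg.rat_le hf).not.of_iff fun _ => not_le.symm

@[fun_prop]
theorem ExpComp.rat_eq {f g : α → ℚ} (hf : ExpComp f) (hg : ExpComp g) :
    ExpComp fun a => f a = g a :=
  ((hf.rat_le hg).and (hg.rat_le hf)).of_iff fun _ => le_antisymm_iff

/-- The values of `f` at the pairs `(a, i)` with `i < n a` are polynomially long in `a`. -/
theorem PolyBdd.exists_of_lt {n : α → ℕ} {f : α → ℕ → β} (hn : PolyBdd fun a => len (n a))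
    (hf : ExpComp fun w : α × ℕ => f w.1 w.2) :
    ∃ b : α → ℕ, PolyBdd b ∧ ∀ a, ∀ i ≤ n a, len (f a i) ≤ b a := by
  obtain ⟨p, hp⟩ := hf.polyBdd
  refine ⟨fun a => p.eval (len a + (4 * len (n a) + 1) + 1),
    ((PolyBdd.self.add (((PolyBdd.const 4).mul hn).add (.const 1))).add (.const 1)).eval p,
    fun a i hi => (hp (a, i)).trans (eval_mono p ?_)⟩
  have := len_nat_mono hi
  rw [len_pair]
  omega

theorem ExpComp.sum_range {n : α → ℕ} {f : α → ℕ → ℚ} (hn : ExpComp n) (hn' : PolyBdd n)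
    (hf : ExpComp fun w : α × ℕ => f w.1 w.2) :
    ExpComp fun a => ∑ i ∈ Finset.range (n a), f a i := by
  obtain ⟨b, hb, hlen⟩ := PolyBdd.exists_of_lt hn.polyBdd hf
  refine .natRec (h := fun a i => ∑ j ∈ Finset.range i, f a j) (z := fun _ => 0)
    (g := fun a i r => r + f a i) (b := fun a => 8 * (n a * (b a + 1)) + 15) hn (by fun_prop)
    (.rat_add (by fun_prop) (hf.comp (f := fun w : α × ℕ × ℚ => (w.1, w.2.1)) (by fun_prop)))
    (fun _ => rfl) (fun _ _ => Finset.sum_range_succ _ _)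
    (((PolyBdd.const 8).mul (hn'.mul (hb.add (.const 1)))).add (.const 15)) fun a i hi => ?_
  have h1 : HeightLe (∑ j ∈ Finset.range i, f a j) (i * (b a + 1)) :=
    .sum fun j hj => (heightLe_len _).mono (hlen a j (hj.le.trans hi))
  have h2 := h1.len_le
  have h3 := Nat.mul_le_mul_right (b a + 1) hi
  omega

theorem ExpComp.map_range {n : α → ℕ} {f : α → ℕ → β} (hn : ExpComp n) (hn' : PolyBdd n)
    (hf : ExpComp fun w : α × ℕ => f w.1 w.2) :
    ExpComp fun a => (List.range (n a)).map (f a) := by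
  obtain ⟨b, hb, hlen⟩ := PolyBdd.exists_of_lt hn.polyBdd hf
  have h := ExpComp.natRec (h := fun a i => ((List.range i).map (f a)).reverse) (z := fun _ => [])
    (g := fun a i r => f a i :: r) (b := fun a => n a * (b a + 1) + 1) hn (by fun_prop)
    (.listCons (hf.comp (f := fun w : α × ℕ × List β => (w.1, w.2.1)) (by fun_prop)) (by fun_prop))
    (fun _ => rfl) (fun _ _ => by simp [List.range_succ])
    ((hn'.mul (hb.add (.const 1))).add (.const 1)) fun a i hi => ?_
  · simpa using h.reverse
  rw [len_reverse]
  have : len ((List.range i).map (f a)) ≤ i * (b a + 1) + 1 := by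
    induction i with
    | zero => simp [len_listNil]
    | succ i ih =>
      have h1 := len_append ((List.range i).map (f a)) [f a i]
      have h2 := hlen a i (by omega)
      have h3 := ih (by omega)
      simp only [List.range_succ, List.map_append, List.map_cons, List.map_nil, len_listCons,
        len_listNil] at *
      rw [add_mul]
      omega
  have h3 := Nat.mul_le_mul_right (b a + 1) hi
  omega

/-! ### The length of the input, digits and table look-up -/

theorem ExpComp.sum_range_nat {n : α → ℕ} {f : α → ℕ → ℕ} (hn : ExpComp n) (hn' : PolyBdd n)
    (hf : ExpComp fun w : α × ℕ => f w.1 w.2) :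
    ExpComp fun a => ∑ i ∈ Finset.range (n a), f a i := by
  have h := ExpComp.sum_range (f := fun a i => (f a i : ℚ)) hn hn' (by fun_prop)
  refine h.num_natAbs.of_enc_eq fun a => ?_
  rw [← Nat.cast_sum, Rat.num_natCast, Int.natAbs_natCast]

theorem ExpComp.eq_dataNil {f : α → Data} (hf : ExpComp f) : ExpComp fun a => f a = .nil :=
  .cases (f := fun _ => False) hf (.const False) (.const True) (fun a h => by simp [h])
    fun a h => by simp [h]

@[fun_prop]
theorem ExpComp.len {f : α → β} (hf : ExpComp f) : ExpComp fun a => len (f a) := by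
  -- visit the nodes of the tree, with a stack of subtrees that are still to be visited
  let st : List Data × ℕ → List Data × ℕ := fun s =>
    match s.1 with
    | [] => s
    | d :: l => (if d = .nil then l else d.left :: d.right :: l, s.2 + 1)
  have hst : ExpComp st :=
    .listCases (L := fun s : List Data × ℕ => s.1) (z := fun s => s)
      (g := fun s d l => (if d = .nil then l else d.left :: d.right :: l, s.2 + 1)) (by fun_prop)
      (by fun_prop) (.prodMk (.ite (.eq_dataNil (by fun_prop)) (by fun_prop) (by fun_prop))
        (by fun_prop)) (fun s h => by simp [st, h]) (fun s d l h => by simp [st, h])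
  let tot : List Data → ℕ := fun l => (l.map Data.size).sum
  have htot : ∀ s, s.1 ≠ [] → tot (st s).1 + 1 = tot s.1 ∧ (st s).2 = s.2 + 1 := by
    rintro ⟨_ | ⟨d, l⟩, n⟩ h
    · exact absurd rfl h
    · cases d with
      | nil => simp [st, tot, Data.size]; omega
      | cons x y => simp [st, tot, Data.size, Data.left, Data.right]; omega
  have h0 : ∀ l, tot l ≠ 0 ↔ l ≠ [] := by
    intro l
    cases l with
    | nil => simp [tot]
    | cons d l => simp [tot, (Data.size_pos d).ne']
  have hit : ∀ d j, j ≤ d.size → tot (st^[j] ([d], 0)).1 = d.size - j ∧ (st^[j] ([d], 0)).2 = j := by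
    intro d j
    induction j with
    | zero => simp [tot]
    | succ j ih =>
      intro hj
      obtain ⟨h1, h2⟩ := ih (by omega)
      rw [Function.iterate_succ_apply']
      obtain ⟨h3, h4⟩ := htot (st^[j] ([d], 0)) ((h0 _).1 (by omega))
      omega
  have hlen : ∀ l : List Data, LeaderFollower.len l ≤ 2 * tot l + 1 := by
    intro l
    induction l with
    | nil => simp [len_listNil]
    | cons d l ih =>
      have h1 : LeaderFollower.len d = d.size := rfl
      have h2 := Data.size_pos d
      have h3 : tot (d :: l) = d.size + tot l := rfl
      rw [len_listCons]
      omega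
  have hw := ExpComp.iterate_while (i := fun a => ([enc (f a)], 0)) (c := fun s => s.1 ≠ [])
    (g := st) (n := fun a => LeaderFollower.len (f a))
    (b := fun a => 2 * LeaderFollower.len (f a) + 1 + (4 * LeaderFollower.len (f a) + 1) + 1)
    (.prodMk (.listCons hf.toData (by fun_prop)) (by fun_prop)) (.ne_nil (by fun_prop)) hst
    hf.polyBdd.expBdd
    (fun a j hj => by
      have h1 := (hit (enc (f a)) j hj.le).1
      refine (h0 _).1 ?_
      change j < (enc (f a)).size at hj
      omega)
    (fun a h => by
      have h1 := (hit (enc (f a)) _ le_rfl).1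
      exact (h0 _).2 h (by rw [Nat.sub_self] at h1; exact h1))
    ((((PolyBdd.const 2).mul hf.polyBdd).add (.const 1)).add
      (((PolyBdd.const 4).mul hf.polyBdd).add (.const 1)) |>.add (.const 1))
    (fun a j hj => by
      obtain ⟨h1, h2⟩ := hit (enc (f a)) j hj
      have h3 := hlen (st^[j] ([enc (f a)], 0)).1
      have h4 := len_nat_le_of_lt ((Nat.lt_two_pow_self (n := j)).trans_le
        (Nat.pow_le_pow_right two_pos hj))
      have h5 : LeaderFollower.len (st^[j] ([enc (f a)], 0)) = LeaderFollower.len (st^[j] ([enc (f a)], 0)).1 +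
        LeaderFollower.len (st^[j] ([enc (f a)], 0)).2 + 1 := rfl
      have h6 : (enc (f a)).size = LeaderFollower.len (f a) := rfl
      rw [h2] at h5
      omega)
  exact hw.snd.of_enc_eq fun a => congrArg enc (hit (enc (f a)) _ le_rfl).2.symm

/-- The digit with index `q` of `c` in base `b`. -/
def digit (b c q : ℕ) : ℕ := c / b ^ q % b

@[fun_prop]
theorem ExpComp.digit {b c q : α → ℕ} (hb : ExpComp b) (hc : ExpComp c) (hq : ExpComp q) :
    ExpComp fun a => LeaderFollower.digit (b a) (c a) (q a) := by
  -- repeated division keeps the intermediate values small even if `q` is large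
  have h : ExpComp fun a => c a / b a ^ q a :=
    .natRec_nat (h := fun a i => c a / b a ^ i) (g := fun a _ r => r / b a) hq hc (by fun_prop)
      (fun _ => by simp) (fun _ _ => by rw [pow_succ, Nat.div_div_eq_div_mul]) hc.expBdd
      fun _ _ _ => Nat.div_le_self _ _
  exact h.mod hb

/-- The entry with index `i` of a tree that represents a list. -/
def Data.nth (d : Data) (i : ℕ) : Data := (Data.right^[i] d).left

theorem Data.size_iterate_right_le (d : Data) (i : ℕ) : (Data.right^[i] d).size ≤ d.size := by
  induction i with
  | zero => exact le_rfl
  | succ i ih =>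
    rw [Function.iterate_succ_apply']
    exact (Data.size_right_le _).trans ih

theorem Data.size_nth_le (d : Data) (i : ℕ) : (d.nth i).size ≤ d.size :=
  (Data.size_left_le _).trans (d.size_iterate_right_le i)

theorem nth_encList (l : List Data) (i : ℕ) (hi : i < l.length) : (encList l).nth i = l[i] := by
  induction l generalizing i with
  | nil => simp at hi
  | cons d l ih =>
    cases i with
    | zero => rfl
    | succ i => exact ih i (by simpa using hi)

@[fun_prop]
theorem ExpComp.nth {d : α → Data} {i : α → ℕ} (hd : ExpComp d) (hi : ExpComp i) :
    ExpComp fun a => (d a).nth (i a) :=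
  ExpComp.left <| .natRec (h := fun a j => Data.right^[j] (d a)) (g := fun _ _ r => r.right) hi hd
    (by fun_prop) (fun _ => rfl) (fun _ _ => Function.iterate_succ_apply' _ _ _) hd.polyBdd
    fun a j _ => (d a).size_iterate_right_le j

/-- The subtable obtained from a table by fixing the first `k` indices. -/
def Data.lookup (d : Data) (idx : ℕ → ℕ) (k : ℕ) : Data := k.rec d fun q t => t.nth (idx q)

theorem Data.size_lookup_le (d : Data) (idx : ℕ → ℕ) (k : ℕ) : (d.lookup idx k).size ≤ d.size := by
  induction k with
  | zero => exact le_rfl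
  | succ k ih => exact (Data.size_nth_le _ _).trans ih

theorem Data.lookup_succ (d : Data) (idx : ℕ → ℕ) (k : ℕ) :
    d.lookup idx (k + 1) = (d.nth (idx 0)).lookup (fun q => idx (q + 1)) k := by
  induction k with
  | zero => rfl
  | succ k ih => exact congrArg (fun t => Data.nth t (idx (k + 1))) ih

theorem lookup_encTable {k : ℕ} (m : Fin k → ℕ) (T : ((p : Fin k) → Fin (m p)) → Data)
    (a : (p : Fin k) → Fin (m p)) (idx : ℕ → ℕ) (h : ∀ q : Fin k, idx q = a q) :
    (encTable m T).lookup idx k = T a := by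
  induction k generalizing idx with
  | zero => exact congrArg T (funext fun p => p.elim0)
  | succ k ih =>
    have h0 : idx 0 < m 0 := by simpa using (h 0).trans_lt (a 0).2
    rw [Data.lookup_succ, encTable, nth_encList _ _ (by simpa using h0), List.getElem_ofFn]
    rw [ih (fun p => m p.succ) _ (fun p => a p.succ) _ (fun q => by simpa using h q.succ)]
    congr 1
    funext p
    refine Fin.cases ?_ (fun p => ?_) p
    · exact Fin.ext (h 0)
    · rfl

theorem ExpComp.lookup {d : α → Data} {idx : α → ℕ → ℕ} {k : α → ℕ} (hd : ExpComp d)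
    (hi : ExpComp fun w : α × ℕ => idx w.1 w.2) (hk : ExpComp k) :
    ExpComp fun a => (d a).lookup (idx a) (k a) :=
  .natRec (h := fun a j => (d a).lookup (idx a) j) (g := fun a q t => t.nth (idx a q)) hk hd
    (.nth (by fun_prop) (hi.comp (f := fun w : α × ℕ × Data => (w.1, w.2.1)) (by fun_prop)))
    (fun _ => rfl) (fun _ _ => rfl) hd.polyBdd fun _ _ _ => Data.size_lookup_le _ _ _

@[fun_prop]
theorem ExpComp.length {L : α → List β} (hL : ExpComp L) : ExpComp fun a => (L a).length :=
  .listRec (h := fun _ l => l.length) (z := fun _ => 0) (g := fun _ _ _ r => r + 1) hL (by fun_prop)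
    (by fun_prop) (fun _ => rfl) (fun _ _ _ => rfl)
    (((PolyBdd.const 4).mul hL.polyBdd).add (.const 1)) fun a _ h =>
      len_nat_le_of_lt (Nat.lt_two_pow_self.trans_le (Nat.pow_le_pow_right two_pos
        (h.length_le.trans (length_lt_len _).le)))

/-! ### Access to the data of a game -/

instance : Enc Game := ⟨Game.encode⟩

namespace Game

/-- The number of actions of the follower with index `q` (and `0` if there is none). -/
def actions (G : Game) (q : ℕ) : ℕ := if h : q < G.k then G.m ⟨q, h⟩ else 0

open Classical in
/-- Payoffs of the followers, for players and actions given by natural numbers; `0` if an index is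
out of range. -/
noncomputable def payU (G : Game) (p : ℕ) (a : ℕ → ℕ) (j : ℕ) : ℚ :=
  if h : p < G.k ∧ j < G.l ∧ ∀ q : Fin G.k, a q < G.m q then
    G.U ⟨p, h.1⟩ (fun q => ⟨a q, h.2.2 q⟩) ⟨j, h.2.1⟩ else 0

open Classical in
/-- Payoffs of the leader, for actions given by natural numbers; `0` if an index is out of range. -/
noncomputable def payV (G : Game) (a : ℕ → ℕ) (j : ℕ) : ℚ :=
  if h : j < G.l ∧ ∀ q : Fin G.k, a q < G.m q then G.V (fun q => ⟨a q, h.2 q⟩) ⟨j, h.1⟩ else 0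

theorem nth_payV (G : Game) (a : G.Profile) (j : Fin G.l) (idx : ℕ → ℕ)
    (h : ∀ q : Fin G.k, idx q = a q) :
    (G.encode.right.right.left.lookup idx G.k).nth j = enc (G.V a j) := by
  have h1 : G.encode.right.right.left = encTable G.m fun a => encVec (G.V a) := rfl
  rw [h1, lookup_encTable _ _ a idx h, encVec, nth_encList _ _ (by simp), List.getElem_ofFn]
  rfl

theorem nth_payU (G : Game) (p : Fin G.k) (a : G.Profile) (j : Fin G.l) (idx : ℕ → ℕ)
    (h : ∀ q : Fin G.k, idx q = a q) :
    ((G.encode.right.right.right.nth p).lookup idx G.k).nth j = enc (G.U p a j) := by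
  have h1 : G.encode.right.right.right =
    encList (List.ofFn fun p => encTable G.m fun a => encVec (G.U p a)) := rfl
  rw [h1, nth_encList _ _ (by simp), List.getElem_ofFn, lookup_encTable _ _ a idx h, encVec,
    nth_encList _ _ (by simp), List.getElem_ofFn]
  rfl

theorem k_lt_len (G : Game) : G.k < len G := by
  have h1 := length_lt_len (List.ofFn G.m)
  have h2 : len (List.ofFn G.m) ≤ len G := by
    have : enc (List.ofFn G.m) = G.encode.left := by
      simp [enc, encode, Data.left, List.map_ofFn, Function.comp_def]
    rw [len, this]
    exact Data.size_left_le _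
  rw [List.length_ofFn] at h1
  omega

theorem len_V_le (G : Game) (a : G.Profile) (j : Fin G.l) : len (G.V a j) ≤ len G := by
  rw [len, ← G.nth_payV a j (fun q => if h : q < G.k then a ⟨q, h⟩ else 0) fun q => by simp]
  exact (Data.size_nth_le _ _).trans <| (Data.size_lookup_le _ _ _).trans <|
    (Data.size_left_le _).trans <| (Data.size_right_le _).trans (Data.size_right_le _)

theorem len_U_le (G : Game) (p : Fin G.k) (a : G.Profile) (j : Fin G.l) :
    len (G.U p a j) ≤ len G := by
  rw [len, ← G.nth_payU p a j (fun q => if h : q < G.k then a ⟨q, h⟩ else 0) fun q => by simp]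
  exact (Data.size_nth_le _ _).trans <| (Data.size_lookup_le _ _ _).trans <|
    (Data.size_nth_le _ _).trans <|
    (Data.size_right_le _).trans <| (Data.size_right_le _).trans (Data.size_right_le _)

theorem l_lt_len (G : Game) : G.l < len G := by
  let a : G.Profile := fun p => ⟨0, G.m_pos p⟩
  have h1 : G.encode.right.right.left.lookup (fun _ => 0) G.k = encVec (G.V a) :=
    lookup_encTable G.m (fun a => encVec (G.V a)) a (fun _ => 0) fun _ => rfl
  have h2 := Data.size_lookup_le G.encode.right.right.left (fun _ => 0) G.k
  have h3 : G.encode.right.right.left.size ≤ len G :=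
    (Data.size_left_le _).trans <| (Data.size_right_le _).trans (Data.size_right_le _)
  have h4 := length_lt_len (List.ofFn (G.V a))
  have h5 : len (List.ofFn (G.V a)) = (encVec (G.V a)).size := by
    simp [len, enc, encVec, List.map_ofFn, Function.comp_def]
  rw [List.length_ofFn] at h4
  rw [h1] at h2
  omega

theorem m_lt (G : Game) (p : Fin G.k) : G.m p < 2 ^ len G := by
  refine (lt_two_pow_len _).trans_le (Nat.pow_le_pow_right two_pos ?_)
  have h1 : G.encode.left.nth p = enc (G.m p) := by
    have : G.encode.left = encList (List.ofFn fun p => encNat (G.m p)) := rfl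
    rw [this, nth_encList _ _ (by simp), List.getElem_ofFn]
    rfl
  rw [len, ← h1]
  exact (Data.size_nth_le _ _).trans (Data.size_left_le _)

end Game

@[fun_prop]
theorem ExpComp.game_k {G : α → Game} (hG : ExpComp G) : ExpComp fun a => (G a).k := by
  have h : ExpComp fun a => List.ofFn (G a).m := hG.toData.left.of_enc_eq fun a => by
    simp [enc, Game.encode, Data.left, List.map_ofFn, Function.comp_def]
  exact h.length.of_enc_eq fun a => by rw [List.length_ofFn]

theorem ExpComp.polyBdd_k {G : α → Game} (hG : ExpComp G) : PolyBdd fun a => (G a).k :=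
  hG.polyBdd.of_le fun a => (G a).k_lt_len.le

@[fun_prop]
theorem ExpComp.game_l {G : α → Game} (hG : ExpComp G) : ExpComp fun a => (G a).l :=
  hG.toData.right.left.of_enc_eq fun _ => rfl

theorem ExpComp.polyBdd_l {G : α → Game} (hG : ExpComp G) : PolyBdd fun a => (G a).l :=
  hG.polyBdd.of_le fun a => (G a).l_lt_len.le

@[fun_prop]
theorem ExpComp.actions {G : α → Game} {q : α → ℕ} (hG : ExpComp G) (hq : ExpComp q) :
    ExpComp fun a => (G a).actions (q a) := by
  have h : ExpComp fun a => if q a < (G a).k then (enc (G a)).left.nth (q a) else enc (0 : ℕ) :=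
    .ite (by fun_prop) (.nth hG.toData.left hq) (.const _)
  refine h.of_enc_eq fun a => ?_
  unfold Game.actions
  split_ifs with h
  · have h1 : (enc (G a)).left = encList (List.ofFn fun p => encNat ((G a).m p)) := rfl
    rw [h1, nth_encList _ _ (by simpa using h), List.getElem_ofFn]
    rfl
  · rfl

theorem forall_lt_actions {G : Game} {a : ℕ → ℕ} :
    (∀ q < G.k, a q < G.actions q) ↔ ∀ q : Fin G.k, a q < G.m q := by
  refine ⟨fun h q => by simpa [Game.actions] using h q q.2, fun h q hq => ?_⟩
  simpa [Game.actions, hq] using h ⟨q, hq⟩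

theorem ExpComp.payV {G : α → Game} {idx : α → ℕ → ℕ} {j : α → ℕ} (hG : ExpComp G)
    (hi : ExpComp fun w : α × ℕ => idx w.1 w.2) (hj : ExpComp j) :
    ExpComp fun a => (G a).payV (idx a) (j a) := by
  classical
  have h : ExpComp fun a => if j a < (G a).l ∧ ∀ q < (G a).k, idx a q < (G a).actions q then
      ((enc (G a)).right.right.left.lookup (idx a) (G a).k).nth (j a) else enc (0 : ℚ) :=
    .ite (by fun_prop) (.nth (.lookup hG.toData.right.right.left hi (by fun_prop)) hj) (.const _)
  refine h.of_enc_eq fun a => ?_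
  unfold Game.payV
  simp only [forall_lt_actions]
  split_ifs with h
  · exact ((G a).nth_payV (fun q => ⟨idx a q, h.2 q⟩) ⟨j a, h.1⟩ (idx a) fun _ => rfl).symm
  · rfl

theorem ExpComp.payU {G : α → Game} {p : α → ℕ} {idx : α → ℕ → ℕ} {j : α → ℕ} (hG : ExpComp G)
    (hp : ExpComp p) (hi : ExpComp fun w : α × ℕ => idx w.1 w.2) (hj : ExpComp j) :
    ExpComp fun a => (G a).payU (p a) (idx a) (j a) := by
  classical
  have h : ExpComp fun a =>
      if p a < (G a).k ∧ j a < (G a).l ∧ ∀ q < (G a).k, idx a q < (G a).actions q then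
      (((enc (G a)).right.right.right.nth (p a)).lookup (idx a) (G a).k).nth (j a)
      else enc (0 : ℚ) :=
    .ite (by fun_prop) (.nth (.lookup (.nth hG.toData.right.right.right hp) hi (by fun_prop)) hj)
      (.const _)
  refine h.of_enc_eq fun a => ?_
  unfold Game.payU
  simp only [forall_lt_actions]
  split_ifs with h
  · exact ((G a).nth_payU ⟨p a, h.1⟩ (fun q => ⟨idx a q, h.2.2 q⟩) ⟨j a, h.2.1⟩ (idx a)
      fun _ => rfl).symm
  · rfl

/-! ### Small vertices of polyhedra -/

section Vertex

variable {ι κ : Type} [Fintype κ]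

open Matrix

/-- If a linear objective attains its maximum over the polyhedron `{z | ∀ i, b i ≤ R i ⬝ᵥ z}`, and
no line lies in the polyhedron, then the maximum is attained at a vertex: a point that is determined
by its tight constraints. -/
theorem exists_vertex [Fintype ι] (R : ι → κ → ℝ) (b : ι → ℝ) (c : κ → ℝ)
    (hR : ∀ y, (∀ i, R i ⬝ᵥ y = 0) → y = 0) (z₀ : κ → ℝ) (hz₀ : ∀ i, b i ≤ R i ⬝ᵥ z₀)
    (hopt : ∀ z, (∀ i, b i ≤ R i ⬝ᵥ z) → c ⬝ᵥ z ≤ c ⬝ᵥ z₀) :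
    ∃ z, (∀ i, b i ≤ R i ⬝ᵥ z) ∧ c ⬝ᵥ z = c ⬝ᵥ z₀ ∧
      ∀ y, (∀ i, R i ⬝ᵥ z = b i → R i ⬝ᵥ y = 0) → y = 0 := by
  classical
  -- induction on the number of constraints that are not tight
  suffices H : ∀ n z, (Finset.univ.filter fun i => R i ⬝ᵥ z ≠ b i).card = n →
      (∀ i, b i ≤ R i ⬝ᵥ z) → c ⬝ᵥ z = c ⬝ᵥ z₀ → ∃ z, (∀ i, b i ≤ R i ⬝ᵥ z) ∧
      c ⬝ᵥ z = c ⬝ᵥ z₀ ∧ ∀ y, (∀ i, R i ⬝ᵥ z = b i → R i ⬝ᵥ y = 0) → y = 0 from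
    H _ z₀ rfl hz₀ rfl
  intro n
  induction n using Nat.strong_induction_on with
  | _ n ih =>
  intro z hn hz hc
  by_contra! hcon
  obtain ⟨y, hy, hy0⟩ := hcon z hz hc
  have hmul : ∀ (v y : κ → ℝ) (t : ℝ), v ⬝ᵥ (z + t • y) = v ⬝ᵥ z + t * (v ⬝ᵥ y) := by
    intro v y t
    rw [dotProduct_add, dotProduct_smul, smul_eq_mul]
  -- small steps in the directions `y` and `-y` are feasible, so the objective is constant along `y`
  obtain ⟨ε, hε, hstep⟩ : ∃ ε > 0, ∀ i, ε * |R i ⬝ᵥ y| ≤ R i ⬝ᵥ z - b i := by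
    have h1 : ∀ i, ∃ ε > 0, ε * |R i ⬝ᵥ y| ≤ R i ⬝ᵥ z - b i := by
      intro i
      rcases (hz i).eq_or_lt with h | h
      · exact ⟨1, one_pos, by simp [hy i h.symm, h]⟩
      · refine ⟨(R i ⬝ᵥ z - b i) / (|R i ⬝ᵥ y| + 1), div_pos (sub_pos.2 h) (by positivity), ?_⟩
        rw [div_mul_eq_mul_div, div_le_iff₀ (by positivity)]
        exact mul_le_mul_of_nonneg_left (by linarith) (sub_pos.2 h).le
    choose e he hes using h1
    rcases isEmpty_or_nonempty ι with hι | hι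
    · exact ⟨1, one_pos, fun i => hι.elim i⟩
    · refine ⟨Finset.univ.inf' Finset.univ_nonempty e, (Finset.lt_inf'_iff _).2 fun i _ => he i,
        fun i => le_trans ?_ (hes i)⟩
      exact mul_le_mul_of_nonneg_right (Finset.inf'_le _ (Finset.mem_univ i)) (abs_nonneg _)
  have hcy : c ⬝ᵥ y = 0 := by
    have h1 := hopt (z + ε • y) fun i => by
      rw [hmul]; nlinarith [hstep i, neg_abs_le (R i ⬝ᵥ y)]
    have h2 := hopt (z + (-ε) • y) fun i => by
      rw [hmul]; nlinarith [hstep i, le_abs_self (R i ⬝ᵥ y)]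
    rw [hmul, hc] at h1 h2
    nlinarith
  -- a direction in which some constraint becomes tight
  obtain ⟨y, hy, hcy, i₀, hi₀⟩ : ∃ y, (∀ i, R i ⬝ᵥ z = b i → R i ⬝ᵥ y = 0) ∧ c ⬝ᵥ y = 0 ∧
      ∃ i, R i ⬝ᵥ y < 0 := by
    obtain ⟨i, hi⟩ : ∃ i, R i ⬝ᵥ y ≠ 0 := by
      by_contra! h
      exact hy0 (hR y h)
    rcases hi.lt_or_gt with hi | hi
    · exact ⟨y, hy, hcy, i, hi⟩
    · exact ⟨-y, fun i h => by simp [hy i h], by simp [hcy], i, by simpa using hi⟩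
  obtain ⟨i₁, hi₁, hmin⟩ := Finset.exists_min_image (Finset.univ.filter fun i => R i ⬝ᵥ y < 0)
    (fun i => (R i ⬝ᵥ z - b i) / -(R i ⬝ᵥ y)) ⟨i₀, by simpa using hi₀⟩
  simp only [Finset.mem_filter, Finset.mem_univ, true_and] at hi₁ hmin
  set t := (R i₁ ⬝ᵥ z - b i₁) / -(R i₁ ⬝ᵥ y) with ht
  have ht0 : 0 ≤ t := div_nonneg (sub_nonneg.2 (hz i₁)) (by linarith)
  have htight : R i₁ ⬝ᵥ (z + t • y) = b i₁ := by
    rw [hmul, ht]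
    field_simp [hi₁.ne]
    ring
  have hfeas : ∀ i, b i ≤ R i ⬝ᵥ (z + t • y) := by
    intro i
    rw [hmul]
    rcases lt_or_ge (R i ⬝ᵥ y) 0 with h | h
    · have h1 := hmin i h
      rw [le_div_iff₀ (by linarith)] at h1
      linarith
    · have := mul_nonneg ht0 h
      linarith [hz i]
  refine absurd (ih _ ?_ (z + t • y) rfl hfeas (by rw [hmul, hcy, hc]; ring)) ?_
  · rw [← hn]
    refine Finset.card_lt_card ⟨fun i hi => ?_, fun h => ?_⟩
    · simp only [Finset.mem_filter, Finset.mem_univ, true_and] at hi ⊢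
      intro h
      exact hi (by rw [hmul, hy i h, h]; ring)
    · have h1 : i₁ ∈ Finset.univ.filter fun i => R i ⬝ᵥ z ≠ b i := by
        simp only [Finset.mem_filter, Finset.mem_univ, true_and]
        intro h
        exact hi₁.ne (hy i₁ h)
      exact (Finset.mem_filter.1 (h h1)).2 htight
  · rintro ⟨z, h1, h2, h3⟩
    obtain ⟨y, h4, h5⟩ := hcon z h1 h2
    exact h5 (h3 y h4)

/-- Vectors whose common orthogonal complement is trivial contain a basis. -/
theorem exists_det_ne_zero [DecidableEq κ] (R : ι → κ → ℝ) (T : Set ι)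
    (hT : ∀ y, (∀ i ∈ T, R i ⬝ᵥ y = 0) → y = 0) :
    ∃ e : κ → ι, (∀ j, e j ∈ T) ∧ (Matrix.of fun j => R (e j)).det ≠ 0 := by
  have hspan : Submodule.span ℝ (R '' T) = ⊤ := by
    by_contra hne
    obtain ⟨f, hf, hle⟩ := Submodule.exists_le_ker_of_lt_top _ (lt_top_iff_ne_top.2 hne)
    have hfy : ∀ v, f v = v ⬝ᵥ fun j => f (Pi.single j 1) := by
      intro v
      conv_lhs => rw [← Finset.univ_sum_single v, map_sum]
      refine Finset.sum_congr rfl fun j _ => ?_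
      rw [← smul_eq_mul, ← map_smul, ← Pi.single_smul, smul_eq_mul, mul_one]
    have h0 := hT (fun j => f (Pi.single j 1)) fun i hi => by
      rw [← hfy]
      exact hle (Submodule.subset_span ⟨i, hi, rfl⟩)
    refine hf (LinearMap.ext fun v => ?_)
    rw [hfy, h0]
    simp
  obtain ⟨s, hs, hss, hli⟩ := exists_linearIndependent ℝ (R '' T)
  have B : Module.Basis s ℝ (κ → ℝ) := Module.Basis.mk hli (by simp [hss, hspan])
  have hfin : Fintype s := FiniteDimensional.fintypeBasisIndex B
  have hcard : Fintype.card κ = Fintype.card s := by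
    rw [← Module.finrank_eq_card_basis B, Module.finrank_fintype_fun_eq_card]
  let f := Fintype.equivOfCardEq hcard
  choose e he hes using fun j => hs (f j).2
  refine ⟨e, he, ?_⟩
  have h1 : LinearIndependent ℝ (fun j => R (e j)) := by
    have h2 : (fun j => R (e j)) = (fun v : s => (v : κ → ℝ)) ∘ f := funext hes
    rw [h2]
    exact hli.comp f f.injective
  exact ((Matrix.isUnit_iff_isUnit_det _).1 (Matrix.linearIndependent_rows_iff_isUnit.1 h1)).ne_zero

/-- Over a common denominator, the solution of a regular system of linear equations with `n`
unknowns whose coefficients have height at most `h` is bounded by `2 ^ vertexExp n h`. -/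
def vertexExp (n h : ℕ) : ℕ := n * n + h * (n + 2) * n

theorem vertexExp_mono {n n' h h' : ℕ} (hn : n ≤ n') (hh : h ≤ h') :
    vertexExp n h ≤ vertexExp n' h' := by
  unfold vertexExp
  gcongr

theorem factorial_le_two_pow (n : ℕ) : n.factorial ≤ 2 ^ (n * n) :=
  (Nat.factorial_le_pow n).trans (by
    rw [pow_mul]
    exact Nat.pow_le_pow_left Nat.lt_two_pow_self.le n)

theorem natAbs_det_le [DecidableEq κ] (A : Matrix κ κ ℤ) (K : ℕ) (h : ∀ i j, (A i j).natAbs ≤ K) :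
    A.det.natAbs ≤ (Fintype.card κ).factorial * K ^ Fintype.card κ := by
  have := Matrix.det_le (A := A) (abv := AbsoluteValue.abs) (x := (K : ℤ)) fun i j => by
    rw [AbsoluteValue.abs_apply, Int.abs_eq_natAbs]
    exact_mod_cast h i j
  rw [AbsoluteValue.abs_apply, Int.abs_eq_natAbs, nsmul_eq_mul] at this
  exact_mod_cast this

/-- The solution of a regular system of linear equations with integral coefficients (Cramer). -/
theorem exists_small_solution_int [DecidableEq κ] (A : Matrix κ κ ℤ) (b : κ → ℤ) (hA : A.det ≠ 0)
    (K : ℕ) (hK : ∀ i j, (A i j).natAbs ≤ K) (hb : ∀ i, (b i).natAbs ≤ K) (z : κ → ℝ)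
    (hz : ∀ i, (fun j => (A i j : ℝ)) ⬝ᵥ z = b i) :
    ∃ (w : κ → ℤ) (d : ℕ), 0 < d ∧ d ≤ (Fintype.card κ).factorial * K ^ Fintype.card κ ∧
      (∀ j, (w j).natAbs ≤ (Fintype.card κ).factorial * K ^ Fintype.card κ) ∧
      ∀ j, z j = w j / d := by
  have hdet : (A.det : ℝ) • z = fun j => (A.cramer b j : ℝ) := by
    have h1 : (A.map (Int.cast : ℤ → ℝ)) *ᵥ z = fun i => (b i : ℝ) := funext hz
    have h2 := congrArg (fun v => (A.map (Int.cast : ℤ → ℝ)).adjugate *ᵥ v) h1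
    simp only [Matrix.mulVec_mulVec, Matrix.adjugate_mul, Matrix.smul_mulVec, Matrix.one_mulVec,
      ← Matrix.cramer_eq_adjugate_mulVec] at h2
    have h3 : (A.map (Int.cast : ℤ → ℝ)).det = A.det :=
      ((Int.castRingHom ℝ).map_det A).symm
    rw [h3] at h2
    rw [h2]
    funext j
    rw [Matrix.cramer_apply, Matrix.cramer_apply]
    have := ((Int.castRingHom ℝ).map_det (A.updateCol j b)).symm
    rw [RingHom.mapMatrix_apply, Matrix.map_updateCol] at this
    exact this
  have hdetR : (A.det : ℝ) ≠ 0 := by exact_mod_cast hA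
  have hzj : ∀ j, z j = A.cramer b j / A.det := by
    intro j
    have := congrFun hdet j
    rw [Pi.smul_apply, smul_eq_mul] at this
    rw [← this]
    field_simp
  refine ⟨fun j => A.det.sign * A.cramer b j, A.det.natAbs, Int.natAbs_pos.2 hA,
    natAbs_det_le A K hK, fun j => ?_, fun j => ?_⟩
  · rw [Int.natAbs_mul, Int.natAbs_sign_of_ne_zero hA, one_mul, Matrix.cramer_apply]
    refine natAbs_det_le _ K fun i k => ?_
    rw [Matrix.updateCol_apply]
    split_ifs
    · exact hb i
    · exact hK i k
  · have h1 : ((A.det.natAbs : ℕ) : ℝ) = A.det.sign * A.det := by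
      rw [← Int.cast_mul, Int.sign_mul_self_eq_natAbs, Int.cast_natCast]
    have h2 : (A.det.sign : ℝ) ≠ 0 := by
      have := Int.sign_eq_zero_iff_zero.not.2 hA
      exact_mod_cast this
    rw [hzj, h1]
    push_cast
    rw [mul_div_mul_left _ _ h2]

theorem exists_common_denominator (r : κ → ℚ) (s : ℚ) (h : ℕ) (hr : ∀ j, HeightLe (r j) h)
    (hs : HeightLe s h) :
    ∃ (D : ℕ) (r' : κ → ℤ) (s' : ℤ), 0 < D ∧ (∀ j, (r' j : ℚ) = D * r j) ∧ (s' : ℚ) = D * s ∧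
      (∀ j, (r' j).natAbs ≤ 2 ^ (h * (Fintype.card κ + 2))) ∧
      s'.natAbs ≤ 2 ^ (h * (Fintype.card κ + 2)) := by
  let D := (∏ j, (r j).den) * s.den
  have hD : D ≤ 2 ^ (h * (Fintype.card κ + 1)) := by
    have h1 : ∏ j, (r j).den ≤ (2 ^ h) ^ Fintype.card κ := by
      rw [← Finset.card_univ]
      exact Finset.prod_le_pow_card _ _ _ fun j _ => (hr j).2
    calc D ≤ (2 ^ h) ^ Fintype.card κ * 2 ^ h := Nat.mul_le_mul h1 hs.2
      _ = _ := by rw [← pow_succ, ← pow_mul]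
  have key : ∀ q : ℚ, q.den ∣ D → HeightLe q h →
      ((q.num * (D / q.den : ℕ) : ℤ) : ℚ) = D * q ∧
      (q.num * (D / q.den : ℕ) : ℤ).natAbs ≤ 2 ^ (h * (Fintype.card κ + 2)) := by
    intro q hq hh
    constructor
    · obtain ⟨e, he⟩ := hq
      have h0 : (q.den : ℚ) ≠ 0 := by exact_mod_cast q.den_ne_zero
      rw [he, Nat.mul_div_cancel_left _ q.den_pos]
      have h1 : (q.num : ℚ) = q.den * q := (Rat.den_mul_eq_num q).symm
      push_cast
      rw [h1]
      ring
    · rw [Int.natAbs_mul, Int.natAbs_natCast]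
      calc q.num.natAbs * (D / q.den) ≤ 2 ^ h * 2 ^ (h * (Fintype.card κ + 1)) :=
            Nat.mul_le_mul hh.1 ((Nat.div_le_self _ _).trans hD)
        _ = _ := by rw [← pow_add]; congr 1; ring
  have hrD : ∀ j, (r j).den ∣ D := fun j =>
    (Finset.dvd_prod_of_mem (fun j => (r j).den) (Finset.mem_univ j)).mul_right _
  have hsD : s.den ∣ D := Dvd.intro_left _ rfl
  exact ⟨D, _, _, Nat.mul_pos (Finset.prod_pos fun j _ => (r j).den_pos) s.den_pos,
    fun j => (key (r j) (hrD j) (hr j)).1, (key s hsD hs).1, fun j => (key (r j) (hrD j) (hr j)).2,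
    (key s hsD hs).2⟩

/-- A linear objective that attains its maximum over a polyhedron without lines, given by
inequalities whose coefficients have height at most `h`, attains it at a small rational point. -/
theorem exists_small_vertex [Fintype ι] (R : ι → κ → ℚ) (b : ι → ℚ) (h : ℕ)
    (hRh : ∀ i j, HeightLe (R i j) h) (hbh : ∀ i, HeightLe (b i) h) (c : κ → ℝ)
    (hR : ∀ y : κ → ℝ, (∀ i, (fun j => (R i j : ℝ)) ⬝ᵥ y = 0) → y = 0) (z₀ : κ → ℝ)
    (hz₀ : ∀ i, (b i : ℝ) ≤ (fun j => (R i j : ℝ)) ⬝ᵥ z₀)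
    (hopt : ∀ z, (∀ i, (b i : ℝ) ≤ (fun j => (R i j : ℝ)) ⬝ᵥ z) → c ⬝ᵥ z ≤ c ⬝ᵥ z₀) :
    ∃ (w : κ → ℤ) (d : ℕ) (z : κ → ℝ), 0 < d ∧
      (∀ j, (w j).natAbs ≤ 2 ^ vertexExp (Fintype.card κ) h) ∧ (∀ j, z j = w j / d) ∧
      (∀ i, (b i : ℝ) ≤ (fun j => (R i j : ℝ)) ⬝ᵥ z) ∧ c ⬝ᵥ z = c ⬝ᵥ z₀ := by
  classical
  obtain ⟨z, hz, hcz, hv⟩ := exists_vertex (fun i j => (R i j : ℝ)) (fun i => (b i : ℝ)) c hR z₀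
    hz₀ hopt
  obtain ⟨e, he, hdet⟩ := exists_det_ne_zero (fun i j => (R i j : ℝ))
    {i | (fun j => (R i j : ℝ)) ⬝ᵥ z = b i} hv
  choose D r s hD hr hs hr' hs' using fun k =>
    exists_common_denominator (R (e k)) (b (e k)) h (hRh _) (hbh _)
  have hrR : ∀ k j, (r k j : ℝ) = D k * R (e k) j := fun k j => by exact_mod_cast hr k j
  have hsR : ∀ k, (s k : ℝ) = D k * b (e k) := fun k => by exact_mod_cast hs k
  have hdet' : (Matrix.of r).det ≠ 0 := by
    have h1 : ((Matrix.of r).det : ℝ) = (∏ k, (D k : ℝ)) *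
        (Matrix.of fun k j => (R (e k) j : ℝ)).det := by
      rw [← Matrix.det_mul_column]
      refine ((Int.castRingHom ℝ).map_det (Matrix.of r)).trans ?_
      congr 1
      ext k j
      exact hrR k j
    have h2 : ((Matrix.of r).det : ℝ) ≠ 0 := by
      rw [h1]
      exact mul_ne_zero (Finset.prod_ne_zero_iff.2 fun k _ => by exact_mod_cast (hD k).ne') hdet
    exact_mod_cast h2
  obtain ⟨w, d, hd, -, hw, hzw⟩ := exists_small_solution_int (Matrix.of r) s hdet' _ hr' hs' z
    fun k => by
      have h1 : (fun j => ((Matrix.of r) k j : ℝ)) = (D k : ℝ) • fun j => (R (e k) j : ℝ) :=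
        funext fun j => hrR k j
      rw [h1, smul_dotProduct, hsR, smul_eq_mul]
      exact congrArg _ (he k)
  refine ⟨w, d, z, hd, fun j => (hw j).trans ?_, hzw, hz, hcz⟩
  unfold vertexExp
  rw [pow_add, pow_mul 2 (h * _)]
  exact Nat.mul_le_mul_right _ (factorial_le_two_pow _)

end Vertex

/-! ### Small points of systems of linear inequalities on the simplex -/

section Systems

open Matrix

variable {ι₁ ι₂ : Type} [Finite ι₁] [Finite ι₂] {l : ℕ}

theorem heightLe_ite (P : Prop) [Decidable P] (h : ℕ) : HeightLe (if P then 1 else 0) h := by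
  split_ifs
  · exact .one h
  · exact .zero h

/-- A homogeneous system of weak and strict linear inequalities with a nonzero nonnegative solution
has a solution in small natural numbers. -/
theorem exists_small_strict_solution (C : ι₁ → Fin l → ℚ) (D : ι₂ → Fin l → ℚ) (h : ℕ)
    (hCh : ∀ i j, HeightLe (C i j) h) (hDh : ∀ i j, HeightLe (D i j) h) (x : Fin l → ℝ)
    (hx : ∀ j, 0 ≤ x j) (hpos : 0 < ∑ j, x j) (hC : ∀ i, 0 ≤ (fun j => (C i j : ℝ)) ⬝ᵥ x)
    (hD : ∀ i, 0 < (fun j => (D i j : ℝ)) ⬝ᵥ x) :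
    ∃ n : Fin l → ℕ, (∀ j, n j ≤ 2 ^ vertexExp l h) ∧ 0 < ∑ j, n j ∧
      (∀ i, 0 ≤ (fun j => (C i j : ℝ)) ⬝ᵥ fun j => (n j : ℝ)) ∧
      ∀ i, 0 < (fun j => (D i j : ℝ)) ⬝ᵥ fun j => (n j : ℝ) := by
  have := Fintype.ofFinite ι₁
  have := Fintype.ofFinite ι₂
  let D' : Option ι₂ → Fin l → ℚ := fun o => o.elim (fun _ => 1) D
  have hD' : ∀ o, 0 < (fun j => (D' o j : ℝ)) ⬝ᵥ x := by
    rintro (_ | i)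
    · simpa [D', dotProduct] using hpos
    · exact hD i
  let R : Fin l ⊕ ι₁ ⊕ Option ι₂ → Fin l → ℚ :=
    Sum.elim (fun j k => if k = j then 1 else 0) (Sum.elim C D')
  let b : Fin l ⊕ ι₁ ⊕ Option ι₂ → ℚ := Sum.elim (fun _ => 0) (Sum.elim (fun _ => 0) fun _ => 1)
  have hunit : ∀ (j : Fin l) (y : Fin l → ℝ), (fun k => (R (.inl j) k : ℝ)) ⬝ᵥ y = y j := by
    intro j y
    simp [R, dotProduct, apply_ite ((↑) : ℚ → ℝ)]
  obtain ⟨t, ht⟩ := (Set.finite_range fun o => ((fun j => (D' o j : ℝ)) ⬝ᵥ x)⁻¹).bddAbove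
  have ht' : ∀ o, 1 ≤ t * (fun j => (D' o j : ℝ)) ⬝ᵥ x := by
    intro o
    have h1 := ht ⟨o, rfl⟩
    rwa [inv_le_iff_one_le_mul₀ (hD' o)] at h1
  have ht0 : 0 ≤ t := (inv_pos.2 (hD' none)).le.trans (ht ⟨none, rfl⟩)
  obtain ⟨w, d, z, hd, hw, hzw, hz, -⟩ := exists_small_vertex R b h
    (by
      rintro (j | i | _ | i) k
      · exact heightLe_ite _ h
      · exact hCh i k
      · exact .one h
      · exact hDh i k)
    (by
      rintro (j | i | o)
      · exact .zero h
      · exact .zero h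
      · exact .one h) 0
    (fun y hy => funext fun j => (hunit j y).symm.trans (hy (.inl j))) (t • x)
    (by
      rintro (j | i | o)
      · rw [hunit]
        simpa [b] using mul_nonneg ht0 (hx j)
      · rw [dotProduct_smul]
        exact (Rat.cast_zero (α := ℝ)).le.trans (mul_nonneg ht0 (hC i))
      · rw [dotProduct_smul]
        exact (Rat.cast_one (α := ℝ)).le.trans (ht' o)) (by simp)
  have hz0 : ∀ j, 0 ≤ z j := fun j => by
    have := hz (.inl j)
    rw [hunit] at this
    simpa [b] using this
  have hd' : (0 : ℝ) < d := by exact_mod_cast hd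
  have hn : (fun j => (((w j).toNat : ℕ) : ℝ)) = (d : ℝ) • z := by
    funext j
    have h1 : (0 : ℝ) ≤ w j := by
      have h2 := hz0 j
      rw [hzw, le_div_iff₀ hd'] at h2
      simpa using h2
    have h3 : (((w j).toNat : ℤ) : ℝ) = w j := by
      rw [Int.toNat_of_nonneg (by exact_mod_cast h1)]
    rw [Pi.smul_apply, smul_eq_mul, hzw, mul_div_cancel₀ _ hd'.ne', ← h3, Int.cast_natCast]
  have hDn : ∀ o, 0 < (fun j => (D' o j : ℝ)) ⬝ᵥ fun j => (((w j).toNat : ℕ) : ℝ) := by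
    intro o
    rw [hn, dotProduct_smul, smul_eq_mul]
    have h1 : ((1 : ℚ) : ℝ) ≤ (fun j => (D' o j : ℝ)) ⬝ᵥ z := hz (.inr (.inr o))
    exact mul_pos hd' (by push_cast at h1; linarith)
  refine ⟨fun j => (w j).toNat, fun j => ?_, ?_, fun i => ?_, fun i => hDn (some i)⟩
  · have := hw j
    rw [Fintype.card_fin] at this
    dsimp only
    omega
  · have h1 := hDn none
    simp only [D', Option.elim, dotProduct, Rat.cast_one, one_mul] at h1
    exact_mod_cast h1
  · rw [hn, dotProduct_smul, smul_eq_mul]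
    have h1 : ((0 : ℚ) : ℝ) ≤ (fun j => (C i j : ℝ)) ⬝ᵥ z := hz (.inr (.inl i))
    exact mul_nonneg hd'.le (by simpa using h1)

/-- The minimum of finitely many linear functions attains its maximum over a polytope in the simplex
at a small rational point, which is given here by the numerators `n` of its coordinates. -/
theorem exists_small_optimum [Nonempty ι₂] (C : ι₁ → Fin l → ℚ) (V : ι₂ → Fin l → ℚ) (h : ℕ)
    (hCh : ∀ i j, HeightLe (C i j) h) (hVh : ∀ i j, HeightLe (V i j) h) (x₀ : Fin l → ℝ)
    (hx₀ : x₀ ∈ stdSimplex ℝ (Fin l)) (hC : ∀ i, 0 ≤ (fun j => (C i j : ℝ)) ⬝ᵥ x₀) :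
    ∃ (n : Fin l → ℕ) (v : ℝ), (∀ j, n j ≤ 2 ^ vertexExp (l + 1) h) ∧ 0 < ∑ j, n j ∧
      (∀ i, 0 ≤ (fun j => (C i j : ℝ)) ⬝ᵥ fun j => (n j : ℝ)) ∧
      (∀ a, v * ∑ j, (n j : ℝ) ≤ (fun j => (V a j : ℝ)) ⬝ᵥ fun j => (n j : ℝ)) ∧
      ∀ x ∈ stdSimplex ℝ (Fin l), (∀ i, 0 ≤ (fun j => (C i j : ℝ)) ⬝ᵥ x) →
        ∃ a, (fun j => (V a j : ℝ)) ⬝ᵥ x ≤ v := by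
  have := Fintype.ofFinite ι₁
  have := Fintype.ofFinite ι₂
  have hcont : ∀ r : Fin l → ℝ, Continuous fun x : Fin l → ℝ => r ⬝ᵥ x := fun r => by
    unfold dotProduct
    fun_prop
  let K : Set (Fin l → ℝ) := stdSimplex ℝ (Fin l) ∩ {x | ∀ i, 0 ≤ (fun j => (C i j : ℝ)) ⬝ᵥ x}
  have hK : IsCompact K := (isCompact_stdSimplex ℝ (Fin l)).inter_right
    (by
      rw [Set.ofPred_forall]
      exact isClosed_iInter fun i => isClosed_le continuous_const (hcont _))
  let F : (Fin l → ℝ) → ℝ := fun x =>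
    Finset.univ.inf' Finset.univ_nonempty fun a => (fun j => (V a j : ℝ)) ⬝ᵥ x
  have hF : Continuous F := Continuous.finset_inf'_apply _ fun a _ => hcont _
  obtain ⟨x₁, ⟨hx₁, hC₁⟩, hmax⟩ := hK.exists_isMaxOn ⟨x₀, hx₀, hC⟩ hF.continuousOn
  -- maximise `v` over the pairs of a point of the polytope and a lower bound `v` of the functions
  let R : Fin l ⊕ Bool ⊕ ι₁ ⊕ ι₂ → Option (Fin l) → ℚ :=
    Sum.elim (fun j o => o.elim 0 fun k => if k = j then 1 else 0)
      (Sum.elim (fun s o => o.elim 0 fun _ => if s then 1 else -1)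
        (Sum.elim (fun i o => o.elim 0 (C i)) fun a o => o.elim (-1) (V a)))
  let b : Fin l ⊕ Bool ⊕ ι₁ ⊕ ι₂ → ℚ :=
    Sum.elim (fun _ => 0) (Sum.elim (fun s => if s then 1 else -1) fun _ => 0)
  have hR₁ : ∀ j (y : Option (Fin l) → ℝ), (fun o => (R (.inl j) o : ℝ)) ⬝ᵥ y = y (some j) := by
    intro j y
    simp [R, dotProduct, Fintype.sum_option, apply_ite ((↑) : ℚ → ℝ)]
  have hR₂ : ∀ y : Option (Fin l) → ℝ,
      (fun o => (R (.inr (.inl true)) o : ℝ)) ⬝ᵥ y = ∑ j, y (some j) := by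
    intro y
    simp [R, dotProduct, Fintype.sum_option]
  have hR₃ : ∀ y : Option (Fin l) → ℝ,
      (fun o => (R (.inr (.inl false)) o : ℝ)) ⬝ᵥ y = -∑ j, y (some j) := by
    intro y
    simp [R, dotProduct, Fintype.sum_option]
  have hR₄ : ∀ i (y : Option (Fin l) → ℝ), (fun o => (R (.inr (.inr (.inl i))) o : ℝ)) ⬝ᵥ y =
      (fun j => (C i j : ℝ)) ⬝ᵥ fun j => y (some j) := by
    intro i y
    simp [R, dotProduct, Fintype.sum_option]
  have hR₅ : ∀ a (y : Option (Fin l) → ℝ), (fun o => (R (.inr (.inr (.inr a))) o : ℝ)) ⬝ᵥ y =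
      ((fun j => (V a j : ℝ)) ⬝ᵥ fun j => y (some j)) - y none := by
    intro a y
    simp [R, dotProduct, Fintype.sum_option]
    ring
  let c : Option (Fin l) → ℝ := fun o => o.elim 1 fun _ => 0
  have hc : ∀ y : Option (Fin l) → ℝ, c ⬝ᵥ y = y none := by
    intro y
    simp [c, dotProduct, Fintype.sum_option]
  have hfeas : ∀ y : Option (Fin l) → ℝ, (∀ i, (b i : ℝ) ≤ (fun o => (R i o : ℝ)) ⬝ᵥ y) ↔
      ((fun j => y (some j)) ∈ K ∧
        ∀ a, y none ≤ (fun j => (V a j : ℝ)) ⬝ᵥ fun j => y (some j)) := by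
    intro y
    constructor
    · intro hy
      refine ⟨⟨⟨fun j => ?_, ?_⟩, fun i => ?_⟩, fun a => ?_⟩
      · have := hy (.inl j)
        rw [hR₁] at this
        simpa [b] using this
      · have h1 := hy (.inr (.inl true))
        have h2 := hy (.inr (.inl false))
        rw [hR₂] at h1
        rw [hR₃] at h2
        simp [b] at h1 h2
        linarith
      · have := hy (.inr (.inr (.inl i)))
        rw [hR₄] at this
        simpa [b] using this
      · have := hy (.inr (.inr (.inr a)))
        rw [hR₅] at this
        simpa [b] using this
    · rintro ⟨⟨⟨h1, h2⟩, h3⟩, h4⟩ (j | (_ | _) | i | a)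
      · rw [hR₁]
        simpa [b] using h1 j
      · rw [hR₃, h2]
        simp [b]
      · rw [hR₂, h2]
        simp [b]
      · rw [hR₄]
        simpa [b] using h3 i
      · rw [hR₅]
        simpa [b] using h4 a
  obtain ⟨w, d, z, hd, hw, hzw, hz, hcz⟩ := exists_small_vertex R b h
    (by
      rintro (j | (_ | _) | i | a) (_ | k)
      · exact .zero h
      · exact heightLe_ite _ h
      · exact .zero h
      · exact (HeightLe.one h).neg
      · exact .zero h
      · exact .one h
      · exact .zero h
      · exact hCh i k
      · exact (HeightLe.one h).neg
      · exact hVh a k)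
    (by
      rintro (j | (_ | _) | i | a)
      · exact .zero h
      · exact (HeightLe.one h).neg
      · exact .one h
      · exact .zero h
      · exact .zero h) c
    (by
      intro y hy
      have h1 : ∀ j, y (some j) = 0 := fun j => (hR₁ j y).symm.trans (hy (.inl j))
      have h2 : y none = 0 := by
        have := hy (.inr (.inr (.inr (Classical.arbitrary ι₂))))
        rw [hR₅] at this
        simpa [dotProduct, h1] using this
      funext o
      cases o with
      | none => exact h2
      | some j => exact h1 j)
    (fun o => o.elim (F x₁) x₁)
    ((hfeas _).2 ⟨⟨hx₁, hC₁⟩, fun a => Finset.inf'_le _ (Finset.mem_univ a)⟩)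
    (by
      intro y hy
      obtain ⟨h1, h2⟩ := (hfeas y).1 hy
      rw [hc, hc]
      exact (Finset.le_inf' _ _ fun a _ => h2 a).trans (hmax h1))
  obtain ⟨⟨⟨hz0, hz1⟩, hzC⟩, hzV⟩ := (hfeas z).1 hz
  rw [hc, hc] at hcz
  have hd' : (0 : ℝ) < d := by exact_mod_cast hd
  have hn : (fun j => (((w (some j)).toNat : ℕ) : ℝ)) = (d : ℝ) • fun j => z (some j) := by
    funext j
    have h1 : (0 : ℝ) ≤ w (some j) := by
      have h2 : 0 ≤ z (some j) := hz0 j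
      rw [hzw, le_div_iff₀ hd'] at h2
      simpa using h2
    have h3 : (((w (some j)).toNat : ℤ) : ℝ) = w (some j) := by
      rw [Int.toNat_of_nonneg (by exact_mod_cast h1)]
    rw [Pi.smul_apply, smul_eq_mul, hzw, mul_div_cancel₀ _ hd'.ne', ← h3, Int.cast_natCast]
  have hsum : ∑ j, (((w (some j)).toNat : ℕ) : ℝ) = d := by
    have h1 : ∑ j, (((w (some j)).toNat : ℕ) : ℝ) = ∑ j, d * z (some j) :=
      Finset.sum_congr rfl fun j _ => congrFun hn j
    rw [h1, ← Finset.mul_sum, hz1, mul_one]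
  refine ⟨fun j => (w (some j)).toNat, F x₁, fun j => ?_, ?_, fun i => ?_, fun a => ?_,
    fun x hx hxC => ?_⟩
  · have := hw (some j)
    rw [Fintype.card_option, Fintype.card_fin] at this
    dsimp only
    omega
  · have : (0 : ℝ) < ∑ j, (((w (some j)).toNat : ℕ) : ℝ) := by rw [hsum]; exact hd'
    exact_mod_cast this
  · rw [hn, dotProduct_smul, smul_eq_mul]
    exact mul_nonneg hd'.le (hzC i)
  · have h1 := hzV a
    rw [hcz] at h1
    rw [hsum, hn, dotProduct_smul, smul_eq_mul, mul_comm]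
    exact mul_le_mul_of_nonneg_left h1 hd'.le
  · have h1 : F x ≤ F x₁ := hmax ⟨hx, hxC⟩
    obtain ⟨a, -, ha⟩ := Finset.exists_mem_eq_inf' Finset.univ_nonempty
      fun a => (fun j => (V a j : ℝ)) ⬝ᵥ x
    exact ⟨a, ha ▸ h1⟩

end Systems

namespace Game

open Matrix Filter Topology

variable (G : Game)

/-! ### Equilibria at infinitesimally perturbed strategies -/

/-- The coefficients of the loss of follower `p` when she deviates from `a` to `b`. -/
def lossRow (a : G.Profile) (p : Fin G.k) (b : Fin (G.m p)) (j : Fin G.l) : ℚ :=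
  G.U p a j - G.U p (Function.update a p b) j

/-- The loss of follower `p` when she deviates from `a` to `b`, as a linear function of the strategy
of the leader. -/
def loss (x : Fin G.l → ℝ) (a : G.Profile) (p : Fin G.k) (b : Fin (G.m p)) : ℝ :=
  (fun j => (G.lossRow a p b j : ℝ)) ⬝ᵥ x

/-- `a` is an equilibrium at `x + ε • (z - x)` for all small `ε > 0`: no deviation is profitable
in the lexicographic order of the losses at `x` and at `z`. -/
def LexNE (x z : Fin G.l → ℝ) (a : G.Profile) : Prop :=
  ∀ p b, 0 < G.loss x a p b ∨ G.loss x a p b = 0 ∧ 0 ≤ G.loss z a p b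

/-- Among the equilibria at `x` perturbed towards `z`, the profile `a` is the worst one for the
leader, who is paid at `x`. -/
def IsWorst (x z : Fin G.l → ℝ) (a : G.Profile) : Prop :=
  G.LexNE x z a ∧ ∀ a', G.LexNE x z a' → G.leaderUtility a x ≤ G.leaderUtility a' x

variable {G}

theorem loss_eq (x : Fin G.l → ℝ) (a : G.Profile) (p : Fin G.k) (b : Fin (G.m p)) :
    G.loss x a p b = G.followerUtility p a x - G.followerUtility p (Function.update a p b) x := by
  simp [loss, lossRow, followerUtility, dotProduct, sub_mul]

theorem isNE_iff {x : Fin G.l → ℝ} {a : G.Profile} : G.IsNE x a ↔ ∀ p b, 0 ≤ G.loss x a p b := by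
  simp [IsNE, loss_eq]

theorem lexNE_self_iff {x : Fin G.l → ℝ} {a : G.Profile} : G.LexNE x x a ↔ G.IsNE x a := by
  rw [isNE_iff]
  refine forall₂_congr fun p b => ⟨fun h => ?_, fun h => ?_⟩
  · rcases h with h | h
    · exact h.le
    · exact h.2
  · rcases h.eq_or_lt with h' | h'
    · exact .inr ⟨h'.symm, h⟩
    · exact .inl h'

theorem leaderUtility_eq (x : Fin G.l → ℝ) (a : G.Profile) :
    G.leaderUtility a x = (fun j => (G.V a j : ℝ)) ⬝ᵥ x := rfl

theorem loss_smul (c : ℝ) (x : Fin G.l → ℝ) (a : G.Profile) (p : Fin G.k) (b : Fin (G.m p)) :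
    G.loss (c • x) a p b = c * G.loss x a p b := by
  rw [loss, dotProduct_smul, smul_eq_mul, loss]

theorem leaderUtility_smul (c : ℝ) (x : Fin G.l → ℝ) (a : G.Profile) :
    G.leaderUtility a (c • x) = c * G.leaderUtility a x := by
  rw [leaderUtility_eq, dotProduct_smul, smul_eq_mul, leaderUtility_eq]

theorem lexNE_smul {c d : ℝ} (hc : 0 < c) (hd : 0 < d) {x z : Fin G.l → ℝ} {a : G.Profile} :
    G.LexNE (c • x) (d • z) a ↔ G.LexNE x z a := by
  simp only [LexNE, loss_smul, mul_pos_iff_of_pos_left hc, mul_nonneg_iff_of_pos_left hd,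
    mul_eq_zero, hc.ne', false_or]

theorem isWorst_smul {c d : ℝ} (hc : 0 < c) (hd : 0 < d) {x z : Fin G.l → ℝ} {a : G.Profile} :
    G.IsWorst (c • x) (d • z) a ↔ G.IsWorst x z a := by
  simp only [IsWorst, lexNE_smul hc hd, leaderUtility_smul, mul_le_mul_iff_right₀ hc]

theorem le_pessimistic {x : Fin G.l → ℝ} {v : EReal} (h : ∃ a, G.IsNE x a)
    (hv : ∀ a, G.IsNE x a → v ≤ G.leaderUtility a x) : v ≤ G.pessimistic x := by
  rw [pessimistic, if_pos h]
  exact le_iInf₂ hv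

theorem pessimistic_le {x : Fin G.l → ℝ} {a : G.Profile} (h : G.IsNE x a) :
    G.pessimistic x ≤ G.leaderUtility a x := by
  rw [pessimistic, if_pos ⟨a, h⟩]
  exact iInf₂_le (f := fun a (_ : a ∈ {a | G.IsNE x a}) => (G.leaderUtility a x : EReal)) a h

theorem pessimistic_le_supValue {x : Fin G.l → ℝ} (hx : x ∈ G.strategies) :
    G.pessimistic x ≤ G.supValue :=
  le_iSup₂ (f := fun x (_ : x ∈ G.strategies) => G.pessimistic x) x hx

/-- The payoff at `x` in the worst equilibrium that survives a perturbation is approximated by the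
pessimistic utilities at the perturbed strategies. -/
theorem IsWorst.le_supValue {x z : Fin G.l → ℝ} {a : G.Profile} (hx : x ∈ G.strategies)
    (hz : z ∈ G.strategies) (h : G.IsWorst x z a) : (G.leaderUtility a x : EReal) ≤ G.supValue := by
  let y : ℝ → Fin G.l → ℝ := fun ε => x + ε • (z - x)
  have hlin : ∀ (r : Fin G.l → ℝ) ε, r ⬝ᵥ y ε = (1 - ε) * (r ⬝ᵥ x) + ε * (r ⬝ᵥ z) := by
    intro r ε
    simp only [y, dotProduct_add, dotProduct_smul, dotProduct_sub, smul_eq_mul]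
    ring
  have htend : ∀ r : Fin G.l → ℝ, Tendsto (fun ε => r ⬝ᵥ y ε) (𝓝[>] 0) (𝓝 (r ⬝ᵥ x)) := by
    intro r
    have h1 : Continuous fun ε => r ⬝ᵥ y ε := by
      simp only [hlin]
      fun_prop
    simpa [y] using (h1.tendsto 0).mono_left nhdsWithin_le_nhds
  have hpos : ∀ᶠ ε : ℝ in 𝓝[>] 0, 0 < ε ∧ ε < 1 := Ioo_mem_nhdsGT one_pos
  have hNE : ∀ᶠ ε : ℝ in 𝓝[>] 0, ∀ a p b, 0 ≤ G.loss (y ε) a p b ↔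
      0 < G.loss x a p b ∨ G.loss x a p b = 0 ∧ 0 ≤ G.loss z a p b := by
    refine eventually_all.2 fun a => eventually_all.2 fun p => eventually_all.2 fun b => ?_
    have ht := htend fun j => (G.lossRow a p b j : ℝ)
    rcases lt_trichotomy (G.loss x a p b) 0 with h0 | h0 | h0
    · filter_upwards [ht.eventually (gt_mem_nhds h0)] with ε h1
      have h1 : G.loss (y ε) a p b < 0 := h1
      simp [h0.not_gt, h0.ne, h1.not_ge]
    · filter_upwards [hpos] with ε h1
      have h2 : G.loss (y ε) a p b = (1 - ε) * G.loss x a p b + ε * G.loss z a p b := hlin _ _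
      rw [h2, h0]
      simp [mul_nonneg_iff_of_pos_left h1.1]
    · filter_upwards [ht.eventually (lt_mem_nhds h0)] with ε h1
      have h1 : 0 < G.loss (y ε) a p b := h1
      simp [h0, h1.le]
  refine EReal.ge_of_forall_gt_iff_ge.1 fun v hv => ?_
  have hv : v < G.leaderUtility a x := by exact_mod_cast hv
  have hV : ∀ᶠ ε : ℝ in 𝓝[>] 0, ∀ a', G.LexNE x z a' → v < G.leaderUtility a' (y ε) := by
    refine eventually_all.2 fun a' => ?_
    by_cases ha' : G.LexNE x z a'
    · filter_upwards [(htend fun j => (G.V a' j : ℝ)).eventually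
        (lt_mem_nhds (hv.trans_le (h.2 a' ha')))] with ε h1 _
      exact h1
    · exact .of_forall fun _ h' => absurd h' ha'
  obtain ⟨ε, h1, h2, h3⟩ := (hpos.and (hNE.and hV)).exists
  have hiff : ∀ a, G.IsNE (y ε) a ↔ G.LexNE x z a := fun a =>
    isNE_iff.trans (forall₂_congr fun p b => h2 a p b)
  have hy : y ε ∈ G.strategies :=
    (convex_stdSimplex ℝ _).add_smul_sub_mem hx hz ⟨h1.1.le, h1.2.le⟩
  refine le_trans (le_pessimistic ⟨a, (hiff a).2 h.1⟩ fun a' ha' => ?_)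
    (pessimistic_le_supValue hy)
  exact_mod_cast (h3 a' ((hiff a').1 ha')).le

/-- The strategy with given nonnegative weights. -/
theorem smul_mem_strategies {n : Fin G.l → ℕ} (hn : 0 < ∑ j, n j) :
    ((∑ j, n j : ℕ) : ℝ)⁻¹ • (fun j => (n j : ℝ)) ∈ G.strategies := by
  have h : (0 : ℝ) < (∑ j, n j : ℕ) := by exact_mod_cast hn
  refine ⟨fun j => by simp only [Pi.smul_apply, smul_eq_mul]; positivity, ?_⟩
  simp only [Pi.smul_apply, smul_eq_mul, ← Finset.mul_sum]
  rw [← Nat.cast_sum, inv_mul_cancel₀ h.ne']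

theorem IsWorst.div_le_supValue {n z : Fin G.l → ℕ} {a : G.Profile} (hn : 0 < ∑ j, n j)
    (hz : 0 < ∑ j, z j) (h : G.IsWorst (fun j => (n j : ℝ)) (fun j => (z j : ℝ)) a) :
    ((G.leaderUtility a (fun j => (n j : ℝ)) / (∑ j, n j : ℕ) : ℝ) : EReal) ≤ G.supValue := by
  have h1 : (0 : ℝ) < (∑ j, n j : ℕ) := by exact_mod_cast hn
  have h2 : (0 : ℝ) < (∑ j, z j : ℕ) := by exact_mod_cast hz
  have := ((isWorst_smul (inv_pos.2 h1) (inv_pos.2 h2)).2 h).le_supValue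
    (smul_mem_strategies hn) (smul_mem_strategies hz)
  rwa [leaderUtility_smul, inv_mul_eq_div] at this

/-- If `x` satisfies weakly, and `z` strictly, the inequalities which ensure that the equilibria are
those at `x₀`, then these are also the equilibria at `x` perturbed towards `z`. -/
theorem lexNE_iff_of_forall {x₀ x z : Fin G.l → ℝ}
    (h₁ : ∀ a, G.IsNE x₀ a → ∀ p b, 0 ≤ G.loss x a p b ∧ 0 ≤ G.loss z a p b)
    (h₂ : ∀ a, ¬G.IsNE x₀ a → ∃ p b, G.loss x a p b ≤ 0 ∧ G.loss z a p b < 0) (a : G.Profile) :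
    G.LexNE x z a ↔ G.IsNE x₀ a := by
  constructor
  · intro h
    by_contra hne
    obtain ⟨p, b, h3, h4⟩ := h₂ a hne
    rcases h p b with h5 | h5
    · exact h5.not_ge h3
    · exact h4.not_ge h5.2
  · intro h p b
    obtain ⟨h3, h4⟩ := h₁ a h p b
    rcases h3.eq_or_lt with h5 | h5
    · exact .inr ⟨h5.symm, h4⟩
    · exact .inl h5

theorem exists_isWorst {x₀ x z : Fin G.l → ℝ} (h : ∃ a, G.IsNE x₀ a)
    (hiff : ∀ a, G.LexNE x z a ↔ G.IsNE x₀ a) : ∃ a, G.IsNE x₀ a ∧ G.IsWorst x z a := by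
  classical
  obtain ⟨a, ha, hmin⟩ := Set.exists_min_image {a | G.IsNE x₀ a} (fun a => G.leaderUtility a x)
    (Set.toFinite _) h
  exact ⟨a, ha, (hiff a).2 ha, fun a' ha' => hmin a' ((hiff a').1 ha')⟩

/-! ### Small optimal strategies -/

theorem heightLe_lossRow {S : ℕ} (hU : ∀ p a j, HeightLe (G.U p a j) S) (a : G.Profile)
    (p : Fin G.k) (b : Fin (G.m p)) (j : Fin G.l) : HeightLe (G.lossRow a p b j) (2 * S + 1) :=
  ((hU p a j).sub (hU p _ j)).mono (by omega)

/-- A follower and one of her actions. -/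
abbrev Deviation (G : Game) : Type := Σ p : Fin G.k, Fin (G.m p)

/-- The pessimistic utility at `x₀` is at most the payoff of the leader in a worst equilibrium at
small strategies: `z` has the same equilibria as `x₀`, and `n` maximises the minimum of the leader's
payoffs in these equilibria over the closure of the set of all such strategies. -/
theorem exists_small_isWorst {S : ℕ} (hU : ∀ p a j, HeightLe (G.U p a j) S)
    (hV : ∀ a j, HeightLe (G.V a j) S) {x₀ : Fin G.l → ℝ} (hx₀ : x₀ ∈ G.strategies)
    (hne : ∃ a, G.IsNE x₀ a) :
    ∃ (n z : Fin G.l → ℕ) (a : G.Profile), (∀ j, n j ≤ 2 ^ vertexExp (G.l + 1) (2 * S + 1)) ∧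
      (∀ j, z j ≤ 2 ^ vertexExp (G.l + 1) (2 * S + 1)) ∧ 0 < ∑ j, n j ∧ 0 < ∑ j, z j ∧
      G.IsWorst (fun j => (n j : ℝ)) (fun j => (z j : ℝ)) a ∧
      G.pessimistic x₀ ≤
        ((G.leaderUtility a (fun j => (n j : ℝ)) / (∑ j, n j : ℕ) : ℝ) : EReal) := by
  have hviol : ∀ a : {a // ¬G.IsNE x₀ a}, ∃ p b, G.loss x₀ a p b < 0 := by
    intro a
    have := a.2
    rw [isNE_iff] at this
    push Not at this
    exact this
  -- a profitable deviation from each profile that is not an equilibrium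
  choose p b hpb using hviol
  let C : {a // G.IsNE x₀ a} × G.Deviation → Fin G.l → ℚ := fun i => G.lossRow i.1 i.2.1 i.2.2
  let D : {a // ¬G.IsNE x₀ a} → Fin G.l → ℚ := fun a j => -G.lossRow a (p a) (b a) j
  have hC : ∀ i x, ((fun j => (C i j : ℝ)) ⬝ᵥ x) = G.loss x i.1 i.2.1 i.2.2 := fun _ _ => rfl
  have hD : ∀ a x, ((fun j => (D a j : ℝ)) ⬝ᵥ x) = -G.loss x a (p a) (b a) := by
    intro a x
    simp [D, loss, dotProduct]
  have hCh : ∀ i j, HeightLe (C i j) (2 * S + 1) := fun i j => heightLe_lossRow hU _ _ _ _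
  have hDh : ∀ a j, HeightLe (D a j) (2 * S + 1) := fun a j => (heightLe_lossRow hU _ _ _ _).neg
  have hC₀ : ∀ i, 0 ≤ (fun j => (C i j : ℝ)) ⬝ᵥ x₀ := fun i => isNE_iff.1 i.1.2 _ _
  have hD₀ : ∀ a, 0 < (fun j => (D a j : ℝ)) ⬝ᵥ x₀ := fun a => by
    rw [hD]
    exact neg_pos.2 (hpb a)
  obtain ⟨z, hz, hzpos, hzC, hzD⟩ := exists_small_strict_solution C D _ hCh hDh x₀ hx₀.1
    (by rw [hx₀.2]; exact one_pos) hC₀ hD₀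
  have : Nonempty {a // G.IsNE x₀ a} := nonempty_subtype.2 hne
  obtain ⟨n, v, hn, hnpos, hnE, hnV, hopt⟩ := exists_small_optimum (Sum.elim C D)
    (fun a : {a // G.IsNE x₀ a} => G.V a) (2 * S + 1)
    (by
      rintro (i | a) j
      · exact hCh i j
      · exact hDh a j) (fun a j => (hV _ _).mono (by omega)) x₀ hx₀
    (by
      rintro (i | a)
      · exact hC₀ i
      · exact (hD₀ a).le)
  have hiff := lexNE_iff_of_forall (x₀ := x₀) (x := fun j => (n j : ℝ)) (z := fun j => (z j : ℝ))
    (fun a ha p b => ⟨hnE (.inl (⟨a, ha⟩, ⟨p, b⟩)), hzC (⟨a, ha⟩, ⟨p, b⟩)⟩)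
    (fun a ha => ⟨_, _, by
      have h1 : 0 ≤ (fun j => (D ⟨a, ha⟩ j : ℝ)) ⬝ᵥ fun j => (n j : ℝ) := hnE (.inr ⟨a, ha⟩)
      rwa [hD, neg_nonneg] at h1, by
      have h1 := hzD ⟨a, ha⟩
      rwa [hD, neg_pos] at h1⟩)
  obtain ⟨a, ha, hworst⟩ := exists_isWorst hne hiff
  refine ⟨n, z, a, hn, fun j => (hz j).trans (Nat.pow_le_pow_right two_pos
    (vertexExp_mono (Nat.le_succ _) le_rfl)), hnpos, hzpos, hworst, ?_⟩
  obtain ⟨a', ha'⟩ := hopt x₀ hx₀ (by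
      rintro (i | a)
      · exact hC₀ i
      · exact (hD₀ a).le)
  refine (pessimistic_le a'.2).trans (EReal.coe_le_coe_iff.2 (ha'.trans ?_))
  rw [le_div_iff₀ (by exact_mod_cast hnpos), Nat.cast_sum]
  exact hnV ⟨a, ha⟩

/-- If the followers' game has an equilibrium for some strategy, then the supremum is the payoff in
a worst equilibrium at a small strategy with a small perturbation. -/
theorem exists_small_isWorst_eq_supValue {S : ℕ} (hU : ∀ p a j, HeightLe (G.U p a j) S)
    (hV : ∀ a j, HeightLe (G.V a j) S) (hne : ∃ x ∈ G.strategies, ∃ a, G.IsNE x a) :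
    ∃ (n z : Fin G.l → ℕ) (a : G.Profile), (∀ j, n j ≤ 2 ^ vertexExp (G.l + 1) (2 * S + 1)) ∧
      (∀ j, z j ≤ 2 ^ vertexExp (G.l + 1) (2 * S + 1)) ∧ 0 < ∑ j, n j ∧ 0 < ∑ j, z j ∧
      G.IsWorst (fun j => (n j : ℝ)) (fun j => (z j : ℝ)) a ∧
      ((G.leaderUtility a (fun j => (n j : ℝ)) / (∑ j, n j : ℕ) : ℝ) : EReal) = G.supValue := by
  let N := 2 ^ vertexExp (G.l + 1) (2 * S + 1)
  let T : Set ((Fin G.l → ℕ) × (Fin G.l → ℕ) × G.Profile) := {t | (∀ j, t.1 j ≤ N) ∧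
    (∀ j, t.2.1 j ≤ N) ∧ 0 < ∑ j, t.1 j ∧ 0 < ∑ j, t.2.1 j ∧
      G.IsWorst (fun j => (t.1 j : ℝ)) (fun j => (t.2.1 j : ℝ)) t.2.2}
  have hT : T.Finite := by
    refine ((Set.finite_Iic fun _ => N).prod ((Set.finite_Iic fun _ => N).prod
      (Set.toFinite Set.univ))).subset ?_
    rintro t ⟨h1, h2, -⟩
    exact ⟨h1, h2, trivial⟩
  obtain ⟨x, hx, hxne⟩ := hne
  obtain ⟨n₁, z₁, a₁, h1⟩ := exists_small_isWorst hU hV hx hxne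
  obtain ⟨⟨n, z, a⟩, ⟨hn, hz, hnpos, hzpos, hworst⟩, hmax⟩ := Set.exists_max_image T
    (fun t => G.leaderUtility t.2.2 (fun j => (t.1 j : ℝ)) / (∑ j, t.1 j : ℕ)) hT
    ⟨(n₁, z₁, a₁), h1.1, h1.2.1, h1.2.2.1, h1.2.2.2.1, h1.2.2.2.2.1⟩
  refine ⟨n, z, a, hn, hz, hnpos, hzpos, hworst,
    le_antisymm (hworst.div_le_supValue hnpos hzpos) (iSup₂_le fun y hy => ?_)⟩
  by_cases hyne : ∃ a, G.IsNE y a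
  · obtain ⟨n₂, z₂, a₂, h2⟩ := exists_small_isWorst hU hV hy hyne
    exact h2.2.2.2.2.2.trans (EReal.coe_le_coe_iff.2
      (hmax (n₂, z₂, a₂) ⟨h2.1, h2.2.1, h2.2.2.1, h2.2.2.2.1, h2.2.2.2.2.1⟩))
  · rw [pessimistic, if_neg hyne]
    exact bot_le

/-- If the pessimistic utility reaches `q` at some strategy, then it does so at a small strategy:
the inequalities that say so are added to those for the set of equilibria. -/
theorem exists_small_of_le_pessimistic {S h : ℕ} (hU : ∀ p a j, HeightLe (G.U p a j) S)
    (hV : ∀ a j, HeightLe (G.V a j) S) {q : ℚ} (hq : HeightLe q h) (hSh : S ≤ h)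
    {x₀ : Fin G.l → ℝ} (hx₀ : x₀ ∈ G.strategies) (hne : ∃ a, G.IsNE x₀ a)
    (hle : ((q : ℝ) : EReal) ≤ G.pessimistic x₀) :
    ∃ (n : Fin G.l → ℕ) (a : G.Profile), (∀ j, n j ≤ 2 ^ vertexExp G.l (S + h + 1)) ∧
      0 < ∑ j, n j ∧ G.IsWorst (fun j => (n j : ℝ)) (fun j => (n j : ℝ)) a ∧
      (q : ℝ) ≤ G.leaderUtility a (fun j => (n j : ℝ)) / (∑ j, n j : ℕ) := by
  have hviol : ∀ a : {a // ¬G.IsNE x₀ a}, ∃ p b, G.loss x₀ a p b < 0 := by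
    intro a
    have := a.2
    rw [isNE_iff] at this
    push Not at this
    exact this
  -- a profitable deviation from each profile that is not an equilibrium
  choose p b hpb using hviol
  let C : {a // G.IsNE x₀ a} × Option G.Deviation → Fin G.l → ℚ := fun i =>
    i.2.elim (fun j => G.V i.1 j - q) fun d => G.lossRow i.1 d.1 d.2
  let D : {a // ¬G.IsNE x₀ a} → Fin G.l → ℚ := fun a j => -G.lossRow a (p a) (b a) j
  have hC : ∀ a d x, ((fun j => (C (a, some d) j : ℝ)) ⬝ᵥ x) = G.loss x a d.1 d.2 :=
    fun _ _ _ => rfl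
  have hC' : ∀ a x, ((fun j => (C (a, none) j : ℝ)) ⬝ᵥ x) =
      G.leaderUtility a x - q * ∑ j, x j := by
    intro a x
    simp [C, leaderUtility, dotProduct, sub_mul, Finset.mul_sum]
  have hD : ∀ a x, ((fun j => (D a j : ℝ)) ⬝ᵥ x) = -G.loss x a (p a) (b a) := by
    intro a x
    simp [D, loss, dotProduct]
  obtain ⟨n, hn, hnpos, hnC, hnD⟩ := exists_small_strict_solution C D (S + h + 1)
    (by
      rintro ⟨a, _ | d⟩ j
      · exact (hV _ _).sub hq
      · exact (heightLe_lossRow hU _ _ _ _).mono (by omega))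
    (fun a j => (heightLe_lossRow hU _ _ _ _).neg.mono (by omega)) x₀ hx₀.1
    (by rw [hx₀.2]; exact one_pos)
    (by
      rintro ⟨a, _ | d⟩
      · rw [hC', hx₀.2, mul_one, sub_nonneg]
        exact EReal.coe_le_coe_iff.1 (hle.trans (pessimistic_le a.2))
      · exact isNE_iff.1 a.2 _ _)
    (fun a => by
      rw [hD]
      exact neg_pos.2 (hpb a))
  have hiff := lexNE_iff_of_forall (x₀ := x₀) (x := fun j => (n j : ℝ)) (z := fun j => (n j : ℝ))
    (fun a ha p b => ⟨hnC (⟨a, ha⟩, some ⟨p, b⟩), hnC (⟨a, ha⟩, some ⟨p, b⟩)⟩)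
    (fun a ha => by
      have h1 := hnD ⟨a, ha⟩
      rw [hD, neg_pos] at h1
      exact ⟨_, _, h1.le, h1⟩)
  obtain ⟨a, ha, hworst⟩ := exists_isWorst hne hiff
  refine ⟨n, a, hn, hnpos, hworst, ?_⟩
  have h1 := hnC (⟨a, ha⟩, none)
  rw [hC', sub_nonneg] at h1
  rw [le_div_iff₀ (by exact_mod_cast hnpos), Nat.cast_sum]
  exact h1

end Game

/-! ### The algorithm -/

/-- A bound for the heights of the values of small strategies. -/
def valueExp (S : ℕ) : ℕ :=
  S * (S + vertexExp S (2 * S + 1) + 1) + (S + vertexExp S (2 * S + 1))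

/-- The weights of an optimal strategy may be chosen to be at most `2 ^ strategyExp S` if the game
has length `S`. -/
def strategyExp (S : ℕ) : ℕ := vertexExp S (S + valueExp S + 1)

namespace Game

variable (G : Game)

/-- Profiles of the followers are coded by numbers, in this base. -/
def profileBase : ℕ := 2 ^ len G

/-- Strategies of the leader are coded by numbers whose digits in this base are the weights of the
actions. -/
def weightBase : ℕ := 2 ^ (strategyExp (len G) + 1)

/-- The number of codes of profiles. -/
def profileCodes : ℕ := G.profileBase ^ G.k

/-- The number of codes of strategies. -/
def strategyCodes : ℕ := G.weightBase ^ G.l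

/-- The action of follower `q` in the profile with code `c`. -/
def action (c q : ℕ) : ℕ := digit G.profileBase c q

/-- The weight of action `j` in the strategy with code `x`. -/
def weight (x j : ℕ) : ℕ := digit G.weightBase x j

/-- The total weight of the strategy with code `x`. -/
def total (x : ℕ) : ℕ := ∑ j ∈ Finset.range G.l, G.weight x j

/-- The number `c` is the code of a profile. -/
def IsProfile (c : ℕ) : Prop := ∀ q < G.k, G.action c q < G.actions q

/-- `Game.loss` for codes of the strategy and of the profile. -/
noncomputable def codeLoss (x c p b : ℕ) : ℚ :=
  ∑ j ∈ Finset.range G.l, (G.payU p (G.action c) j -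
    G.payU p (fun q => if q = p then b else G.action c q) j) * G.weight x j

/-- The payoff of the leader, for codes of the strategy and of the profile. -/
noncomputable def codeValue (x c : ℕ) : ℚ :=
  (∑ j ∈ Finset.range G.l, G.payV (G.action c) j * G.weight x j) / G.total x

/-- `Game.LexNE` for codes. -/
def CodeLexNE (x z c : ℕ) : Prop :=
  G.IsProfile c ∧ ∀ p < G.k, ∀ b < G.actions p,
    0 < G.codeLoss x c p b ∨ G.codeLoss x c p b = 0 ∧ 0 ≤ G.codeLoss z c p b

/-- `Game.IsWorst` for codes. -/
def CodeIsWorst (x z c : ℕ) : Prop :=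
  0 < G.total x ∧ 0 < G.total z ∧ G.CodeLexNE x z c ∧
    ∀ c' < G.profileCodes, G.CodeLexNE x z c' → G.codeValue x c ≤ G.codeValue x c'

/-- The leader's payoff at `x` in the worst equilibrium `c` at `x` perturbed towards `z` is maximal
among all such payoffs. -/
def CodeIsBest (x z c : ℕ) : Prop :=
  G.CodeIsWorst x z c ∧ ∀ c' < G.profileCodes, ∀ x' < G.strategyCodes, ∀ z' < G.strategyCodes,
    G.CodeIsWorst x' z' c' → G.codeValue x' c' ≤ G.codeValue x c

/-- The profile at which the supremum is approached. -/
noncomputable def bestProfile : ℕ :=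
  leastBelow G.profileCodes fun c => ∃ x < G.strategyCodes, ∃ z < G.strategyCodes, G.CodeIsBest x z c

/-- The limit of strategies along which the supremum is approached. -/
noncomputable def bestLimit : ℕ :=
  leastBelow G.strategyCodes fun x => ∃ z < G.strategyCodes, G.CodeIsBest x z G.bestProfile

/-- A strategy at which the supremum is attained without a perturbation. -/
noncomputable def bestStrategy : ℕ :=
  leastBelow G.strategyCodes fun x => ∃ c < G.profileCodes, G.CodeIsBest x x c

open Classical in
/-- The code of the strategy that is returned, if there is one. If the followers never have an
equilibrium, then every strategy is optimal, and the first action of the leader, with the code `1`,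
is returned. -/
noncomputable def returnedCode : Option ℕ :=
  if G.bestProfile < G.profileCodes then
    if G.bestStrategy < G.strategyCodes then some G.bestStrategy else none
  else some 1

open Classical in
/-- The output of the algorithm. -/
noncomputable def solve : G.Output where
  value := if G.bestProfile < G.profileCodes then some (G.codeValue G.bestLimit G.bestProfile)
    else none
  strategy := G.returnedCode.map fun x j => (G.weight x j : ℚ) / G.total x

end Game

/-! ### The algorithm is computable in exponential time -/

theorem PolyBdd.vertexExp {n h : α → ℕ} (hn : PolyBdd n) (hh : PolyBdd h) :
    PolyBdd fun a => vertexExp (n a) (h a) :=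
  (hn.mul hn).add ((hh.mul (hn.add (.const 2))).mul hn)

theorem PolyBdd.strategyExp {n : α → ℕ} (hn : PolyBdd n) : PolyBdd fun a => strategyExp (n a) :=
  have h := hn.vertexExp (((PolyBdd.const 2).mul hn).add (.const 1))
  hn.vertexExp ((hn.add ((hn.mul ((hn.add h).add (.const 1))).add (hn.add h))).add (.const 1))

@[fun_prop]
theorem ExpComp.strategyExp {n : α → ℕ} (hn : ExpComp n) :
    ExpComp fun a => strategyExp (n a) := by
  unfold LeaderFollower.strategyExp LeaderFollower.valueExp LeaderFollower.vertexExp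
  fun_prop

@[fun_prop]
theorem ExpComp.profileBase {G : α → Game} (hG : ExpComp G) :
    ExpComp fun a => (G a).profileBase :=
  .pow (.const 2) hG.len hG.polyBdd

@[fun_prop]
theorem ExpComp.weightBase {G : α → Game} (hG : ExpComp G) : ExpComp fun a => (G a).weightBase :=
  .pow (.const 2) (by fun_prop) ((PolyBdd.strategyExp hG.polyBdd).add (.const 1))

@[fun_prop]
theorem ExpComp.profileCodes {G : α → Game} (hG : ExpComp G) :
    ExpComp fun a => (G a).profileCodes :=
  .pow (by fun_prop) (by fun_prop) hG.polyBdd_k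

@[fun_prop]
theorem ExpComp.strategyCodes {G : α → Game} (hG : ExpComp G) :
    ExpComp fun a => (G a).strategyCodes :=
  .pow (by fun_prop) (by fun_prop) hG.polyBdd_l

@[fun_prop]
theorem ExpComp.action {G : α → Game} {c q : α → ℕ} (hG : ExpComp G) (hc : ExpComp c)
    (hq : ExpComp q) : ExpComp fun a => (G a).action (c a) (q a) := by
  unfold Game.action
  fun_prop

@[fun_prop]
theorem ExpComp.weight {G : α → Game} {x j : α → ℕ} (hG : ExpComp G) (hx : ExpComp x)
    (hj : ExpComp j) : ExpComp fun a => (G a).weight (x a) (j a) := by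
  unfold Game.weight
  fun_prop

@[fun_prop]
theorem ExpComp.total {G : α → Game} {x : α → ℕ} (hG : ExpComp G) (hx : ExpComp x) :
    ExpComp fun a => (G a).total (x a) :=
  .sum_range_nat (by fun_prop) hG.polyBdd_l (by fun_prop)

theorem ExpComp.isProfile {G : α → Game} {c : α → ℕ} (hG : ExpComp G) (hc : ExpComp c) :
    ExpComp fun a => (G a).IsProfile (c a) :=
  .forall_lt (by fun_prop) (by fun_prop)

@[fun_prop]
theorem ExpComp.codeLoss {G : α → Game} {x c p b : α → ℕ} (hG : ExpComp G) (hx : ExpComp x)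
    (hc : ExpComp c) (hp : ExpComp p) (hb : ExpComp b) :
    ExpComp fun a => (G a).codeLoss (x a) (c a) (p a) (b a) :=
  .sum_range (by fun_prop) hG.polyBdd_l <| .rat_mul
    (.rat_sub (.payU (by fun_prop) (by fun_prop) (by fun_prop) (by fun_prop))
      (.payU (by fun_prop) (by fun_prop) (by fun_prop) (by fun_prop))) (by fun_prop)

@[fun_prop]
theorem ExpComp.codeValue {G : α → Game} {x c : α → ℕ} (hG : ExpComp G) (hx : ExpComp x)
    (hc : ExpComp c) : ExpComp fun a => (G a).codeValue (x a) (c a) :=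
  .rat_div_natCast (.sum_range (by fun_prop) hG.polyBdd_l <| .rat_mul
    (.payV (by fun_prop) (by fun_prop) (by fun_prop)) (by fun_prop)) (by fun_prop)

@[fun_prop]
theorem ExpComp.codeLexNE {G : α → Game} {x z c : α → ℕ} (hG : ExpComp G) (hx : ExpComp x)
    (hz : ExpComp z) (hc : ExpComp c) : ExpComp fun a => (G a).CodeLexNE (x a) (z a) (c a) :=
  .and (.isProfile hG hc) (.forall_lt (by fun_prop) (.forall_lt (by fun_prop) (by fun_prop)))

@[fun_prop]
theorem ExpComp.codeIsWorst {G : α → Game} {x z c : α → ℕ} (hG : ExpComp G) (hx : ExpComp x)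
    (hz : ExpComp z) (hc : ExpComp c) : ExpComp fun a => (G a).CodeIsWorst (x a) (z a) (c a) :=
  .and (by fun_prop) <| .and (by fun_prop) <| .and (by fun_prop) <|
    .forall_lt (by fun_prop) (.imp (by fun_prop) (by fun_prop))

@[fun_prop]
theorem ExpComp.codeIsBest {G : α → Game} {x z c : α → ℕ} (hG : ExpComp G) (hx : ExpComp x)
    (hz : ExpComp z) (hc : ExpComp c) : ExpComp fun a => (G a).CodeIsBest (x a) (z a) (c a) :=
  .and (by fun_prop) <| .forall_lt (by fun_prop) <| .forall_lt (by fun_prop) <|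
    .forall_lt (by fun_prop) (.imp (by fun_prop) (by fun_prop))

@[fun_prop]
theorem ExpComp.bestProfile {G : α → Game} (hG : ExpComp G) :
    ExpComp fun a => (G a).bestProfile :=
  .leastBelow (by fun_prop) (.exists_lt (by fun_prop) (.exists_lt (by fun_prop) (by fun_prop)))

@[fun_prop]
theorem ExpComp.bestLimit {G : α → Game} (hG : ExpComp G) : ExpComp fun a => (G a).bestLimit :=
  .leastBelow (by fun_prop) (.exists_lt (by fun_prop) (by fun_prop))

@[fun_prop]
theorem ExpComp.bestStrategy {G : α → Game} (hG : ExpComp G) :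
    ExpComp fun a => (G a).bestStrategy :=
  .leastBelow (by fun_prop) (.exists_lt (by fun_prop) (by fun_prop))

theorem ExpComp.strategyVec {G : α → Game} {x : α → ℕ} (hG : ExpComp G) (hx : ExpComp x) :
    ExpComp fun a => (List.range (G a).l).map
      fun j => ((G a).weight (x a) j : ℚ) / (G a).total (x a) :=
  .map_range (by fun_prop) hG.polyBdd_l (by fun_prop)

theorem encVec_eq {l : ℕ} (f : ℕ → ℚ) :
    encVec (fun j : Fin l => f j) = enc ((List.range l).map f) := by
  simp only [encVec, enc, List.map_map]
  congr 1
  refine List.ext_getElem (by simp) fun i h1 h2 => ?_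
  simp

theorem output_encode_eq (G : Game) (v : Option ℚ) (o : Option ℕ) (f : ℕ → ℕ → ℚ) :
    Game.Output.encode (G := G) ⟨v, o.map fun x j => f x j⟩ =
      enc (v, o.map fun x => (List.range G.l).map (f x)) := by
  cases o with
  | none => rfl
  | some x =>
    change Data.cons _ (.cons _ .nil) = .cons _ (.cons _ .nil)
    rw [encVec_eq]
    rfl

theorem exists_prog_solve : ∃ (c : Prog) (T : Game → ℕ), ExpBdd T ∧
    ∀ G, ∃ t ≤ T G, Runs c G.encode G.solve.encode t := by
  classical
  have hv : ExpComp fun G : Game => if G.bestProfile < G.profileCodes then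
      some (G.codeValue G.bestLimit G.bestProfile) else none := by fun_prop
  have hs : ExpComp fun G : Game => G.returnedCode.map fun x =>
      (List.range G.l).map fun j => (G.weight x j : ℚ) / G.total x := by
    refine .of_enc_eq (.ite (P := fun G : Game => G.bestProfile < G.profileCodes) (by fun_prop)
      (.ite (P := fun G : Game => G.bestStrategy < G.strategyCodes) (by fun_prop)
        (.some (.strategyVec .id (.bestStrategy .id))) (.const none))
      (.some (.strategyVec .id (.const 1)))) fun G => congrArg enc ?_
    unfold Game.returnedCode
    split_ifs <;> rfl
  obtain ⟨⟨c, T, hT, h⟩, -⟩ := hv.prodMk hs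
  refine ⟨c, T, hT, fun G => ?_⟩
  obtain ⟨t, ht, hr⟩ := h G
  refine ⟨t, ht, ?_⟩
  have henc := output_encode_eq G G.solve.value G.returnedCode
    fun x j => (G.weight x j : ℚ) / G.total x
  exact henc ▸ hr

/-! ### Correctness of the algorithm -/

theorem exists_digits {b k : ℕ} (f : Fin k → ℕ) (hf : ∀ i, f i < b) :
    ∃ c < b ^ k, ∀ i : Fin k, digit b c i = f i := by
  let e := finFunctionFinEquiv (m := b) (n := k)
  refine ⟨e fun i => ⟨f i, hf i⟩, (e _).2, fun i => ?_⟩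
  have h := congrFun (e.symm_apply_apply fun i => ⟨f i, hf i⟩) i
  exact congrArg Fin.val h

namespace Game

variable {G : Game}

/-- The profile with code `c`. -/
def profile (c : ℕ) (h : G.IsProfile c) : G.Profile :=
  fun q => ⟨G.action c q, forall_lt_actions.1 h q⟩

/-- The weights of the strategy with code `x`, as real numbers. -/
def weights (x : ℕ) (j : Fin G.l) : ℝ := G.weight x j

theorem exists_profileCode (a : G.Profile) :
    ∃ c < G.profileCodes, ∃ h : G.IsProfile c, profile c h = a := by
  obtain ⟨c, hc, hd⟩ := exists_digits (b := G.profileBase) (fun q => (a q : ℕ))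
    fun q => (a q).2.trans (G.m_lt q)
  refine ⟨c, hc, forall_lt_actions.2 fun q => ?_, ?_⟩
  · rw [action, hd]
    exact (a q).2
  · funext q
    exact Fin.ext (hd q)

theorem exists_strategyCode (n : Fin G.l → ℕ) (hn : ∀ j, n j < G.weightBase) :
    ∃ x < G.strategyCodes, ∀ j : Fin G.l, G.weight x j = n j :=
  exists_digits n hn

theorem total_eq (x : ℕ) : G.total x = ∑ j : Fin G.l, G.weight x j :=
  (Fin.sum_univ_eq_sum_range _ _).symm

theorem cast_codeLoss (x c : ℕ) (h : G.IsProfile c) (p : Fin G.k) (b : Fin (G.m p)) :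
    (G.codeLoss x c p b : ℝ) = G.loss (weights x) (profile c h) p b := by
  have h' := forall_lt_actions.1 h
  have hU₁ : ∀ j : Fin G.l, G.payU p (G.action c) j = G.U p (profile c h) j := fun j =>
    dif_pos ⟨p.2, j.2, h'⟩
  have hb : ∀ q : Fin G.k, (if (q : ℕ) = p then (b : ℕ) else G.action c q) =
      Function.update (profile c h) p b q := by
    intro q
    by_cases hq : q = p
    · subst hq
      simp
    · rw [Function.update_of_ne hq, if_neg (fun h => hq (Fin.ext h))]
      rfl
  have hU₂ : ∀ j : Fin G.l, G.payU p (fun q => if q = p then (b : ℕ) else G.action c q) j =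
      G.U p (Function.update (profile c h) p b) j := by
    intro j
    have h1 : ∀ q : Fin G.k, (if (q : ℕ) = p then (b : ℕ) else G.action c q) < G.m q := fun q => by
      rw [hb]
      exact Fin.is_lt _
    refine (dif_pos ⟨p.2, j.2, h1⟩).trans ?_
    congr 1
    funext q
    exact Fin.ext (hb q)
  rw [codeLoss, ← Fin.sum_univ_eq_sum_range (fun j => (G.payU p (G.action c) j -
    G.payU p (fun q => if q = p then (b : ℕ) else G.action c q) j) * G.weight x j)]
  simp only [hU₁, hU₂]
  simp [loss, lossRow, dotProduct, weights]

theorem cast_codeValue (x c : ℕ) (h : G.IsProfile c) :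
    (G.codeValue x c : ℝ) = G.leaderUtility (profile c h) (weights x) / G.total x := by
  have hV : ∀ j : Fin G.l, G.payV (G.action c) j = G.V (profile c h) j := fun j =>
    dif_pos ⟨j.2, forall_lt_actions.1 h⟩
  rw [codeValue, ← Fin.sum_univ_eq_sum_range (fun j => G.payV (G.action c) j * G.weight x j)]
  simp only [hV]
  simp [leaderUtility, weights]

theorem codeLexNE_iff {x z c : ℕ} :
    G.CodeLexNE x z c ↔ ∃ h, G.LexNE (weights x) (weights z) (profile c h) := by
  rw [CodeLexNE, ← exists_prop]
  refine exists_congr fun h => ?_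
  have key : ∀ (p : Fin G.k) (b : Fin (G.m p)),
      (0 < G.codeLoss x c p b ∨ G.codeLoss x c p b = 0 ∧ 0 ≤ G.codeLoss z c p b) ↔
      (0 < G.loss (weights x) (profile c h) p b ∨ G.loss (weights x) (profile c h) p b = 0 ∧
        0 ≤ G.loss (weights z) (profile c h) p b) := by
    intro p b
    rw [← cast_codeLoss, ← cast_codeLoss]
    norm_cast
  constructor
  · intro h1 p b
    exact (key p b).1 (h1 p p.2 b (by simp [actions]))
  · intro h1 p hp b hb
    have hb' : b < G.m ⟨p, hp⟩ := by simpa [actions, hp] using hb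
    exact (key ⟨p, hp⟩ ⟨b, hb'⟩).2 (h1 _ _)

theorem codeIsWorst_iff {x z c : ℕ} :
    G.CodeIsWorst x z c ↔ 0 < G.total x ∧ 0 < G.total z ∧
      ∃ h, G.IsWorst (weights x) (weights z) (profile c h) := by
  refine and_congr_right fun hx => and_congr_right fun _ => ?_
  have hx' : (0 : ℝ) < G.total x := by exact_mod_cast hx
  have key : ∀ c c' (h : G.IsProfile c) (h' : G.IsProfile c'), G.codeValue x c ≤ G.codeValue x c' ↔
      G.leaderUtility (profile c h) (weights x) ≤ G.leaderUtility (profile c' h') (weights x) := by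
    intro c c' h h'
    rw [← Rat.cast_le (K := ℝ), cast_codeValue x c h, cast_codeValue x c' h',
      div_le_div_iff_of_pos_right hx']
  rw [codeLexNE_iff]
  constructor
  · rintro ⟨⟨h, hlex⟩, hmin⟩
    refine ⟨h, hlex, fun a' ha' => ?_⟩
    obtain ⟨c', hc', h', rfl⟩ := exists_profileCode a'
    exact (key _ _ h h').1 (hmin c' hc' (codeLexNE_iff.2 ⟨h', ha'⟩))
  · rintro ⟨h, hlex, hmin⟩
    refine ⟨⟨h, hlex⟩, fun c' _ hl => ?_⟩
    obtain ⟨h', hl'⟩ := codeLexNE_iff.1 hl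
    exact (key _ _ h h').2 (hmin _ hl')

/-- The strategy with code `x`. -/
noncomputable def strategyOf (x : ℕ) : Fin G.l → ℝ := (G.total x : ℝ)⁻¹ • weights x

theorem strategyOf_mem {x : ℕ} (hx : 0 < G.total x) : strategyOf x ∈ G.strategies := by
  have := smul_mem_strategies (n := fun j : Fin G.l => G.weight x j) (by rwa [← total_eq])
  rwa [← total_eq] at this

theorem CodeIsWorst.le_supValue {x z c : ℕ} (h : G.CodeIsWorst x z c) :
    ((G.codeValue x c : ℝ) : EReal) ≤ G.supValue := by
  obtain ⟨hx, hz, hc, h⟩ := codeIsWorst_iff.1 h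
  rw [cast_codeValue x c hc]
  have := h.div_le_supValue (n := fun j => G.weight x j) (z := fun j => G.weight z j)
    (by rwa [← total_eq]) (by rwa [← total_eq])
  rwa [← total_eq] at this

theorem CodeIsWorst.le_pessimistic {x c : ℕ} (h : G.CodeIsWorst x x c) :
    ((G.codeValue x c : ℝ) : EReal) ≤ G.pessimistic (strategyOf x) := by
  obtain ⟨hx, -, hc, h⟩ := codeIsWorst_iff.1 h
  have hx' : (0 : ℝ) < (G.total x : ℝ)⁻¹ := inv_pos.2 (by exact_mod_cast hx)
  have h' := (isWorst_smul hx' hx').2 h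
  refine Game.le_pessimistic ⟨_, lexNE_self_iff.1 h'.1⟩ fun a ha => ?_
  rw [cast_codeValue x c hc, ← inv_mul_eq_div, ← leaderUtility_smul]
  exact_mod_cast h'.2 a (lexNE_self_iff.2 ha)

theorem exists_codeIsWorst {n z : Fin G.l → ℕ} {a : G.Profile} (hn : ∀ j, n j < G.weightBase)
    (hz : ∀ j, z j < G.weightBase) (hnpos : 0 < ∑ j, n j) (hzpos : 0 < ∑ j, z j)
    (h : G.IsWorst (fun j => (n j : ℝ)) (fun j => (z j : ℝ)) a) :
    ∃ x < G.strategyCodes, ∃ y < G.strategyCodes, ∃ c < G.profileCodes, G.CodeIsWorst x y c ∧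
      (∀ j : Fin G.l, G.weight x j = n j) ∧ (∀ j : Fin G.l, G.weight y j = z j) ∧
      (G.codeValue x c : ℝ) = G.leaderUtility a (fun j => (n j : ℝ)) / (∑ j, n j : ℕ) := by
  obtain ⟨x, hx, hxn⟩ := exists_strategyCode n hn
  obtain ⟨y, hy, hyz⟩ := exists_strategyCode z hz
  obtain ⟨c, hc, hc', rfl⟩ := exists_profileCode a
  have hwx : weights x = fun j => (n j : ℝ) := funext fun j => congrArg _ (hxn j)
  have hwy : weights y = fun j => (z j : ℝ) := funext fun j => congrArg _ (hyz j)
  have htx : G.total x = ∑ j, n j := by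
    rw [total_eq]
    exact Finset.sum_congr rfl fun j _ => hxn j
  have hty : G.total y = ∑ j, z j := by
    rw [total_eq]
    exact Finset.sum_congr rfl fun j _ => hyz j
  refine ⟨x, hx, y, hy, c, hc, codeIsWorst_iff.2 ⟨htx ▸ hnpos, hty ▸ hzpos, hc', ?_⟩, hxn, hyz, ?_⟩
  · rwa [hwx, hwy]
  · rw [cast_codeValue x c hc', hwx, htx]

theorem heightLe_U (p : Fin G.k) (a : G.Profile) (j : Fin G.l) : HeightLe (G.U p a j) (len G) :=
  (heightLe_len _).mono (G.len_U_le p a j)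

theorem heightLe_V (a : G.Profile) (j : Fin G.l) : HeightLe (G.V a j) (len G) :=
  (heightLe_len _).mono (G.len_V_le a j)

theorem heightLe_codeValue {x c : ℕ} (hc : G.IsProfile c)
    (hx : ∀ j : Fin G.l, G.weight x j ≤ 2 ^ vertexExp (len G) (2 * len G + 1)) :
    HeightLe (G.codeValue x c) (valueExp (len G)) := by
  have hl := G.l_lt_len
  have hV : ∀ j < G.l, HeightLe (G.payV (G.action c) j) (len G) := fun j hj => by
    rw [payV, dif_pos ⟨hj, forall_lt_actions.1 hc⟩]
    exact heightLe_V _ _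
  have htot : G.total x ≤ 2 ^ (len G + vertexExp (len G) (2 * len G + 1)) := by
    rw [total_eq, pow_add]
    calc _ ≤ ∑ _j : Fin G.l, 2 ^ vertexExp (len G) (2 * len G + 1) :=
          Finset.sum_le_sum fun j _ => hx j
      _ = G.l * 2 ^ vertexExp (len G) (2 * len G + 1) := by simp
      _ ≤ _ := Nat.mul_le_mul_right _ (hl.le.trans Nat.lt_two_pow_self.le)
  rw [codeValue, div_eq_mul_inv]
  refine (HeightLe.mul (HeightLe.sum fun j hj =>
    (hV j hj).mul (.natCast (hx ⟨j, hj⟩))) (.inv_natCast htot)).mono ?_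
  unfold valueExp
  gcongr

theorem lt_weightBase {n : ℕ} (h : n ≤ 2 ^ strategyExp (len G)) : n < G.weightBase :=
  h.trans_lt (Nat.pow_lt_pow_right one_lt_two (Nat.lt_succ_self _))

theorem le_valueExp (S : ℕ) : S ≤ valueExp S := by
  unfold valueExp
  omega

theorem vertexExp_le_strategyExp (S : ℕ) : vertexExp S (2 * S + 1) ≤ strategyExp S :=
  vertexExp_mono le_rfl (by have := le_valueExp S; omega)

/-- If the followers' game has an equilibrium for some strategy, then the supremum is the value of
codes whose weights are so small that their value has bounded height. -/
theorem exists_codeIsWorst_eq_supValue (hne : ∃ x ∈ G.strategies, ∃ a, G.IsNE x a) :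
    ∃ x < G.strategyCodes, ∃ y < G.strategyCodes, ∃ c < G.profileCodes, G.CodeIsWorst x y c ∧
      ((G.codeValue x c : ℝ) : EReal) = G.supValue ∧
      HeightLe (G.codeValue x c) (valueExp (len G)) := by
  obtain ⟨n, z, a, hn, hz, hnpos, hzpos, hworst, hval⟩ :=
    exists_small_isWorst_eq_supValue (S := len G) heightLe_U heightLe_V hne
  have hle : 2 ^ vertexExp (G.l + 1) (2 * len G + 1) ≤ 2 ^ vertexExp (len G) (2 * len G + 1) :=
    Nat.pow_le_pow_right two_pos (vertexExp_mono G.l_lt_len le_rfl)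
  have hle' := Nat.pow_le_pow_right two_pos (vertexExp_le_strategyExp (len G))
  obtain ⟨x, hx, y, hy, c, hc, hw, hxn, -, hv⟩ := exists_codeIsWorst
    (fun j => lt_weightBase (((hn j).trans hle).trans hle'))
    (fun j => lt_weightBase (((hz j).trans hle).trans hle')) hnpos hzpos hworst
  refine ⟨x, hx, y, hy, c, hc, hw, by rw [hv, hval], ?_⟩
  exact heightLe_codeValue (codeIsWorst_iff.1 hw).2.2.choose fun j => by
    rw [hxn]
    exact (hn j).trans hle

theorem codeIsBest_of_eq {x z c : ℕ} (h : G.CodeIsWorst x z c)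
    (hv : ((G.codeValue x c : ℝ) : EReal) = G.supValue) : G.CodeIsBest x z c := by
  refine ⟨h, fun c' _ x' _ z' _ h' => ?_⟩
  have := h'.le_supValue
  rw [← hv, EReal.coe_le_coe_iff] at this
  exact_mod_cast this

theorem supValue_eq_bot (hne : ¬∃ x ∈ G.strategies, ∃ a, G.IsNE x a) : G.supValue = ⊥ := by
  refine le_bot_iff.1 (iSup₂_le fun y hy => ?_)
  rw [pessimistic, if_neg fun h => hne ⟨y, hy, h⟩]

theorem CodeIsBest.eq_supValue {x z c : ℕ} (h : G.CodeIsBest x z c) :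
    ((G.codeValue x c : ℝ) : EReal) = G.supValue := by
  refine le_antisymm h.1.le_supValue ?_
  have hne : ∃ x ∈ G.strategies, ∃ a, G.IsNE x a := by
    by_contra hne
    have h2 := h.1.le_supValue
    rw [supValue_eq_bot hne, le_bot_iff] at h2
    exact EReal.coe_ne_bot _ h2
  obtain ⟨x', hx', z', hz', c', hc', hw, hv, -⟩ := exists_codeIsWorst_eq_supValue hne
  rw [← hv, EReal.coe_le_coe_iff]
  exact_mod_cast h.2 c' hc' x' hx' z' hz' hw

theorem total_one_pos : 0 < G.total 1 := by
  have hB : 1 < G.weightBase := Nat.one_lt_two_pow (Nat.succ_ne_zero _)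
  rw [total_eq]
  refine lt_of_lt_of_le ?_ (Finset.single_le_sum (fun j _ => Nat.zero_le _)
    (Finset.mem_univ (⟨0, G.l_pos⟩ : Fin G.l)))
  simp [weight, digit, Nat.mod_eq_of_lt hB]

theorem isMaximiser_strategyOf {x c : ℕ} (h : G.CodeIsBest x x c) :
    G.IsMaximiser (strategyOf x) := by
  have hx := strategyOf_mem (codeIsWorst_iff.1 h.1).1
  exact ⟨hx, le_antisymm (pessimistic_le_supValue hx) (h.eq_supValue ▸ h.1.le_pessimistic)⟩

/-- If the supremum is attained, then the search for a pair `(x, x)` succeeds. The bound on the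
height of the supremum, which enters the inequalities for `x`, makes `x` small. -/
theorem exists_codeIsBest_self (hne : ∃ x ∈ G.strategies, ∃ a, G.IsNE x a)
    (hmax : ∃ x, G.IsMaximiser x) :
    ∃ x < G.strategyCodes, ∃ c < G.profileCodes, G.CodeIsBest x x c := by
  obtain ⟨x₁, -, z₁, -, c₁, -, -, hv, hh⟩ := exists_codeIsWorst_eq_supValue hne
  obtain ⟨x₀, hx₀, hsup⟩ := hmax
  have hNE : ∃ a, G.IsNE x₀ a := by
    by_contra h
    rw [pessimistic, if_neg h, ← hv] at hsup
    exact EReal.coe_ne_bot _ hsup.symm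
  obtain ⟨n, a, hn, hnpos, hworst, hle⟩ := exists_small_of_le_pessimistic (S := len G) heightLe_U
    heightLe_V hh (le_valueExp _) hx₀ hNE (by rw [hv, hsup])
  have hle' : 2 ^ vertexExp G.l (len G + valueExp (len G) + 1) ≤ 2 ^ strategyExp (len G) :=
    Nat.pow_le_pow_right two_pos (vertexExp_mono G.l_lt_len.le le_rfl)
  have hn' := fun j => lt_weightBase ((hn j).trans hle')
  obtain ⟨x, hx, y, hy, c, hc, hw, hxn, hyn, hval⟩ :=
    exists_codeIsWorst hn' hn' hnpos hnpos hworst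
  have hwxy : (weights y : Fin G.l → ℝ) = weights x := funext fun j => by
    rw [weights, weights, hxn, hyn]
  have hw' : G.CodeIsWorst x x c := by
    rw [codeIsWorst_iff, hwxy] at hw
    exact codeIsWorst_iff.2 ⟨hw.1, hw.1, hw.2.2⟩
  refine ⟨x, hx, c, hc, codeIsBest_of_eq hw' (le_antisymm hw'.le_supValue ?_)⟩
  rw [← hv, EReal.coe_le_coe_iff, hval]
  exact hle

theorem bestProfile_lt_iff :
    G.bestProfile < G.profileCodes ↔ ∃ x ∈ G.strategies, ∃ a, G.IsNE x a := by
  constructor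
  · intro h
    obtain ⟨x, -, z, -, hb⟩ := leastBelow_spec h
    by_contra hne
    have := hb.eq_supValue
    rw [supValue_eq_bot hne] at this
    exact EReal.coe_ne_bot _ this
  · intro hne
    obtain ⟨x, hx, z, hz, c, hc, hw, hv, -⟩ := exists_codeIsWorst_eq_supValue hne
    exact leastBelow_lt ⟨c, hc, x, hx, z, hz, codeIsBest_of_eq hw hv⟩

theorem solve_value : G.solve.valueEReal = G.supValue := by
  by_cases h : G.bestProfile < G.profileCodes
  · obtain ⟨z, -, hb⟩ := leastBelow_spec (leastBelow_lt (leastBelow_spec h))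
    simp only [Output.valueEReal, solve, if_pos h]
    exact hb.eq_supValue
  · simp only [Output.valueEReal, solve, if_neg h]
    exact (supValue_eq_bot (mt bestProfile_lt_iff.2 h)).symm

theorem exists_solve_strategy (hmax : ∃ x, G.IsMaximiser x) : ∃ y, G.solve.strategy = some y := by
  obtain ⟨x, hx⟩ : ∃ x, G.returnedCode = some x := by
    unfold returnedCode
    split_ifs with h h'
    · exact ⟨_, rfl⟩
    · exact absurd (leastBelow_lt (exists_codeIsBest_self (bestProfile_lt_iff.1 h) hmax)) h'
    · exact ⟨_, rfl⟩
  exact ⟨_, congrArg (Option.map _) hx⟩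

theorem solve_strategy {y : Fin G.l → ℚ} (hy : G.solve.strategy = some y) :
    G.IsMaximiser fun j => (y j : ℝ) := by
  obtain ⟨x, hx, rfl⟩ := Option.map_eq_some_iff.1 hy
  have hxy : (fun j : Fin G.l => (((G.weight x j : ℚ) / G.total x : ℚ) : ℝ)) = strategyOf x := by
    funext j
    simp [strategyOf, weights, div_eq_inv_mul]
  rw [hxy]
  unfold returnedCode at hx
  split_ifs at hx with h₁ h₂
  · obtain rfl := Option.some_injective _ hx
    obtain ⟨c, -, hb⟩ := leastBelow_spec h₂
    exact isMaximiser_strategyOf hb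
  · obtain rfl := Option.some_injective _ hx
    refine ⟨strategyOf_mem total_one_pos, ?_⟩
    rw [supValue_eq_bot (mt bestProfile_lt_iff.2 h₁), pessimistic, if_neg]
    exact fun h => h₁ (bestProfile_lt_iff.2 ⟨_, strategyOf_mem total_one_pos, h⟩)

end Game

/-! ### The length of the encoding of a game -/

theorem size_encList_ofFn {n : ℕ} (f : Fin n → Data) :
    (encList (List.ofFn f)).size = 1 + ∑ i, ((f i).size + 1) := by
  induction n with
  | zero => simp [encList, Data.size]
  | succ n ih =>
    rw [List.ofFn_succ, encList, Data.size, ih, Fin.sum_univ_succ]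
    ring

theorem one_le_bitSize (q : ℚ) : 1 ≤ bitSize q := by
  have : 0 < q.den.size := Nat.size_pos.2 q.den_pos
  unfold bitSize
  omega

theorem size_encRat_le (q : ℚ) : (encRat q).size ≤ 4 * bitSize q + 7 := by
  have h1 := len_nat_le q.num.natAbs
  have h2 := len_nat_le q.den
  have h3 := len_bool (decide (q.num < 0))
  have h4 := len_rat q
  change (encBool _).size ≤ 3 at h3
  change (encRat q).size = _ at h4
  unfold bitSize
  omega

theorem size_encVec_le {l : ℕ} (x : Fin l → ℚ) : (encVec x).size ≤ 1 + 12 * ∑ j, bitSize (x j) := by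
  rw [encVec, size_encList_ofFn, Finset.mul_sum]
  refine add_le_add le_rfl (Finset.sum_le_sum fun j _ => ?_)
  have h1 := size_encRat_le (x j)
  have h2 := one_le_bitSize (x j)
  omega

/-- A table has at most `2 * k` inner nodes per entry, because every player has an action. -/
theorem size_encTable_le {k : ℕ} (m : Fin k → ℕ) (hm : ∀ p, 0 < m p)
    (T : ((p : Fin k) → Fin (m p)) → Data) :
    (encTable m T).size ≤ ∑ a, ((T a).size + 2 * k) := by
  induction k with
  | zero =>
    rw [encTable, Fintype.sum_unique]
    exact (congrArg (fun a => (T a).size) (Subsingleton.elim _ _)).le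
  | succ k ih =>
    rw [encTable, size_encList_ofFn]
    have h1 := fun i => ih (fun p => m p.succ) (fun p => hm _)
      (fun a => T (Fin.cons (α := fun p => Fin (m p)) i a))
    rw [← (Fin.consEquiv fun p => Fin (m p)).sum_comp, Fintype.sum_prod_type]
    have h0 : 1 ≤ Fintype.card ((p : Fin k) → Fin (m p.succ)) :=
      Fintype.card_pos_iff.2 ⟨fun p => ⟨0, hm _⟩⟩
    calc 1 + ∑ i, ((encTable (fun p => m p.succ)
          fun a => T (Fin.cons (α := fun p => Fin (m p)) i a)).size + 1)
        ≤ ∑ _i : Fin (m 0), 1 + ∑ i : Fin (m 0),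
            (∑ a, ((T (Fin.cons (α := fun p => Fin (m p)) i a)).size + 2 * k) + 1) := by
          gcongr with i
          · simpa using Nat.succ_le_of_lt (hm 0)
          · exact h1 i
      _ = ∑ i : Fin (m 0),
            (∑ a, ((T (Fin.cons (α := fun p => Fin (m p)) i a)).size + 2 * k) + 2) := by
          rw [← Finset.sum_add_distrib]
          exact Finset.sum_congr rfl fun _ _ => by ring
      _ ≤ _ := by
          refine Finset.sum_le_sum fun i _ => ?_
          simp only [Finset.sum_add_distrib, Finset.sum_const, Finset.card_univ, smul_eq_mul]
          simp only [Fin.consEquiv, Equiv.coe_fn_mk]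
          rw [add_assoc]
          refine add_le_add le_rfl ?_
          nlinarith

namespace Game

variable (G : Game)

theorem card_profile_pos : 0 < Fintype.card G.Profile :=
  Fintype.card_pos_iff.2 ⟨fun p => ⟨0, G.m_pos p⟩⟩

/-- Every profile and action of the leader come with a payoff of the leader and of each follower. -/
theorem card_mul_le_size : Fintype.card G.Profile * G.l * (G.k + 1) ≤ G.size := by
  have h : ∀ (a : G.Profile) (j : Fin G.l),
      G.k + 1 ≤ bitSize (G.V a j) + ∑ p, bitSize (G.U p a j) := by
    intro a j
    have h1 : ∑ _p : Fin G.k, 1 ≤ ∑ p, bitSize (G.U p a j) :=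
      Finset.sum_le_sum fun p _ => one_le_bitSize _
    have h2 := one_le_bitSize (G.V a j)
    simp only [Finset.sum_const, Finset.card_univ, Fintype.card_fin, smul_eq_mul, mul_one] at h1
    omega
  calc _ = ∑ _a : G.Profile, ∑ _j : Fin G.l, (G.k + 1) := by simp [mul_assoc]
    _ ≤ _ := Finset.sum_le_sum fun a _ => Finset.sum_le_sum fun j _ => h a j

theorem m_le_card (p : Fin G.k) : G.m p ≤ Fintype.card G.Profile := by
  refine Nat.le_of_dvd G.card_profile_pos ?_
  rw [Fintype.card_pi]
  simpa using Finset.dvd_prod_of_mem (fun p => Fintype.card (Fin (G.m p))) (Finset.mem_univ p)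

theorem size_table_le (W : G.Profile → Fin G.l → ℚ) :
    (encTable G.m fun a => encVec (W a)).size ≤
      Fintype.card G.Profile * (2 * G.k + 1) + 12 * ∑ a, ∑ j, bitSize (W a j) := by
  refine (size_encTable_le G.m G.m_pos _).trans ?_
  calc _ ≤ ∑ a : G.Profile, ((2 * G.k + 1) + 12 * ∑ j, bitSize (W a j)) :=
        Finset.sum_le_sum fun a _ => by
          have := size_encVec_le (W a)
          omega
    _ = _ := by
        rw [Finset.sum_add_distrib, Finset.mul_sum]
        simp

theorem size_encode_le : G.encode.size ≤ 6 * G.size ^ 2 + 40 * G.size + 6 := by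
  have hs := G.card_mul_le_size
  have hN := G.card_profile_pos
  have hl := G.l_pos
  set N := Fintype.card G.Profile
  set s := G.size with hsdef
  have hsum : ∑ a, ∑ j, bitSize (G.V a j) + ∑ p, ∑ a, ∑ j, bitSize (G.U p a j) = s := by
    rw [hsdef, size, Finset.sum_comm (s := (Finset.univ : Finset (Fin G.k))),
      ← Finset.sum_add_distrib]
    refine Finset.sum_congr rfl fun a _ => ?_
    rw [Finset.sum_comm (s := (Finset.univ : Finset (Fin G.k))), ← Finset.sum_add_distrib]
  have h1 : N * (G.k + 1) ≤ s := (Nat.mul_le_mul_right _ (Nat.le_mul_of_pos_right N hl)).trans hs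
  have hls : G.l ≤ s := le_trans (by nlinarith [Nat.mul_le_mul hN hl]) hs
  have hks : G.k + 1 ≤ s := le_trans (by nlinarith) h1
  have hNs : N ≤ s := le_trans (by nlinarith) h1
  have hm : (encList (List.ofFn fun p => encNat (G.m p))).size ≤ 1 + G.k * (4 * s + 2) := by
    rw [size_encList_ofFn]
    refine add_le_add le_rfl ?_
    calc _ ≤ ∑ _p : Fin G.k, (4 * s + 2) := Finset.sum_le_sum fun p _ => by
          have h2 := len_nat_le_of_lt (Nat.lt_two_pow_self (n := G.m p))
          have h3 := G.m_le_card p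
          change (encNat _).size ≤ _ at h2
          omega
      _ = _ := by simp
  have hl' : (encNat G.l).size ≤ 4 * s + 1 := by
    have := len_nat_le_of_lt (Nat.lt_two_pow_self (n := G.l))
    change (encNat _).size ≤ _ at this
    omega
  have hV := G.size_table_le G.V
  have hU : (encList (List.ofFn fun p => encTable G.m fun a => encVec (G.U p a))).size ≤
      1 + G.k * (N * (2 * G.k + 1) + 1) + 12 * ∑ p, ∑ a, ∑ j, bitSize (G.U p a j) := by
    rw [size_encList_ofFn, add_assoc]
    refine add_le_add le_rfl ?_
    calc _ ≤ ∑ p : Fin G.k, ((N * (2 * G.k + 1) + 1) + 12 * ∑ a, ∑ j, bitSize (G.U p a j)) :=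
          Finset.sum_le_sum fun p _ => by
            exact (Nat.add_le_add_right (G.size_table_le (G.U p)) 1).trans (Nat.add_right_comm _ _ _).le
      _ = _ := by
          rw [Finset.sum_add_distrib, Finset.mul_sum]
          simp
  have h2 : N * (2 * G.k + 1) ≤ 2 * s := by nlinarith
  have h3 : G.k * (N * (2 * G.k + 1) + 1) ≤ s * (2 * s + 1) :=
    Nat.mul_le_mul (by omega) (by omega)
  have h4 : G.k * (4 * s + 2) ≤ s * (4 * s + 2) := Nat.mul_le_mul (by omega) le_rfl
  simp only [encode, Data.size]
  nlinarith

end Game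

end LeaderFollower

theorem theorem4 :
    ∃ (c : LeaderFollower.Prog) (q : Polynomial ℕ), ∀ G : LeaderFollower.Game,
      ∃ (r : G.Output) (t : ℕ),
        -- on the encoded game, the program halts with the output `r` after `t` steps
        LeaderFollower.Runs c G.encode r.encode t ∧ t ≤ 2 ^ q.eval G.size ∧
        -- the returned value is the supremum
        r.valueEReal = G.supValue ∧
        -- if the supremum is attained, a strategy is returned
        ((∃ x, G.IsMaximiser x) → ∃ y, r.strategy = some y) ∧
        -- a returned strategy is a maximising strategy
        (∀ y, r.strategy = some y → G.IsMaximiser (fun j => (y j : ℝ))) := by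
  obtain ⟨c, T, ⟨g, ⟨p, hp⟩, hT⟩, h⟩ := LeaderFollower.exists_prog_solve
  refine ⟨c, p.comp (6 * X ^ 2 + 40 * X + 6), fun G => ?_⟩
  obtain ⟨t, ht, hr⟩ := h G
  refine ⟨G.solve, t, hr, ?_, LeaderFollower.Game.solve_value,
    LeaderFollower.Game.exists_solve_strategy, fun y => LeaderFollower.Game.solve_strategy⟩
  refine ht.trans ((hT G).trans (Nat.pow_le_pow_right two_pos ((hp G).trans ?_)))
  rw [eval_comp]
  refine LeaderFollower.eval_mono p ?_
  change G.encode.size ≤ _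
  simpa using G.size_encode_le
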